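/- **Theorem 2.1.** Let $G$ be a compact connected Lie group with Lie algebra $\mathfrak g$, let $(\xi_a)$ be a basis of $\mathfrak g$ and $\Theta^a\in S^1(\mathfrak g^*)$ the dual basis. Let $W$ be a compact smooth $G$-manifold, possibly with boundary, which is a degenerate principal $G$-bundle, i.e. $G$ acts locally freely (with discrete stabilizers) on some open subset of $W$ containing $\partial W$. For $\xi\in\mathfrak g$ let $X_\xi(x)=\frac{d}{dt}\big|_{t=0}\exp(-t\xi)\cdot x$ be the fundamental vector field and $\iota_a$ the contraction with $X_{\xi_a}$. Let $W^s$ be the set of points of $W$ whose stabilizer has positive dimension and $W^0=W\setminus W^s$. Let $f:W\to[0,1]$ be a smooth $G$-invariant function that vanishes on an open neighbourhood $U$ of $W^s$ and equals $1$ outside an open neighbourhood $V\supseteq\overline U$. Let $\omega$ be a connection on $W^0$: a smooth $\mathfrak g$-valued $1$-form on $W^0$ with $\omega(X_\xi)=\xi$ for $\xi\in\mathfrak g$ and $\omega_{gx}(g_*v)=\mathrm{Ad}(g)\,\omega_x(v)$ for $g\in G$, $x\in W^0$, $v\in T_xW$. Let $\omega_f=f\omega\in\Omega^1(W)\otimes\mathfrak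 g$ (extended by $0$) be the degenerate connection and $$\Omega_f^G=d\omega_f+\tfrac12[\omega_f,\omega_f]-(-1+f)\,\xi_a\Theta^a=\sum_a \Omega^a\,\xi_a ,\qquad \Omega^a\in S(\mathfrak g^*)\otimes\Omega(W),$$ its equivariant degenerate curvature. Let $CW_f: S(\mathfrak g^*)\to S(\mathfrak g^*)\otimes\Omega(W)$, $F\mapsto F(\Omega_f^G)$, be the algebra homomorphism given by $CW_f(l)=\sum_a l(\xi_a)\,\Omega^a$ for $l\in\mathfrak g^*$. Let $\Omega_G(W)=(S(\mathfrak g^*)\otimes\Omega(W))^G$, let $D=1\otimes d-\sum_a\Theta^a\otimes\iota_a$, and let $H_G^*(W)=H(\Omega_G(W),D)$ be the equivariant cohomology of $W$ in the Cartan model, where elements of $\mathfrak g^*$ have degree $2$. Then for every $F\in S(\mathfrak g^*)^G$ one has $F(\Omega_f^G)\in\Omega_G(W)$ and $D\,F(\Omega_f^G)=0$; if $F$ is homogeneous of polynomial degree $q$, then $F(\Omega_f^G)$ has total degree $2q$; and $F\mapsto[F(\Omega_f^G)]$ is a homomorphism of algebras $$cw_f: S(\mathfrak g^*)^G\to H_G^*(W),$$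 the degenerate Chern–Weil homomorphism. -/

import Mathlib

open Set Filter Topology Module
open scoped Manifold ContDiff TensorProduct


namespace DegCW

noncomputable section

/-! ### Exterior forms on a real vector space -/

section Linear

variable {V V' V'' : Type*} [AddCommGroup V] [Module ℝ V] [AddCommGroup V'] [Module ℝ V']
  [AddCommGroup V''] [Module ℝ V'']

/-- Exterior forms on `V`: the exterior algebra `Λ(V*)`. -/
abbrev Form (V : Type*) [AddCommGroup V] [Module ℝ V] : Type _ :=
  ExteriorAlgebra ℝ (Dual ℝ V)

/-- A covector as a form of degree one. -/
def oneForm : Dual ℝ V →ₗ[ℝ] Form V := ExteriorAlgebra.ι ℝ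

/-- Pullback of exterior forms along a linear map. -/
def pull (A : V →ₗ[ℝ] V') : Form V' →ₐ[ℝ] Form V := ExteriorAlgebra.map A.dualMap

/-- Contraction (interior product) of an exterior form with a vector. -/
def contr (v : V) : Form V →ₗ[ℝ] Form V :=
  CliffordAlgebra.contractLeft (Dual.eval ℝ V v)

/-- The sign automorphism of `Λ(V*)`, equal to `(-1) ^ q` on forms of degree `q`. -/
def parity : Form V →ₐ[ℝ] Form V := CliffordAlgebra.involute

theorem form_induction {C : Form V → Prop}
    (h0 : ∀ r : ℝ, C (algebraMap ℝ (Form V) r)) (h1 : ∀ x : Dual ℝ V, C (oneForm x))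
    (hm : ∀ a b, C a → C b → C (a * b)) (ha : ∀ a b, C a → C b → C (a + b)) (a : Form V) : C a :=
  ExteriorAlgebra.induction h0 h1 hm ha a

@[simp] theorem pull_oneForm (A : V →ₗ[ℝ] V') (l : Dual ℝ V') :
    pull A (oneForm l) = oneForm (l ∘ₗ A) := ExteriorAlgebra.map_apply_ι _ _

@[simp] theorem parity_oneForm (l : Dual ℝ V) : parity (oneForm l) = - oneForm l :=
  CliffordAlgebra.involute_ι _

theorem parity_parity (u : Form V) : parity (parity u) = u :=
  CliffordAlgebra.involute_involute u

theorem contr_algebraMap (v : V) (r : ℝ) : contr v (algebraMap ℝ (Form V) r) = 0 :=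
  CliffordAlgebra.contractLeft_algebraMap _ _ _

theorem contr_oneForm_mul (v : V) (l : Dual ℝ V) (u : Form V) :
    contr v (oneForm l * u) = l v • u - oneForm l * contr v u :=
  CliffordAlgebra.contractLeft_ι_mul _ _ _

theorem contr_oneForm (v : V) (l : Dual ℝ V) :
    contr v (oneForm l) = algebraMap ℝ (Form V) (l v) :=
  CliffordAlgebra.contractLeft_ι _ _ _

theorem contr_mul (v : V) (u w : Form V) :
    contr v (u * w) = contr v u * w + parity u * contr v w := by
  induction u using form_induction generalizing w with
  | h0 r =>
    rw [contr_algebraMap, zero_mul, zero_add, AlgHom.commutes, ← Algebra.smul_def,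
      ← Algebra.smul_def, map_smul]
  | h1 l => rw [contr_oneForm_mul, contr_oneForm, parity_oneForm, Algebra.smul_def]; noncomm_ring
  | hm a b ha hb => rw [mul_assoc, ha, hb, ha, map_mul]; noncomm_ring
  | ha a b ha hb => rw [add_mul, map_add, ha, hb, map_add, map_add]; noncomm_ring

theorem contr_one (v : V) : contr v (1 : Form V) = 0 := CliffordAlgebra.contractLeft_one _ _

theorem contr_parity (v : V) (u : Form V) : contr v (parity u) = - parity (contr v u) := by
  induction u using form_induction with
  | h0 r => rw [AlgHom.commutes, contr_algebraMap, map_zero, neg_zero]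
  | h1 l => rw [parity_oneForm, map_neg, contr_oneForm, AlgHom.commutes]
  | hm a b ha hb => rw [map_mul, contr_mul, contr_mul, ha, hb, map_add, map_mul, map_mul]; noncomm_ring
  | ha a b ha hb => rw [map_add, map_add, ha, hb, map_add, map_add]; abel

theorem pull_smul (A : V →ₗ[ℝ] V') (c : ℝ) (u : Form V') : pull A (c • u) = c • pull A u :=
  map_smul (pull A) c u

theorem pull_parity (A : V →ₗ[ℝ] V') (u : Form V') : pull A (parity u) = parity (pull A u) := by
  induction u using form_induction with
  | h0 r => simp
  | h1 l => simp
  | hm a b ha hb => simp [ha, hb]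
  | ha a b ha hb => simp [ha, hb]

theorem pull_contr (A : V →ₗ[ℝ] V') (v : V) (u : Form V') :
    pull A (contr (A v) u) = contr v (pull A u) := by
  induction u using form_induction with
  | h0 r => rw [contr_algebraMap, AlgHom.commutes, contr_algebraMap, map_zero]
  | h1 l => rw [contr_oneForm, pull_oneForm, contr_oneForm, AlgHom.commutes]; rfl
  | hm a b ha hb => rw [contr_mul, map_add, map_mul, map_mul, map_mul, contr_mul, ha, hb,
      pull_parity]
  | ha a b ha hb => simp [ha, hb]

theorem pull_pull (A : V →ₗ[ℝ] V') (B : V' →ₗ[ℝ] V'') (u : Form V'') :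
    pull A (pull B u) = pull (B ∘ₗ A) u := by
  induction u using form_induction with
  | h0 r => simp
  | h1 l => simp [LinearMap.comp_assoc]
  | hm a b ha hb => simp [ha, hb]
  | ha a b ha hb => simp [ha, hb]

@[simp] theorem pull_id (u : Form V) : pull LinearMap.id u = u := by
  induction u using form_induction with
  | h0 r => simp
  | h1 l => simp
  | hm a b ha hb => simp [ha, hb]
  | ha a b ha hb => simp [ha, hb]

theorem oneForm_mul_swap (l m : Dual ℝ V) : oneForm l * oneForm m = - (oneForm m * oneForm l) :=
  eq_neg_of_add_eq_zero_left (ExteriorAlgebra.ι_add_mul_swap l m)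

/-- A product of two covectors commutes with every form. -/
theorem oneForm_mul_oneForm_comm (l m : Dual ℝ V) (u : Form V) :
    Commute (oneForm l * oneForm m) u := by
  induction u using form_induction with
  | h0 r => exact (Algebra.commutes r _).symm
  | h1 k =>
    show oneForm l * oneForm m * oneForm k = oneForm k * (oneForm l * oneForm m)
    rw [mul_assoc, oneForm_mul_swap m k, mul_neg, ← mul_assoc, oneForm_mul_swap l k]
    noncomm_ring
  | hm a b ha hb => exact ha.mul_right hb
  | ha a b ha hb => exact ha.add_right hb

instance [FiniteDimensional ℝ V] : FiniteDimensional ℝ (Form V) :=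
  Module.Finite.of_basis (finBasis ℝ (Dual ℝ V)).ExteriorAlgebra

/-- An auxiliary norm on the finite-dimensional space `Λ(V*)`; it only serves to speak of smooth
maps with values in `Λ(V*)`, and all norms are equivalent. -/
instance [FiniteDimensional ℝ V] : NormedAddCommGroup (Form V) :=
  NormedAddCommGroup.induced (Form V) (Fin (finrank ℝ (Form V)) → ℝ)
    (finBasis ℝ (Form V)).equivFun.toLinearMap (finBasis ℝ (Form V)).equivFun.injective

instance [FiniteDimensional ℝ V] : NormedSpace ℝ (Form V) :=
  NormedSpace.induced ℝ (Form V) (Fin (finrank ℝ (Form V)) → ℝ)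
    (finBasis ℝ (Form V)).equivFun.toLinearMap

/-- Antisymmetrization of a linear map `V → Λ(V*)`, that is `L ↦ ∑ᵢ eⁱ ∧ L(eᵢ)` for a basis
`(eᵢ)` of `V` with dual basis `(eⁱ)`. -/
def alternate [FiniteDimensional ℝ V] (L : V →ₗ[ℝ] Form V) : Form V :=
  ∑ i, oneForm ((finBasis ℝ V).coord i) * L (finBasis ℝ V i)

theorem alternate_add [FiniteDimensional ℝ V] (L M : V →ₗ[ℝ] Form V) :
    alternate (L + M) = alternate L + alternate M := by
  simp [alternate, mul_add, Finset.sum_add_distrib]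

theorem alternate_smul [FiniteDimensional ℝ V] (c : ℝ) (L : V →ₗ[ℝ] Form V) :
    alternate (c • L) = c • alternate L := by
  simp [alternate, Finset.smul_sum]

theorem pull_alternate [FiniteDimensional ℝ V] [FiniteDimensional ℝ V'] (A : V →ₗ[ℝ] V')
    (L : V' →ₗ[ℝ] Form V') :
    pull A (alternate L) = alternate ((pull A).toLinearMap ∘ₗ L ∘ₗ A) := by
  have key : ∀ j, (finBasis ℝ V').coord j ∘ₗ A
      = ∑ i, (finBasis ℝ V').coord j (A (finBasis ℝ V i)) • (finBasis ℝ V).coord i := by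
    intro j
    apply (finBasis ℝ V).ext
    intro k
    simp [Finsupp.single_apply, Finset.sum_ite_eq]
  have key2 : ∀ i, A (finBasis ℝ V i) = ∑ j, (finBasis ℝ V').coord j (A (finBasis ℝ V i)) •
      finBasis ℝ V' j := fun i => by simp
  simp only [alternate, map_sum, map_mul, pull_oneForm]
  simp_rw [key]
  simp only [map_sum, map_smul, Finset.sum_mul, smul_mul_assoc]
  rw [Finset.sum_comm]
  refine Finset.sum_congr rfl fun i _ => ?_
  have h := congrArg (fun z => oneForm ((finBasis ℝ V).coord i) * pull A (L z)) (key2 i)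
  simp only [map_sum, map_smul, Finset.mul_sum, mul_smul_comm] at h
  exact h.symm

end Linear

/-! ### Differential forms on subsets of a finite-dimensional vector space -/

section Calculus

variable {E E' : Type*} [NormedAddCommGroup E] [NormedSpace ℝ E] [FiniteDimensional ℝ E]
  [NormedAddCommGroup E'] [NormedSpace ℝ E'] [FiniteDimensional ℝ E']

/-- Exterior derivative `∑ᵢ eⁱ ∧ ∂ᵢ w`, within the set `s`, of a form `w` on `E`. -/
def extd (s : Set E) (w : E → Form E) (y : E) : Form E :=
  alternate (fderivWithin ℝ w s y).toLinearMap

/-- The product of forms, as a continuous bilinear map. -/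
def mulCLM : Form E →L[ℝ] Form E →L[ℝ] Form E :=
  LinearMap.toContinuousLinearMap
    ((LinearMap.toContinuousLinearMap (𝕜 := ℝ) (E := Form E) (F' := Form E)).toLinearMap ∘ₗ
      LinearMap.mul ℝ (Form E))

@[simp] theorem mulCLM_apply (u w : Form E) : mulCLM u w = u * w := rfl

theorem contDiffWithinAt_mul {F : Type*} [NormedAddCommGroup F] [NormedSpace ℝ F] {s : Set F}
    {y : F} {u w : F → Form E} (hu : ContDiffWithinAt ℝ ∞ u s y)
    (hw : ContDiffWithinAt ℝ ∞ w s y) : ContDiffWithinAt ℝ ∞ (fun z => u z * w z) s y :=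
  (mulCLM (E := E)).isBoundedBilinearMap.contDiff.comp_contDiffWithinAt (hu.prodMk hw)

theorem contDiffWithinAt_linear {F F' F'' : Type*} [NormedAddCommGroup F] [NormedSpace ℝ F]
    [NormedAddCommGroup F'] [NormedSpace ℝ F'] [FiniteDimensional ℝ F']
    [NormedAddCommGroup F''] [NormedSpace ℝ F''] {s : Set F}
    {y : F} (L : F' →ₗ[ℝ] F'') {u : F → F'} (hu : ContDiffWithinAt ℝ ∞ u s y) :
    ContDiffWithinAt ℝ ∞ (fun z => L (u z)) s y :=
  (LinearMap.toContinuousLinearMap L).contDiff.comp_contDiffWithinAt hu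

theorem fderivWithin_linear {F F' F'' : Type*} [NormedAddCommGroup F] [NormedSpace ℝ F]
    [NormedAddCommGroup F'] [NormedSpace ℝ F'] [FiniteDimensional ℝ F']
    [NormedAddCommGroup F''] [NormedSpace ℝ F''] {s : Set F}
    {y : F} (L : F' →ₗ[ℝ] F'') {u : F → F'} (hu : DifferentiableWithinAt ℝ u s y)
    (hs : UniqueDiffWithinAt ℝ s y) :
    (fderivWithin ℝ (fun z => L (u z)) s y).toLinearMap
      = L ∘ₗ (fderivWithin ℝ u s y).toLinearMap := by
  have := ((LinearMap.toContinuousLinearMap L).hasFDerivAt.comp_hasFDerivWithinAt y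
    hu.hasFDerivWithinAt).fderivWithin hs
  ext v
  exact congrArg (fun T => T v) this

theorem extd_congr {s : Set E} {u w : E → Form E} {y : E} (h : u =ᶠ[𝓝[s] y] w) (hy : y ∈ s) :
    extd s u y = extd s w y := by
  rw [extd, extd, h.fderivWithin_eq_of_mem hy]

theorem extd_add {s : Set E} {u w : E → Form E} {y : E}
    (hu : DifferentiableWithinAt ℝ u s y) (hw : DifferentiableWithinAt ℝ w s y)
    (hs : UniqueDiffWithinAt ℝ s y) :
    extd s (fun z => u z + w z) y = extd s u y + extd s w y := by
  rw [extd, extd, extd, ← alternate_add, fderivWithin_fun_add hs hu hw]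
  rfl

theorem extd_smul {s : Set E} {u : E → Form E} {y : E} (c : ℝ)
    (hu : DifferentiableWithinAt ℝ u s y) (hs : UniqueDiffWithinAt ℝ s y) :
    extd s (fun z => c • u z) y = c • extd s u y := by
  rw [extd, extd, ← alternate_smul, fderivWithin_fun_const_smul hs hu]
  rfl

theorem extd_const {s : Set E} (c : Form E) (y : E) : extd s (fun _ => c) y = 0 := by
  simp [extd, alternate]

theorem mul_oneForm_eq (u : Form E) (l : Dual ℝ E) : u * oneForm l = oneForm l * parity u := by
  induction u using form_induction with
  | h0 r => rw [AlgHom.commutes, Algebra.commutes]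
  | h1 k => rw [parity_oneForm, oneForm_mul_swap]; noncomm_ring
  | hm a b ha hb => rw [mul_assoc, hb, ← mul_assoc, ha, map_mul, mul_assoc]
  | ha a b ha hb => rw [add_mul, ha, hb, map_add, mul_add]

theorem extd_mul {s : Set E} {u w : E → Form E} {y : E}
    (hu : DifferentiableWithinAt ℝ u s y) (hw : DifferentiableWithinAt ℝ w s y)
    (hs : UniqueDiffWithinAt ℝ s y) :
    extd s (fun z => u z * w z) y = extd s u y * w y + parity (u y) * extd s w y := by
  have h := ((mulCLM (E := E)).hasFDerivWithinAt_of_bilinear hu.hasFDerivWithinAt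
    hw.hasFDerivWithinAt).fderivWithin hs
  have h2 : ∀ v, fderivWithin ℝ (fun z => u z * w z) s y v
      = u y * fderivWithin ℝ w s y v + fderivWithin ℝ u s y v * w y := fun v =>
    congrArg (fun T => T v) h
  simp only [extd, alternate, ContinuousLinearMap.coe_coe, h2, Finset.sum_mul, Finset.mul_sum,
    ← Finset.sum_add_distrib]
  refine Finset.sum_congr rfl fun i _ => ?_
  have h3 := mul_oneForm_eq (parity (u y)) ((finBasis ℝ E).coord i)
  rw [parity_parity] at h3
  rw [← mul_assoc (parity _), h3]
  noncomm_ring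

theorem extd_smooth {s : Set E} {w : E → Form E} {y : E} (hw : ContDiffWithinAt ℝ ∞ w s y)
    (hs : UniqueDiffOn ℝ s) (hy : y ∈ s) : ContDiffWithinAt ℝ ∞ (extd s w) s y := by
  have h := hw.fderivWithin_right hs (m := ∞) (by simp) hy
  have h2 : ∀ i, ContDiffWithinAt ℝ ∞ (fun z => oneForm ((finBasis ℝ E).coord i) *
      fderivWithin ℝ w s z (finBasis ℝ E i)) s y := fun i =>
    contDiffWithinAt_mul contDiffWithinAt_const (h.clm_apply contDiffWithinAt_const)
  have h3 := ContDiffWithinAt.sum (s := Finset.univ) fun i _ => h2 i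
  exact h3

/-- Pullbacks of constant-coefficient forms are smooth and closed. -/
theorem pull_const {s : Set E} {t : E → E'} {y : E} (ht : ContDiffWithinAt ℝ ∞ t s y)
    (hs : UniqueDiffOn ℝ s) (hy : y ∈ s) (hc : y ∈ closure (interior s)) (e : Form E') :
    ContDiffWithinAt ℝ ∞ (fun z => pull (fderivWithin ℝ t s z).toLinearMap e) s y ∧
      extd s (fun z => pull (fderivWithin ℝ t s z).toLinearMap e) y = 0 := by
  have hA := ht.fderivWithin_right hs (m := ∞) (by simp) hy
  have hdiff : ∀ {u : E → Form E}, ContDiffWithinAt ℝ ∞ u s y → DifferentiableWithinAt ℝ u s y :=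
    fun h => h.differentiableWithinAt (by simp)
  induction e using form_induction with
  | h0 r =>
    simp only [AlgHom.commutes]
    exact ⟨contDiffWithinAt_const, extd_const _ _⟩
  | h1 l =>
    simp only [pull_oneForm]
    let T : (E →L[ℝ] E') →ₗ[ℝ] Form E :=
      { toFun := fun A => oneForm (l ∘ₗ A.toLinearMap)
        map_add' := fun A B => by
          rw [← map_add, ← LinearMap.comp_add]; rfl
        map_smul' := fun c A => by
          rw [RingHom.id_apply, ← map_smul, ← LinearMap.comp_smul]; rfl }
    refine ⟨contDiffWithinAt_linear T hA, ?_⟩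
    show extd s (fun z => T (fderivWithin ℝ t s z)) y = 0
    rw [extd, fderivWithin_linear T (hA.differentiableWithinAt (by simp)) (hs y hy)]
    have hsym : IsSymmSndFDerivWithinAt ℝ t s y :=
      (ht.of_le (m := 2) (by norm_cast)).isSymmSndFDerivWithinAt (by simp) hs hc hy
    set b := finBasis ℝ E
    set B := fderivWithin ℝ (fderivWithin ℝ t s) s y
    have h1 : ∀ i, T (B (b i)) = ∑ j, l (B (b i) (b j)) • oneForm (b.coord j) := by
      intro i
      simp only [← map_smul, ← map_sum]
      show oneForm _ = _
      congr 1
      apply b.ext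
      intro k
      simp [Finsupp.single_apply]
    have h2 : alternate (T ∘ₗ B.toLinearMap)
        = ∑ i, ∑ j, l (B (b i) (b j)) • (oneForm (b.coord i) * oneForm (b.coord j)) := by
      simp only [alternate, LinearMap.comp_apply, ContinuousLinearMap.coe_coe]
      refine Finset.sum_congr rfl fun i _ => ?_
      rw [h1, Finset.mul_sum]
      exact Finset.sum_congr rfl fun j _ => mul_smul_comm _ _ _
    have h3 : alternate (T ∘ₗ B.toLinearMap) = - alternate (T ∘ₗ B.toLinearMap) := by
      conv_lhs => rw [h2, Finset.sum_comm]
      rw [h2, ← Finset.sum_neg_distrib]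
      refine Finset.sum_congr rfl fun i _ => ?_
      rw [← Finset.sum_neg_distrib]
      refine Finset.sum_congr rfl fun j _ => ?_
      rw [hsym.eq, oneForm_mul_swap, smul_neg]
    have h4 := eq_neg_iff_add_eq_zero.mp h3
    rw [← two_smul ℝ, smul_eq_zero] at h4
    exact h4.resolve_left two_ne_zero
  | hm a b ha hb =>
    simp only [map_mul]
    refine ⟨contDiffWithinAt_mul ha.1 hb.1, ?_⟩
    rw [extd_mul (hdiff ha.1) (hdiff hb.1) (hs y hy), ha.2, hb.2, zero_mul, mul_zero, add_zero]
  | ha a b ha hb =>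
    simp only [map_add]
    refine ⟨ha.1.add hb.1, ?_⟩
    rw [extd_add (hdiff ha.1) (hdiff hb.1) (hs y hy), ha.2, hb.2, add_zero]

/-- Pullback along a smooth map preserves smoothness and commutes with the exterior derivative. -/
theorem pull_smooth {s : Set E} {s' : Set E'} {t : E → E'} {w : E' → Form E'} {y : E}
    (ht : ContDiffWithinAt ℝ ∞ t s y) (hw : ContDiffWithinAt ℝ ∞ w s' (t y))
    (hm : MapsTo t s s')
    (hs : UniqueDiffOn ℝ s) (hy : y ∈ s) (hc : y ∈ closure (interior s)) :
    ContDiffWithinAt ℝ ∞ (fun z => pull (fderivWithin ℝ t s z).toLinearMap (w (t z))) s y ∧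
      extd s (fun z => pull (fderivWithin ℝ t s z).toLinearMap (w (t z))) y
        = pull (fderivWithin ℝ t s y).toLinearMap (extd s' w (t y)) := by
  set b := finBasis ℝ (Form E')
  have hcoef : ∀ i, ContDiffWithinAt ℝ ∞ (fun z => b.coord i (w z)) s' (t y) := fun i =>
    contDiffWithinAt_linear _ hw
  have hcoef' : ∀ i, ContDiffWithinAt ℝ ∞ (fun z => b.coord i (w (t z))) s y := fun i =>
    (hcoef i).comp y ht hm
  have hk := fun i => pull_const ht hs hy hc (b i)
  have hdiff : ∀ {u : E → Form E}, ContDiffWithinAt ℝ ∞ u s y → DifferentiableWithinAt ℝ u s y :=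
    fun h => h.differentiableWithinAt (by simp)
  have hexp : (fun z => pull (fderivWithin ℝ t s z).toLinearMap (w (t z)))
      = fun z => ∑ i, b.coord i (w (t z)) • pull (fderivWithin ℝ t s z).toLinearMap (b i) := by
    funext z
    have h := congrArg (pull (fderivWithin ℝ t s z).toLinearMap) (b.sum_repr (w (t z)))
    rw [← h, map_sum]
    simp only [map_smul]
    rfl
  have hterm : ∀ i, ContDiffWithinAt ℝ ∞ (fun z => b.coord i (w (t z)) •
      pull (fderivWithin ℝ t s z).toLinearMap (b i)) s y := fun i => (hcoef' i).smul (hk i).1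
  refine ⟨hexp ▸ ContDiffWithinAt.sum fun i _ => hterm i, ?_⟩
  rw [hexp]
  have hd : ∀ v, fderivWithin ℝ (fun z => ∑ i, b.coord i (w (t z)) •
        pull (fderivWithin ℝ t s z).toLinearMap (b i)) s y v
      = ∑ i, (b.coord i (w (t y)) • fderivWithin ℝ
          (fun z => pull (fderivWithin ℝ t s z).toLinearMap (b i)) s y v)
        + pull (fderivWithin ℝ t s y).toLinearMap
            (fderivWithin ℝ w s' (t y) (fderivWithin ℝ t s y v)) := by
    intro v
    rw [fderivWithin_fun_sum (hs y hy) fun i _ => hdiff (hterm i)]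
    have hw' : ∀ i, fderivWithin ℝ (fun z => b.coord i (w (t z))) s y v
        = b.coord i (fderivWithin ℝ w s' (t y) (fderivWithin ℝ t s y v)) := by
      intro i
      have h1 := ((LinearMap.toContinuousLinearMap (b.coord i)).hasFDerivAt.comp_hasFDerivWithinAt y
        (((hw.differentiableWithinAt (by simp)).hasFDerivWithinAt).comp y
        ((ht.differentiableWithinAt (by simp)).hasFDerivWithinAt) hm)).fderivWithin (hs y hy)
      exact congrArg (fun T => T v) h1
    rw [← b.sum_repr (fderivWithin ℝ w s' (t y) (fderivWithin ℝ t s y v)), map_sum,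
      ← Finset.sum_add_distrib]
    simp only [_root_.sum_apply, map_smul]
    refine Finset.sum_congr rfl fun i _ => ?_
    rw [fderivWithin_fun_smul (hs y hy) ((hcoef' i).differentiableWithinAt (by simp))
      (hdiff (hk i).1)]
    rw [_root_.add_apply, _root_.smul_apply, ContinuousLinearMap.smulRight_apply, hw']
    rfl
  have hL : (fderivWithin ℝ (fun z => ∑ i, b.coord i (w (t z)) •
        pull (fderivWithin ℝ t s z).toLinearMap (b i)) s y).toLinearMap
      = ∑ i, (b.coord i (w (t y)) • (fderivWithin ℝ
          (fun z => pull (fderivWithin ℝ t s z).toLinearMap (b i)) s y).toLinearMap)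
        + (pull (fderivWithin ℝ t s y).toLinearMap).toLinearMap ∘ₗ
            (fderivWithin ℝ w s' (t y)).toLinearMap ∘ₗ (fderivWithin ℝ t s y).toLinearMap := by
    ext v
    simpa using hd v
  have hsum : ∀ (r : Finset (Fin (finrank ℝ (Form E')))) (L : _ → E →ₗ[ℝ] Form E),
      alternate (∑ i ∈ r, L i) = ∑ i ∈ r, alternate (L i) := by
    intro r L
    simp only [alternate, LinearMap.sum_apply, Finset.mul_sum]
    exact Finset.sum_comm
  rw [extd, hL, alternate_add, hsum, ← pull_alternate]
  simp only [alternate_smul]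
  rw [Finset.sum_eq_zero, zero_add]
  · rfl
  · intro i _
    have := (hk i).2
    rw [extd] at this
    rw [this, smul_zero]

/-- Contraction, as a bilinear map. -/
def contrL : E →ₗ[ℝ] Form E →ₗ[ℝ] Form E :=
  CliffordAlgebra.contractLeft ∘ₗ Dual.eval ℝ E

/-- Contraction, as a continuous bilinear map. -/
def contrCLM : E →L[ℝ] Form E →L[ℝ] Form E :=
  LinearMap.toContinuousLinearMap
    ((LinearMap.toContinuousLinearMap (𝕜 := ℝ) (E := Form E) (F' := Form E)).toLinearMap ∘ₗ
      contrL)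

theorem contrCLM_apply (v : E) (w : Form E) : contrCLM v w = contr v w := rfl

theorem contDiff_contr : ContDiff ℝ ∞ fun p : E × Form E => contr p.1 p.2 := by
  have h : ContDiff ℝ ∞ fun p : E × Form E => contrCLM p.1 p.2 :=
    contrCLM.isBoundedBilinearMap.contDiff
  simp only [contrCLM_apply] at h
  exact h

theorem contDiffWithinAt_contr {F : Type*} [NormedAddCommGroup F] [NormedSpace ℝ F] {s : Set F}
    {y : F} {v : F → E} {w : F → Form E} (hv : ContDiffWithinAt ℝ ∞ v s y)
    (hw : ContDiffWithinAt ℝ ∞ w s y) :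
    ContDiffWithinAt ℝ ∞ (fun z => contr (v z) (w z)) s y :=
  contDiff_contr.contDiffAt.comp_contDiffWithinAt y (f := fun z => (v z, w z)) (hv.prodMk hw)

end Calculus

/-! ### Differential forms on manifolds (possibly with boundary) -/

section Manifold

variable {E : Type*} [NormedAddCommGroup E] [NormedSpace ℝ E] {H : Type*} [TopologicalSpace H]
  (I : ModelWithCorners ℝ E H) {M : Type*} [TopologicalSpace M] [ChartedSpace H M]

/-- Sections `x ↦ u x ∈ Λ(T*ₓM)` of the exterior algebra bundle of the cotangent bundle, without
any regularity. They form a ring under the pointwise wedge product. -/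
abbrev RoughForm (M : Type*) [TopologicalSpace M] [ChartedSpace H M] : Type _ :=
  (x : M) → Form (TangentSpace I x)

/-- Differential of the inverse of the chart at `c`, at the point `y` of the model space. -/
def chartInvD (c : M) (y : E) : E →ₗ[ℝ] TangentSpace I ((extChartAt I c).symm y) :=
  (mfderivWithin 𝓘(ℝ, E) I (extChartAt I c).symm (range I) y).toLinearMap

/-- Differential of the chart at `x`, at the point `x`. -/
def chartD (x : M) : TangentSpace I x →ₗ[ℝ] E :=
  (mfderiv I 𝓘(ℝ, E) (extChartAt I x) x).toLinearMap

/-- Coordinate representation of a form in the chart at `c`: its pullback along the inverse of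
the chart. -/
def chartRep (u : RoughForm I M) (c : M) (y : E) : Form E :=
  pull (chartInvD I c y) (u ((extChartAt I c).symm y))

/-- Pullback of a form along a map. -/
def roughPullback (f : M → M) (u : RoughForm I M) : RoughForm I M := fun x =>
  pull (mfderiv I I f x).toLinearMap (u (f x))

/-- Contraction of a form with a vector field. -/
def roughContr (X : (x : M) → TangentSpace I x) (u : RoughForm I M) : RoughForm I M := fun x =>
  contr (X x) (u x)

variable [FiniteDimensional ℝ E]

/-- Smoothness of a form at a point, in the coordinates of the chart at that point. -/
def SmoothFormAt (u : RoughForm I M) (x : M) : Prop :=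
  ContDiffWithinAt ℝ ∞ (chartRep I u x) (range I) (extChartAt I x x)

/-- Exterior derivative of a form, computed at `x` in the chart at `x`. -/
def roughD (u : RoughForm I M) : RoughForm I M := fun x =>
  pull (chartD I x) (extd (range I) (chartRep I u x) (extChartAt I x x))

theorem chartD_eq [IsManifold I ∞ M] (x : M) (v : TangentSpace I x) : chartD I x v = v :=
  congrArg (fun T => T v) (mfderiv_extChartAt_self (I := I) (x := x))

theorem pull_eq_of_eq {V : Type*} [AddCommGroup V] [Module ℝ V] {u : RoughForm I M} {p q : M}
    (h : p = q) (A : V →ₗ[ℝ] TangentSpace I p) (B : V →ₗ[ℝ] TangentSpace I q) (hAB : ∀ v, (A v : E) = (B v : E)) :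
    pull A (u p) = pull B (u q) := by
  subst h
  congr 2
  exact LinearMap.ext hAB

/-- The coordinate expression of a map `f`. -/
def coordMap (f : M → M) (c c' : M) : E → E := extChartAt I c' ∘ f ∘ (extChartAt I c).symm

theorem chartRep_pullback_apply [IsManifold I ∞ M] {f : M → M} (hf : ContMDiff I I ∞ f)
    (u : RoughForm I M) (c c' : M) {y : E} (hy : y ∈ (extChartAt I c).target)
    (hy' : f ((extChartAt I c).symm y) ∈ (extChartAt I c').source) :
    chartRep I (roughPullback I f u) c y
      = pull (fderivWithin ℝ (coordMap I f c c') (range I) y).toLinearMap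
          (chartRep I u c' (coordMap I f c c' y)) := by
  have hyr : y ∈ range I := extChartAt_target_subset_range c hy
  have hU : UniqueMDiffWithinAt 𝓘(ℝ, E) (range I) y :=
    (I.uniqueDiffOn y hyr).uniqueMDiffWithinAt
  set z := (extChartAt I c).symm y with hz
  have hp : (extChartAt I c').symm (coordMap I f c c' y) = f z :=
    (extChartAt I c').left_inv hy'
  have hs : MDifferentiableWithinAt 𝓘(ℝ, E) I (extChartAt I c).symm (range I) y :=
    mdifferentiableWithinAt_extChartAt_symm hy
  have hfz : MDifferentiableAt I I f z := hf.mdifferentiableAt (by simp)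
  have hc1 : mfderivWithin 𝓘(ℝ, E) I (f ∘ (extChartAt I c).symm) (range I) y
      = (mfderiv I I f z).comp (mfderivWithin 𝓘(ℝ, E) I (extChartAt I c).symm (range I) y) :=
    mfderiv_comp_mfderivWithin y hfz hs hU
  have hcont : ContinuousWithinAt (f ∘ (extChartAt I c).symm) (range I) y :=
    ContinuousAt.comp_continuousWithinAt (g := f) (f := (extChartAt I c).symm) (s := range I)
      (x := y) hfz.continuousAt hs.continuousWithinAt
  have hev : ∀ᶠ y' in 𝓝[range I] y,
      f ((extChartAt I c).symm y') ∈ (extChartAt I c').source :=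
    hcont ((isOpen_extChartAt_source c').mem_nhds hy')
  have heq : ((extChartAt I c').symm ∘ coordMap I f c c') =ᶠ[𝓝[range I] y]
      (f ∘ (extChartAt I c).symm) := by
    filter_upwards [hev] with y' h
    exact (extChartAt I c').left_inv h
  have ht : MDifferentiableWithinAt 𝓘(ℝ, E) 𝓘(ℝ, E) (coordMap I f c c') (range I) y :=
    (mdifferentiableAt_extChartAt ((extChartAt_source I c') ▸ hy')).comp_mdifferentiableWithinAt
      y (hfz.comp_mdifferentiableWithinAt y hs)
  have hty : coordMap I f c c' y ∈ (extChartAt I c').target := (extChartAt I c').map_source hy'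
  have hc2 : mfderivWithin 𝓘(ℝ, E) I ((extChartAt I c').symm ∘ coordMap I f c c') (range I) y
      = (mfderivWithin 𝓘(ℝ, E) I (extChartAt I c').symm (range I) (coordMap I f c c' y)).comp
        (mfderivWithin 𝓘(ℝ, E) 𝓘(ℝ, E) (coordMap I f c c') (range I) y) :=
    mfderivWithin_comp y (mdifferentiableWithinAt_extChartAt_symm hty) ht
      (fun _ _ => mem_range_self _) hU
  have hc3 := heq.mfderivWithin_eq_of_mem (I := 𝓘(ℝ, E)) (I' := I) hyr
  have hfinal : ∀ v : E, (mfderiv I I f z (chartInvD I c y v) : E)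
      = chartInvD I c' (coordMap I f c c' y)
          (fderivWithin ℝ (coordMap I f c c') (range I) y v) := by
    intro v
    rw [← mfderivWithin_eq_fderivWithin]
    have e1 := congrArg (fun T : E →L[ℝ] E => T v) hc1
    have e2 := congrArg (fun T : E →L[ℝ] E => T v) hc2
    have e3 := congrArg (fun T : E →L[ℝ] E => T v) hc3
    exact (e1.symm.trans e3.symm).trans e2
  show pull _ (pull _ (u (f z))) = pull _ (pull _ (u _))
  rw [pull_pull, pull_pull]
  exact pull_eq_of_eq I hp.symm _ _ hfinal

theorem coordMap_contDiffWithinAt [IsManifold I ∞ M] {f : M → M} (hf : ContMDiff I I ∞ f)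
    {c c' x : M} (hx : x ∈ (extChartAt I c).source) (hx' : f x ∈ (extChartAt I c').source) :
    ContDiffWithinAt ℝ ∞ (coordMap I f c c') (range I) (extChartAt I c x) :=
  ((contMDiffAt_iff_of_mem_source (extChartAt_source I c ▸ hx)
    (extChartAt_source I c' ▸ hx')).mp (hf x)).2

theorem coordMap_apply {f : M → M} {c c' x : M} (hx : x ∈ (extChartAt I c).source) :
    coordMap I f c c' (extChartAt I c x) = extChartAt I c' (f x) := by
  show extChartAt I c' (f ((extChartAt I c).symm (extChartAt I c x))) = _
  rw [(extChartAt I c).left_inv hx]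

theorem eventually_chart [IsManifold I ∞ M] {f : M → M} (hf : Continuous f)
    {c c' x : M} (hx : x ∈ (extChartAt I c).source) (hx' : f x ∈ (extChartAt I c').source) :
    ∀ᶠ y in 𝓝[range I] (extChartAt I c x), y ∈ (extChartAt I c).target ∧
      f ((extChartAt I c).symm y) ∈ (extChartAt I c').source := by
  have h1 : ∀ᶠ y in 𝓝[range I] (extChartAt I c x), y ∈ (extChartAt I c).target :=
    extChartAt_target_mem_nhdsWithin' hx
  have h2 : ContinuousAt (fun y => f ((extChartAt I c).symm y)) (extChartAt I c x) :=
    hf.continuousAt.comp (continuousAt_extChartAt_symm' hx)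
  have h3 : ∀ᶠ y in 𝓝[range I] (extChartAt I c x),
      f ((extChartAt I c).symm y) ∈ (extChartAt I c').source := by
    refine (h2.mono_left nhdsWithin_le_nhds).eventually ((isOpen_extChartAt_source c').mem_nhds ?_)
    show f ((extChartAt I c).symm (extChartAt I c x)) ∈ _
    rw [(extChartAt I c).left_inv hx]
    exact hx'
  exact h1.and h3

theorem chartRep_pullback_eventuallyEq [IsManifold I ∞ M] {f : M → M} (hf : ContMDiff I I ∞ f)
    (u : RoughForm I M) {c c' x : M} (hx : x ∈ (extChartAt I c).source)
    (hx' : f x ∈ (extChartAt I c').source) :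
    chartRep I (roughPullback I f u) c =ᶠ[𝓝[range I] (extChartAt I c x)] fun y =>
      pull (fderivWithin ℝ (coordMap I f c c') (range I) y).toLinearMap
          (chartRep I u c' (coordMap I f c c' y)) := by
  filter_upwards [eventually_chart I hf.continuous hx hx'] with y hy
  exact chartRep_pullback_apply I hf u c c' hy.1 hy.2

theorem roughPullback_id (u : RoughForm I M) : roughPullback I id u = u := by
  funext x
  show pull (mfderiv I I id x).toLinearMap (u x) = u x
  rw [mfderiv_id]
  exact pull_id _

theorem chartRep_pullback_smooth [IsManifold I ∞ M] {f : M → M} (hf : ContMDiff I I ∞ f)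
    {u : RoughForm I M} {c x : M} (hx : x ∈ (extChartAt I c).source)
    (hu : SmoothFormAt I u (f x)) :
    ContDiffWithinAt ℝ ∞ (chartRep I (roughPullback I f u) c) (range I) (extChartAt I c x) ∧
    extd (range I) (chartRep I (roughPullback I f u) c) (extChartAt I c x)
      = pull (fderivWithin ℝ (coordMap I f c (f x)) (range I) (extChartAt I c x)).toLinearMap
          (extd (range I) (chartRep I u (f x)) (extChartAt I (f x) (f x))) := by
  have hx' := mem_extChartAt_source (I := I) (f x)
  have h0 := coordMap_apply I (f := f) (c' := f x) hx
  have hr : extChartAt I c x ∈ range I := mem_range_self _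
  have hu' : ContDiffWithinAt ℝ ∞ (chartRep I u (f x)) (range I)
    (coordMap I f c (f x) (extChartAt I c x)) := h0 ▸ hu
  have h := pull_smooth (coordMap_contDiffWithinAt I hf hx hx') hu' (fun _ _ => mem_range_self _)
    I.uniqueDiffOn hr (I.range_subset_closure_interior hr)
  have he := chartRep_pullback_eventuallyEq I hf u hx hx'
  rw [h0] at h
  exact ⟨h.1.congr_of_eventuallyEq_of_mem he hr, (extd_congr he hr).trans h.2⟩

/-- Smoothness may be tested in any chart. -/
theorem contDiffWithinAt_chartRep [IsManifold I ∞ M] {u : RoughForm I M} {c x : M}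
    (hu : SmoothFormAt I u x) (hx : x ∈ (extChartAt I c).source) :
    ContDiffWithinAt ℝ ∞ (chartRep I u c) (range I) (extChartAt I c x) := by
  have := (chartRep_pullback_smooth I contMDiff_id hx (f := id) hu).1
  rwa [roughPullback_id] at this

/-- Invariance of the exterior derivative under changes of charts. -/
theorem chartRep_roughD [IsManifold I ∞ M] {u : RoughForm I M} {c : M} {y : E}
    (hy : y ∈ (extChartAt I c).target) (hu : SmoothFormAt I u ((extChartAt I c).symm y)) :
    chartRep I (roughD I u) c y = extd (range I) (chartRep I u c) y := by
  set z := (extChartAt I c).symm y with hz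
  have hzs : z ∈ (extChartAt I c).source := (extChartAt I c).map_target hy
  have hzy : extChartAt I c z = y := (extChartAt I c).right_inv hy
  have h := (chartRep_pullback_smooth I contMDiff_id hzs (f := id) hu).2
  rw [roughPullback_id, hzy] at h
  rw [h]
  show pull _ (pull _ _) = _
  rw [pull_pull]
  congr 2
  ext v
  have hyr : y ∈ range I := extChartAt_target_subset_range c hy
  have hU : UniqueMDiffWithinAt 𝓘(ℝ, E) (range I) y :=
    (I.uniqueDiffOn y hyr).uniqueMDiffWithinAt
  have hc : mfderivWithin 𝓘(ℝ, E) 𝓘(ℝ, E) (extChartAt I z ∘ (extChartAt I c).symm) (range I) y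
      = (mfderiv I 𝓘(ℝ, E) (extChartAt I z) z).comp
        (mfderivWithin 𝓘(ℝ, E) I (extChartAt I c).symm (range I) y) :=
    mfderiv_comp_mfderivWithin y (mdifferentiableAt_extChartAt (mem_chart_source H z))
      (mdifferentiableWithinAt_extChartAt_symm hy) hU
  rw [mfderivWithin_eq_fderivWithin] at hc
  exact (congrArg (fun T : E →L[ℝ] E => T v) hc).symm

theorem roughD_smooth [IsManifold I ∞ M] {u : RoughForm I M} (hu : ∀ x, SmoothFormAt I u x)
    (x : M) : SmoothFormAt I (roughD I u) x := by
  have hr : extChartAt I x x ∈ range I := mem_range_self _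
  refine (extd_smooth (hu x) I.uniqueDiffOn hr).congr_of_eventuallyEq_of_mem ?_ hr
  filter_upwards [extChartAt_target_mem_nhdsWithin (I := I) x] with y hy
  exact chartRep_roughD I hy (hu _)

theorem roughPullback_smooth [IsManifold I ∞ M] {f : M → M} (hf : ContMDiff I I ∞ f)
    {u : RoughForm I M} (hu : ∀ x, SmoothFormAt I u x) (x : M) :
    SmoothFormAt I (roughPullback I f u) x :=
  (chartRep_pullback_smooth I hf (mem_extChartAt_source x) (hu (f x))).1

end Manifold

/-! ### The algebra of smooth differential forms -/

section Forms

variable {E : Type*} [NormedAddCommGroup E] [NormedSpace ℝ E] [FiniteDimensional ℝ E]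
  {H : Type*} [TopologicalSpace H]
  (I : ModelWithCorners ℝ E H) {M : Type*} [TopologicalSpace M] [ChartedSpace H M]

theorem smoothFormAt_add {u w : RoughForm I M} {x : M} (hu : SmoothFormAt I u x)
    (hw : SmoothFormAt I w x) : SmoothFormAt I (u + w) x := by
  have h : chartRep I (u + w) x = fun y => chartRep I u x y + chartRep I w x y :=
    funext fun y => map_add _ _ _
  rw [SmoothFormAt, h]
  exact hu.add hw

theorem smoothFormAt_mul {u w : RoughForm I M} {x : M} (hu : SmoothFormAt I u x)
    (hw : SmoothFormAt I w x) : SmoothFormAt I (u * w) x := by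
  have h : chartRep I (u * w) x = fun y => chartRep I u x y * chartRep I w x y :=
    funext fun y => map_mul _ _ _
  rw [SmoothFormAt, h]
  exact contDiffWithinAt_mul hu hw

/-- A smooth function is a smooth form of degree zero. -/
theorem smoothFormAt_fun [IsManifold I ∞ M] {f : M → ℝ} (hf : ContMDiff I 𝓘(ℝ, ℝ) ∞ f) (x : M) :
    SmoothFormAt I (fun x => algebraMap ℝ (Form (TangentSpace I x)) (f x) : RoughForm I M) x := by
  have h : chartRep I (fun x => algebraMap ℝ (Form (TangentSpace I x)) (f x) : RoughForm I M) x
      = fun y => Algebra.linearMap ℝ (Form E) (f ((extChartAt I x).symm y)) :=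
    funext fun y => AlgHom.commutes _ _
  rw [SmoothFormAt, h]
  refine contDiffWithinAt_linear _ ?_
  have := ((contMDiffAt_iff_of_mem_source (mem_chart_source H x)
    (mem_chart_source ℝ (f x))).mp (hf x)).2
  rw [extChartAt_model_space_eq_id] at this
  exact this

theorem alternate_parity (L : E →ₗ[ℝ] Form E) :
    alternate (parity.toLinearMap ∘ₗ L) = - parity (alternate L) := by
  simp [alternate]

theorem smoothFormAt_algebraMap (r : ℝ) (x : M) :
    SmoothFormAt I (algebraMap ℝ (RoughForm I M) r) x := by
  have h : chartRep I (algebraMap ℝ (RoughForm I M) r) x = fun _ => algebraMap ℝ (Form E) r :=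
    funext fun y => AlgHom.commutes _ _
  rw [SmoothFormAt, h]
  exact contDiffWithinAt_const

/-- Smooth forms are closed under sums and wedge products. -/
def smoothForms (M : Type*) [TopologicalSpace M] [ChartedSpace H M] :
    Subalgebra ℝ (RoughForm I M) where
  carrier := {u | ∀ x, SmoothFormAt I u x}
  mul_mem' hu hw x := smoothFormAt_mul I (hu x) (hw x)
  add_mem' hu hw x := smoothFormAt_add I (hu x) (hw x)
  algebraMap_mem' r x := smoothFormAt_algebraMap I r x

/-- The algebra `Ω(M)` of smooth differential forms on `M` (of all degrees), with the wedge
product. -/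
def DiffForm (M : Type*) [TopologicalSpace M] [ChartedSpace H M] : Type _ := smoothForms I M

instance : Ring (DiffForm I M) := inferInstanceAs (Ring (smoothForms I M))

instance : Algebra ℝ (DiffForm I M) := inferInstanceAs (Algebra ℝ (smoothForms I M))

theorem smoothFormAt_differentiable {u : RoughForm I M} {x : M} (hu : SmoothFormAt I u x) :
    DifferentiableWithinAt ℝ (chartRep I u x) (range I) (extChartAt I x x) :=
  hu.differentiableWithinAt (by simp)

theorem uniqueDiff_chart (x : M) : UniqueDiffWithinAt ℝ (range I) (extChartAt I x x) :=
  I.uniqueDiffOn _ (mem_range_self _)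

variable [IsManifold I ∞ M]

theorem pull_chartRep_self (u : RoughForm I M) (x : M) :
    pull (chartD I x) (chartRep I u x (extChartAt I x x)) = u x := by
  show pull _ (pull _ _) = _
  rw [pull_pull]
  have hp : (extChartAt I x).symm (extChartAt I x x) = x := extChartAt_to_inv x
  refine (pull_eq_of_eq I hp _ LinearMap.id fun v => ?_).trans (pull_id (u x))
  have h1 := congrArg (fun T => T (chartD I x v)) (mfderivWithin_range_extChartAt_symm (I := I)
    (x := x))
  exact h1.trans (chartD_eq I x v)

theorem roughD_add {u w : RoughForm I M} (hu : ∀ x, SmoothFormAt I u x)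
    (hw : ∀ x, SmoothFormAt I w x) : roughD I (u + w) = roughD I u + roughD I w := by
  funext x
  have h : chartRep I (u + w) x = fun y => chartRep I u x y + chartRep I w x y :=
    funext fun y => map_add _ _ _
  show pull _ _ = pull _ _ + pull _ _
  rw [h, extd_add (smoothFormAt_differentiable I (hu x)) (smoothFormAt_differentiable I (hw x))
    (uniqueDiff_chart I x), map_add]

theorem roughD_smul (c : ℝ) {u : RoughForm I M} (hu : ∀ x, SmoothFormAt I u x) :
    roughD I (c • u) = c • roughD I u := by
  funext x
  have h : chartRep I (c • u) x = fun y => c • chartRep I u x y :=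
    funext fun y => pull_smul _ _ _
  show pull (chartD I x) _ = c • pull (chartD I x) _
  rw [h, extd_smul c (smoothFormAt_differentiable I (hu x)) (uniqueDiff_chart I x), pull_smul]

theorem roughD_mul {u w : RoughForm I M} (hu : ∀ x, SmoothFormAt I u x)
    (hw : ∀ x, SmoothFormAt I w x) (x : M) :
    roughD I (u * w) x = roughD I u x * w x + parity (u x) * roughD I w x := by
  have h : chartRep I (u * w) x = fun y => chartRep I u x y * chartRep I w x y :=
    funext fun y => map_mul _ _ _
  show pull _ _ = pull _ _ * _ + _ * pull _ _
  rw [h, extd_mul (smoothFormAt_differentiable I (hu x)) (smoothFormAt_differentiable I (hw x))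
    (uniqueDiff_chart I x), map_add, map_mul, map_mul, pull_parity, pull_chartRep_self,
    pull_chartRep_self]

theorem smoothFormAt_parity {u : RoughForm I M} {x : M} (hu : SmoothFormAt I u x) :
    SmoothFormAt I (fun x => parity (u x) : RoughForm I M) x := by
  have h : chartRep I (fun x => parity (u x) : RoughForm I M) x
      = fun y => (parity (V := E)).toLinearMap (chartRep I u x y) :=
    funext fun y => pull_parity _ _
  rw [SmoothFormAt, h]
  exact contDiffWithinAt_linear _ hu

/-- The exterior derivative `d : Ω(M) → Ω(M)`. -/
def dForm : DiffForm I M →ₗ[ℝ] DiffForm I M where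
  toFun u := ⟨roughD I u.1, roughD_smooth I u.2⟩
  map_add' u w := Subtype.ext (roughD_add I u.2 w.2)
  map_smul' c u := Subtype.ext (roughD_smul I c u.2)

/-- The sign automorphism `(-1) ^ deg` of `Ω(M)`. -/
def parityForm : DiffForm I M →ₐ[ℝ] DiffForm I M where
  toFun u := ⟨fun x => parity (u.1 x), fun x => smoothFormAt_parity I (u.2 x)⟩
  map_one' := Subtype.ext <| funext fun _ => map_one _
  map_zero' := Subtype.ext <| funext fun _ => map_zero _
  map_mul' _ _ := Subtype.ext <| funext fun _ => map_mul _ _ _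
  map_add' _ _ := Subtype.ext <| funext fun _ => map_add _ _ _
  commutes' r := Subtype.ext <| funext fun _ => AlgHom.commutes _ r

/-- Pullback of smooth forms along a smooth map. -/
def pullbackForm (f : M → M) (hf : ContMDiff I I ∞ f) : DiffForm I M →ₐ[ℝ] DiffForm I M where
  toFun u := ⟨roughPullback I f u.1, roughPullback_smooth I hf u.2⟩
  map_one' := Subtype.ext <| funext fun _ => map_one _
  map_zero' := Subtype.ext <| funext fun _ => map_zero _
  map_mul' _ _ := Subtype.ext <| funext fun _ => map_mul _ _ _
  map_add' _ _ := Subtype.ext <| funext fun _ => map_add _ _ _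
  commutes' r := Subtype.ext <| funext fun _ => AlgHom.commutes _ r

/-- A smooth function, as a form of degree zero. -/
def funForm (f : M → ℝ) (hf : ContMDiff I 𝓘(ℝ, ℝ) ∞ f) : DiffForm I M :=
  ⟨fun x => algebraMap ℝ (Form (TangentSpace I x)) (f x), smoothFormAt_fun I hf⟩

theorem parityForm_parityForm (u : DiffForm I M) : parityForm I (parityForm I u) = u :=
  Subtype.ext <| funext fun _ => parity_parity _

theorem dForm_mul (u w : DiffForm I M) :
    dForm I (u * w) = dForm I u * w + parityForm I u * dForm I w :=
  Subtype.ext <| funext fun x => roughD_mul I u.2 w.2 x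

theorem dForm_one : dForm I (1 : DiffForm I M) = 0 := by
  have h := dForm_mul I (1 : DiffForm I M) 1
  rw [map_one (parityForm I), mul_one, mul_one, one_mul] at h
  simpa using h

theorem dForm_parityForm (u : DiffForm I M) :
    dForm I (parityForm I u) = - parityForm I (dForm I u) := by
  refine Subtype.ext <| funext fun x => ?_
  have h : chartRep I (fun x => parity (u.1 x) : RoughForm I M) x
      = fun y => (parity (V := E)).toLinearMap (chartRep I u.1 x y) :=
    funext fun y => pull_parity _ _
  show pull (chartD I x) (extd _ (chartRep I (fun x => parity (u.1 x) : RoughForm I M) x) _)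
    = - parity (pull (chartD I x) _)
  rw [h, extd, fderivWithin_linear _ (smoothFormAt_differentiable I (u.2 x))
    (uniqueDiff_chart I x), alternate_parity, map_neg, pull_parity]
  rfl

theorem parityForm_pullbackForm (f : M → M) (hf : ContMDiff I I ∞ f) (u : DiffForm I M) :
    parityForm I (pullbackForm I f hf u) = pullbackForm I f hf (parityForm I u) :=
  Subtype.ext <| funext fun _ => (pull_parity _ _).symm

/-- Coordinates of a vector field in the chart at `c`. -/
theorem contDiffWithinAt_vectorField {X : (x : M) → TangentSpace I x}
    (hX : ContMDiff I I.tangent ∞ (fun x => (⟨x, X x⟩ : TangentBundle I M))) (x : M) :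
    ContDiffWithinAt ℝ ∞ (fun y =>
      (trivializationAt E (TangentSpace I) x
        ⟨(extChartAt I x).symm y, X ((extChartAt I x).symm y)⟩).2) (range I)
      (extChartAt I x x) := by
  have h1 := (Bundle.contMDiffAt_section x).mp (hX x)
  have h2 := ((contMDiffAt_iff_of_mem_source (mem_chart_source H x)
      (mem_chart_source E _)).mp h1).2
  rw [extChartAt_model_space_eq_id] at h2
  exact h2

theorem chartInvD_vectorField (X : (x : M) → TangentSpace I x) (x : M) {y : E}
    (hy : y ∈ (extChartAt I x).target) :
    chartInvD I x y (trivializationAt E (TangentSpace I) x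
        ⟨(extChartAt I x).symm y, X ((extChartAt I x).symm y)⟩).2 = X ((extChartAt I x).symm y) := by
  have hzs : (extChartAt I x).symm y ∈ (chartAt H x).source :=
    extChartAt_source I x ▸ (extChartAt I x).map_target hy
  have h1 := congrArg (fun T => T (X ((extChartAt I x).symm y)))
    (mfderivWithin_extChartAt_symm_comp_mfderiv_extChartAt (I := I) hy)
  have h2 := congrArg (fun T => T (X ((extChartAt I x).symm y)))
    (TangentBundle.continuousLinearMapAt_trivializationAt (I := I) hzs)
  have h3 := congrArg (fun T => T (X ((extChartAt I x).symm y)))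
    (Bundle.Trivialization.coe_linearMapAt_of_mem (R := ℝ)
      (trivializationAt E (TangentSpace I) x) (b := (extChartAt I x).symm y)
      (by simpa using hzs))
  refine Eq.trans ?_ h1
  exact congrArg (chartInvD I x y) (h3.symm.trans h2)

theorem roughContr_smooth {X : (x : M) → TangentSpace I x}
    (hX : ContMDiff I I.tangent ∞ (fun x => (⟨x, X x⟩ : TangentBundle I M)))
    {u : RoughForm I M} (hu : ∀ x, SmoothFormAt I u x) (x : M) :
    SmoothFormAt I (roughContr I X u) x := by
  have hr : extChartAt I x x ∈ range I := mem_range_self _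
  have hs := contDiffWithinAt_contr (contDiffWithinAt_vectorField I hX x) (hu x)
  refine hs.congr_of_eventuallyEq_of_mem ?_ hr
  filter_upwards [extChartAt_target_mem_nhdsWithin (I := I) x] with y hy
  have hXz := chartInvD_vectorField I X x hy
  show pull _ (contr (X _) (u _)) = contr _ (pull _ (u _))
  rw [← pull_contr, hXz]

end Forms

/-! ### Tensor products of differential graded algebras -/

section Tensor

variable {S Ω κ : Type*} [CommRing S] [Algebra ℝ S] [Ring Ω] [Algebra ℝ Ω] [Fintype κ]

/-- The operator `1 ⊗ d - ∑ₐ Θ^a ⊗ ι_a` on `S ⊗ Ω`. -/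
def tensorD (d : Ω →ₗ[ℝ] Ω) (c : κ → Ω →ₗ[ℝ] Ω) (Θ : κ → S) : S ⊗[ℝ] Ω →ₗ[ℝ] S ⊗[ℝ] Ω :=
  TensorProduct.map LinearMap.id d
    - ∑ a, TensorProduct.map (LinearMap.mulLeft ℝ (Θ a)) (c a)

theorem tensorD_tmul (d : Ω →ₗ[ℝ] Ω) (c : κ → Ω →ₗ[ℝ] Ω) (Θ : κ → S) (s : S) (u : Ω) :
    tensorD d c Θ (s ⊗ₜ u) = s ⊗ₜ d u - ∑ a, (Θ a * s) ⊗ₜ c a u := by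
  simp [tensorD]

theorem tensorD_mul (d : Ω →ₗ[ℝ] Ω) (c : κ → Ω →ₗ[ℝ] Ω) (Θ : κ → S) (p : Ω →ₐ[ℝ] Ω)
    (hd : ∀ u w, d (u * w) = d u * w + p u * d w)
    (hc : ∀ a u w, c a (u * w) = c a u * w + p u * c a w) (α β : S ⊗[ℝ] Ω) :
    tensorD d c Θ (α * β) = tensorD d c Θ α * β
      + Algebra.TensorProduct.map (AlgHom.id ℝ S) p α * tensorD d c Θ β := by
  induction α using TensorProduct.induction_on with
  | zero => simp
  | add x y hx hy => rw [add_mul, map_add, hx, hy, map_add, map_add]; noncomm_ring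
  | tmul s u =>
    induction β using TensorProduct.induction_on with
    | zero => simp
    | add x y hx hy => rw [mul_add, map_add, hx, hy, map_add]; noncomm_ring
    | tmul t w =>
      rw [Algebra.TensorProduct.map_tmul, Algebra.TensorProduct.tmul_mul_tmul, tensorD_tmul,
        tensorD_tmul, tensorD_tmul, hd, AlgHom.id_apply]
      simp only [hc, TensorProduct.tmul_add, sub_mul, mul_sub, Finset.sum_mul,
        Finset.mul_sum, Algebra.TensorProduct.tmul_mul_tmul, Finset.sum_add_distrib]
      have e1 : ∀ a, Θ a * (s * t) = Θ a * s * t := fun a => (mul_assoc _ _ _).symm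
      have e2 : ∀ a, s * (Θ a * t) = Θ a * s * t := fun a => by ring
      simp only [e1, e2]
      abel

theorem tensorD_parity (d : Ω →ₗ[ℝ] Ω) (c : κ → Ω →ₗ[ℝ] Ω) (Θ : κ → S) (p : Ω →ₐ[ℝ] Ω)
    (hd : ∀ u, d (p u) = - p (d u)) (hc : ∀ a u, c a (p u) = - p (c a u)) (α : S ⊗[ℝ] Ω) :
    tensorD d c Θ (Algebra.TensorProduct.map (AlgHom.id ℝ S) p α)
      = - Algebra.TensorProduct.map (AlgHom.id ℝ S) p (tensorD d c Θ α) := by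
  induction α using TensorProduct.induction_on with
  | zero => simp
  | add x y hx hy => rw [map_add, map_add, hx, hy, map_add, map_add, neg_add]
  | tmul s u =>
    rw [Algebra.TensorProduct.map_tmul, tensorD_tmul, tensorD_tmul, map_sub, map_sum]
    simp only [Algebra.TensorProduct.map_tmul, hd, hc, TensorProduct.tmul_neg,
      Finset.sum_neg_distrib, AlgHom.id_apply]
    abel

end Tensor

/-! ### Smooth group actions and the Cartan model -/

section Action

variable {E : Type*} [NormedAddCommGroup E] [NormedSpace ℝ E] [FiniteDimensional ℝ E]
  {H : Type*} [TopologicalSpace H]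
  {EG : Type*} [NormedAddCommGroup EG] [NormedSpace ℝ EG] {HG : Type*} [TopologicalSpace HG]
  (J : ModelWithCorners ℝ EG HG) (I : ModelWithCorners ℝ E H)
  {G : Type*} [TopologicalSpace G] [ChartedSpace HG G] [Group G]
  {M : Type*} [TopologicalSpace M] [ChartedSpace H M] [MulAction G M]

/-- The fundamental vector field on `M` of an element `ξ` of the Lie algebra of `G`, that is
`x ↦ d/dt exp(-tξ) • x` at `t = 0`; with this sign, `ξ ↦ X_ξ` is a homomorphism of Lie algebras. -/
def fundVF (ξ : GroupLieAlgebra J G) (x : M) : TangentSpace I x :=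
  - (mfderiv J I (fun g : G => g • x) 1 ξ : E)

/-- The adjoint representation of `G` on its Lie algebra: `Ad g` is the differential at `1` of the
conjugation `h ↦ g h g⁻¹`. -/
def Ad (g : G) : GroupLieAlgebra J G →ₗ[ℝ] GroupLieAlgebra J G :=
  ContinuousLinearMap.toLinearMap (M := GroupLieAlgebra J G) (M₂ := GroupLieAlgebra J G)
    (mfderiv J J (fun h : G => g * h * g⁻¹) 1)

theorem smul_contMDiff [ContMDiffSMul J I ∞ G M] (g : G) :
    ContMDiff I I ∞ (fun x : M => g • x) :=
  (ContMDiffSMul.contMDiff_smul (I := J) (I' := I) (n := ∞) (G := G) (M := M)).comp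
    (contMDiff_const.prodMk contMDiff_id)

theorem fundVF_smooth [IsManifold I ∞ M] [LieGroup J ∞ G] [ContMDiffSMul J I ∞ G M]
    (ξ : GroupLieAlgebra J G) :
    ContMDiff I I.tangent ∞ (fun x : M => (⟨x, fundVF J I ξ x⟩ : TangentBundle I M)) := by
  have hG : IsManifold J ∞ G := LieGroup.toContMDiffMul.toIsManifold
  let fg : M → TangentBundle I M := fun x => ⟨x, 0⟩
  have sfg : ContMDiff I I.tangent ∞ fg := Bundle.contMDiff_zeroSection _ _
  let fv : M → TangentBundle J G := fun _ => ⟨1, -ξ⟩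
  have sfv : ContMDiff I J.tangent ∞ fv := contMDiff_const
  let F₂ : (TangentBundle J G × TangentBundle I M) → TangentBundle (J.prod I) (G × M) :=
    (equivTangentBundleProd J G I M).symm
  have S₂ : ContMDiff (J.tangent.prod I.tangent) (J.prod I).tangent ∞ F₂ :=
    contMDiff_equivTangentBundleProd_symm
  have hact := ContMDiffSMul.contMDiff_smul (I := J) (I' := I) (n := ∞) (G := G) (M := M)
  have S₃ : ContMDiff (J.prod I).tangent I.tangent ∞
      (tangentMap (J.prod I) I (fun p : G × M => p.1 • p.2)) :=
    hact.contMDiff_tangentMap (by simp)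
  have S := (S₃.comp S₂).comp (sfv.prodMk sfg)
  have h1 : ∀ x : M, (mfderiv (J.prod I) I (fun p : G × M => p.1 • p.2) ((1 : G), x)
      ((-ξ, 0) : TangentSpace J (1 : G) × TangentSpace I x) : E)
      = fundVF J I ξ x := by
    intro x
    have := mfderiv_prod_eq_add_apply (I := J) (I' := I) (I'' := I)
      (f := fun p : G × M => p.1 • p.2) (p := ((1 : G), x))
      (v := ((-ξ, 0) : TangentSpace J (1 : G) × TangentSpace I x))
      (hact.mdifferentiableAt (by simp))
    refine this.trans ?_
    have e1 := map_neg (mfderiv J I (fun g : G => g • x) 1) ξ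
    have e2 := map_zero (mfderiv I I (fun y : M => (1 : G) • y) x)
    exact (congrArg₂ (fun a b : E => a + b) e1 e2).trans (add_zero _)
  have h2 : (fun x : M => (⟨x, fundVF J I ξ x⟩ : TangentBundle I M))
      = (tangentMap (J.prod I) I (fun p : G × M => p.1 • p.2) ∘ F₂) ∘
        fun x => (fv x, fg x) := by
    funext x
    refine Bundle.TotalSpace.ext (one_smul G x).symm ?_
    exact heq_of_eq (h1 x).symm
  rw [h2]
  exact S

/-- Contraction `ι_ξ : Ω(M) → Ω(M)` with the fundamental vector field of `ξ`. -/
def contrForm [IsManifold I ∞ M] [LieGroup J ∞ G] [ContMDiffSMul J I ∞ G M]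
    (ξ : GroupLieAlgebra J G) : DiffForm I M →ₗ[ℝ] DiffForm I M where
  toFun u := ⟨roughContr I (fundVF J I ξ) u.1, roughContr_smooth I (fundVF_smooth J I ξ) u.2⟩
  map_add' _ _ := Subtype.ext <| funext fun _ => map_add _ _ _
  map_smul' c u := Subtype.ext <| funext fun x => (contr (fundVF J I ξ x)).map_smul c (u.1 x)

theorem contrForm_mul [IsManifold I ∞ M] [LieGroup J ∞ G] [ContMDiffSMul J I ∞ G M]
    (ξ : GroupLieAlgebra J G) (u w : DiffForm I M) :
    contrForm J I ξ (u * w) = contrForm J I ξ u * w + parityForm I u * contrForm J I ξ w :=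
  Subtype.ext <| funext fun _ => contr_mul _ _ _

theorem contrForm_parityForm [IsManifold I ∞ M] [LieGroup J ∞ G] [ContMDiffSMul J I ∞ G M]
    (ξ : GroupLieAlgebra J G) (u : DiffForm I M) :
    contrForm J I ξ (parityForm I u) = - parityForm I (contrForm J I ξ u) :=
  Subtype.ext <| funext fun _ => contr_parity _ _

/-- The action of `G` on `Ω(M)`: `g` acts as the pullback along `x ↦ g⁻¹ • x`. -/
def actForm [IsManifold I ∞ M] [ContMDiffSMul J I ∞ G M] (g : G) :
    DiffForm I M →ₐ[ℝ] DiffForm I M :=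
  pullbackForm I (fun x => g⁻¹ • x) (smul_contMDiff J I g⁻¹)

/-- The symmetric algebra `S(𝔤*)` of polynomials on the Lie algebra `𝔤` of `G`. -/
abbrev Poly (G : Type*) [TopologicalSpace G] [ChartedSpace HG G] [Group G] : Type _ :=
  SymmetricAlgebra ℝ (Dual ℝ (GroupLieAlgebra J G))

/-- The action of `G` on `S(𝔤*)` extending the coadjoint representation. -/
def actPoly (g : G) : Poly J G →ₐ[ℝ] Poly J G :=
  SymmetricAlgebra.lift (SymmetricAlgebra.ι ℝ (Dual ℝ (GroupLieAlgebra J G)) ∘ₗ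
    (Ad J g⁻¹).dualMap)

/-- The algebra `S(𝔤*)^G` of invariant polynomials. -/
def invPoly (G : Type*) [TopologicalSpace G] [ChartedSpace HG G] [Group G] :
    Subalgebra ℝ (Poly J G) where
  carrier := {F | ∀ g : G, actPoly J g F = F}
  mul_mem' ha hb g := by rw [map_mul, ha g, hb g]
  add_mem' ha hb g := by rw [map_add, ha g, hb g]
  algebraMap_mem' r g := AlgHom.commutes _ r

variable [IsManifold I ∞ M]

variable (G M) in
/-- The algebra `S(𝔤*) ⊗ Ω(M)`. As `S(𝔤*)` is concentrated in even degrees, the graded tensor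
product is the usual one. -/
abbrev CartanAlg : Type _ := Poly J G ⊗[ℝ] DiffForm I M

/-- The sign automorphism `(-1) ^ deg` of `S(𝔤*) ⊗ Ω(M)`. -/
def cartanParity : CartanAlg J I G M →ₐ[ℝ] CartanAlg J I G M :=
  Algebra.TensorProduct.map (AlgHom.id ℝ _) (parityForm I)

variable [ContMDiffSMul J I ∞ G M]

/-- The diagonal action of `G` on `S(𝔤*) ⊗ Ω(M)`. -/
def actCartan (g : G) : CartanAlg J I G M →ₐ[ℝ] CartanAlg J I G M :=
  Algebra.TensorProduct.map (actPoly J g) (actForm J I g)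

variable (G M) in
/-- The algebra `Ω_G(M) = (S(𝔤*) ⊗ Ω(M))^G` of equivariant differential forms. -/
def EquivForm : Subalgebra ℝ (CartanAlg J I G M) where
  carrier := {α | ∀ g : G, actCartan J I g α = α}
  mul_mem' ha hb g := by rw [map_mul, ha g, hb g]
  add_mem' ha hb g := by rw [map_add, ha g, hb g]
  algebraMap_mem' r g := AlgHom.commutes _ r

variable [LieGroup J ∞ G] {κ : Type*} [Fintype κ] (b : Basis κ ℝ (GroupLieAlgebra J G))

/-- The element `Θ^a ∈ S¹(𝔤*)` of the dual basis. -/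
def Theta (a : κ) : Poly J G := SymmetricAlgebra.ι ℝ _ (b.coord a)

/-- The Cartan differential `D = 1 ⊗ d - ∑ₐ Θ^a ⊗ ι_a` on `S(𝔤*) ⊗ Ω(M)`, for a basis `(ξ_a)` of the
Lie algebra. -/
def cartanD : CartanAlg J I G M →ₗ[ℝ] CartanAlg J I G M :=
  tensorD (dForm I) (fun a => contrForm J I (b a)) (Theta J b)

theorem cartanD_mul (α β : CartanAlg J I G M) :
    cartanD J I b (α * β) = cartanD J I b α * β + cartanParity J I α * cartanD J I b β :=
  tensorD_mul _ _ _ _ (dForm_mul I) (fun a => contrForm_mul J I (b a)) α β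

theorem cartanD_parity (α : CartanAlg J I G M) :
    cartanD J I b (cartanParity J I α) = - cartanParity J I (cartanD J I b α) :=
  tensorD_parity _ _ _ _ (dForm_parityForm I) (fun a => contrForm_parityForm J I (b a)) α

theorem cartanD_one : cartanD J I b (1 : CartanAlg J I G M) = 0 := by
  rw [cartanD, Algebra.TensorProduct.one_def, tensorD_tmul, dForm_one]
  have h : ∀ ξ : GroupLieAlgebra J G, contrForm J I ξ (1 : DiffForm I M) = 0 := fun ξ =>
    Subtype.ext <| funext fun x => contr_one _
  simp [h]

theorem cartanParity_act (g : G) (α : CartanAlg J I G M) :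
    actCartan J I g (cartanParity J I α) = cartanParity J I (actCartan J I g α) := by
  induction α using TensorProduct.induction_on with
  | zero => simp
  | add x y hx hy => simp only [map_add, hx, hy]
  | tmul s u =>
    show actPoly J g s ⊗ₜ[ℝ] actForm J I g (parityForm I u)
      = actPoly J g s ⊗ₜ[ℝ] parityForm I (actForm J I g u)
    rw [actForm, parityForm_pullbackForm]

theorem cartanParity_cartanParity (α : CartanAlg J I G M) :
    cartanParity J I (cartanParity J I α) = α := by
  induction α using TensorProduct.induction_on with
  | zero => simp
  | add x y hx hy => simp only [map_add, hx, hy]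
  | tmul s u =>
    show s ⊗ₜ[ℝ] parityForm I (parityForm I u) = s ⊗ₜ[ℝ] u
    rw [parityForm_parityForm]

theorem cartanD_parity_mul {z β : CartanAlg J I G M} (hz : cartanD J I b z = 0) :
    cartanD J I b (cartanParity J I z * β) = z * cartanD J I b β := by
  rw [cartanD_mul, cartanD_parity, hz, map_zero, neg_zero, zero_mul, zero_add,
    cartanParity_cartanParity]

/-- The `D`-closed equivariant forms are closed under sums and products. -/
def closedForms : Subalgebra ℝ (CartanAlg J I G M) where
  carrier := {α | α ∈ EquivForm J I G M ∧ cartanD J I b α = 0}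
  mul_mem' ha hb := ⟨mul_mem ha.1 hb.1, by rw [cartanD_mul, ha.2, hb.2, zero_mul, mul_zero,
    add_zero]⟩
  add_mem' ha hb := ⟨add_mem ha.1 hb.1, by rw [map_add, ha.2, hb.2, add_zero]⟩
  algebraMap_mem' r := ⟨algebraMap_mem _ r, by
    rw [Algebra.algebraMap_eq_smul_one, map_smul, cartanD_one, smul_zero]⟩

variable (M) in
/-- The algebra of `D`-closed equivariant forms. -/
def Cocycle : Type _ := closedForms J I b (M := M)

instance : Ring (Cocycle J I M b) := inferInstanceAs (Ring (closedForms J I b (M := M)))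

instance : Algebra ℝ (Cocycle J I M b) :=
  inferInstanceAs (Algebra ℝ (closedForms J I b (M := M)))

variable (M) in
/-- The ideal of `D`-exact equivariant forms in the algebra of `D`-closed equivariant forms. -/
def Coboundary : Ideal (Cocycle J I M b) where
  carrier := {z | ∃ β ∈ EquivForm J I G M, cartanD J I b β = z.1}
  zero_mem' := ⟨0, zero_mem _, map_zero _⟩
  add_mem' := by
    rintro _ _ ⟨β, hβ, h⟩ ⟨γ, hγ, h'⟩
    exact ⟨β + γ, add_mem hβ hγ, by rw [map_add, h, h']; rfl⟩
  smul_mem' := by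
    rintro z w ⟨β, hβ, h⟩
    have hz : cartanParity J I z.1 ∈ EquivForm J I G M := fun g => by
      rw [cartanParity_act, z.2.1 g]
    exact ⟨cartanParity J I z.1 * β, mul_mem hz hβ,
      (cartanD_parity_mul J I b z.2.2).trans (congrArg (fun t => z.1 * t) h)⟩

instance : (Coboundary J I M b).IsTwoSided where
  mul_mem_of_left := by
    rintro z w ⟨β, hβ, h⟩
    refine ⟨β * w.1, mul_mem hβ w.2.1, ?_⟩
    rw [cartanD_mul, w.2.2, mul_zero, add_zero]
    exact congrArg (fun t => t * w.1) h

variable (M) in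
/-- The equivariant cohomology algebra `H_G^*(M)` in the Cartan model: `D`-closed equivariant forms
modulo `D`-exact ones. -/
abbrev EquivCohomology : Type _ := Cocycle J I M b ⧸ Coboundary J I M b

variable (M) in
/-- The cohomology class of a `D`-closed equivariant form. -/
def cohomClass : Cocycle J I M b →ₐ[ℝ] EquivCohomology J I M b :=
  Ideal.Quotient.mkₐ ℝ (Coboundary J I M b)

end Action

/-! ### Degenerate principal bundles, degenerate connections and the Chern–Weil map -/

section ChernWeil

variable {E : Type*} [NormedAddCommGroup E] [NormedSpace ℝ E] [FiniteDimensional ℝ E]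
  {H : Type*} [TopologicalSpace H]
  {EG : Type*} [NormedAddCommGroup EG] [NormedSpace ℝ EG] {HG : Type*} [TopologicalSpace HG]
  (J : ModelWithCorners ℝ EG HG) (I : ModelWithCorners ℝ E H)
  {G : Type*} [TopologicalSpace G] [ChartedSpace HG G] [Group G]
  {M : Type*} [TopologicalSpace M] [ChartedSpace H M] [MulAction G M]

/-- The singular set `W^s`: the points whose stabilizer has positive dimension. For a smooth action
of a Lie group, stabilizers are closed subgroups, hence Lie groups, and a Lie group is discrete if
and only if its dimension is zero. -/
def singularSet (G M : Type*) [TopologicalSpace G] [Group G] [MulAction G M] : Set M :=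
  {x | ¬ DiscreteTopology (MulAction.stabilizer G x)}

/-- A smooth `G`-manifold is a degenerate principal `G`-bundle if the action is locally free on an
open set which contains the boundary. -/
def IsDegeneratePrincipalBundle (G : Type*) [TopologicalSpace G] [Group G] [MulAction G M] : Prop :=
  ∃ O : Set M, IsOpen O ∧ I.boundary M ⊆ O ∧
    ∀ x ∈ O, DiscreteTopology (MulAction.stabilizer G x)

/-- An invariant smooth function with values in `[0, 1]`, which vanishes on a neighbourhood `U` of
the singular set and is equal to one outside a larger neighbourhood `V`. -/
structure IsCutoff (G : Type*) [TopologicalSpace G] [Group G] [MulAction G M] (f : M → ℝ) :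
    Prop where
  smooth : ContMDiff I 𝓘(ℝ, ℝ) ∞ f
  mem_Icc : ∀ x, f x ∈ Set.Icc (0 : ℝ) 1
  invariant : ∀ (g : G) (x : M), f (g • x) = f x
  nhds : ∃ U V : Set M, IsOpen U ∧ IsOpen V ∧ singularSet G M ⊆ U ∧ closure U ⊆ V ∧
    (∀ x ∈ U, f x = 0) ∧ ∀ x ∉ V, f x = 1

/-- A `𝔤`-valued form `θ` of degree one is a connection form on the regular part `W^0`, the
complement of the singular set: it is smooth there, equivariant, and reproduces the generators of
fundamental vector fields. The values of `θ` on the singular set are irrelevant. -/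
structure IsConnection (θ : (x : M) → TangentSpace I x →ₗ[ℝ] GroupLieAlgebra J G) : Prop where
  smooth : ∀ (l : Dual ℝ (GroupLieAlgebra J G)) (x : M), x ∉ singularSet G M →
    SmoothFormAt I (fun y => oneForm (l ∘ₗ θ y) : RoughForm I M) x
  equivariant : ∀ (g : G) (x : M), x ∉ singularSet G M → ∀ v : TangentSpace I x,
    θ (g • x) (mfderiv I I (fun y : M => g • y) x v) = Ad J g (θ x v)
  reproduces : ∀ (ξ : GroupLieAlgebra J G) (x : M), x ∉ singularSet G M →
    θ x (fundVF J I ξ x) = ξ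

variable [IsManifold I ∞ M] {f : M → ℝ}
  {θ : (x : M) → TangentSpace I x →ₗ[ℝ] GroupLieAlgebra J G}

theorem smoothFormAt_degConn (hf : IsCutoff I G f) (hθ : IsConnection J I θ)
    (l : Dual ℝ (GroupLieAlgebra J G)) (x : M) :
    SmoothFormAt I (fun y => oneForm (f y • (l ∘ₗ θ y)) : RoughForm I M) x := by
  by_cases hx : x ∈ singularSet G M
  · obtain ⟨U, V, hU, -, hsU, -, h0, -⟩ := hf.nhds
    have hr : extChartAt I x x ∈ range I := mem_range_self _
    have hc : ContDiffWithinAt ℝ ∞ (fun _ : E => (0 : Form E)) (range I) (extChartAt I x x) :=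
      contDiffWithinAt_const
    refine hc.congr_of_eventuallyEq_of_mem ?_ hr
    have h1 : ContinuousAt (extChartAt I x).symm (extChartAt I x x) :=
      continuousAt_extChartAt_symm x
    have h2 : ∀ᶠ y in 𝓝[range I] (extChartAt I x x), (extChartAt I x).symm y ∈ U := by
      refine (h1.mono_left nhdsWithin_le_nhds).eventually (hU.mem_nhds ?_)
      rw [extChartAt_to_inv]
      exact hsU hx
    filter_upwards [h2] with y hy
    show pull _ (oneForm (f _ • _)) = 0
    rw [h0 _ hy, zero_smul, map_zero, map_zero]
  · have h : (fun y => oneForm (f y • (l ∘ₗ θ y)) : RoughForm I M)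
        = (fun y => algebraMap ℝ (Form (TangentSpace I y)) (f y) : RoughForm I M)
          * (fun y => oneForm (l ∘ₗ θ y) : RoughForm I M) := by
      funext y
      show oneForm (f y • (l ∘ₗ θ y)) = algebraMap ℝ (Form (TangentSpace I y)) (f y) * _
      rw [map_smul, Algebra.smul_def]
    rw [h]
    exact smoothFormAt_mul I (smoothFormAt_fun I hf.smooth x) (hθ.smooth l x hx)

/-- The component `⟨l, θ_f⟩` of the degenerate connection `θ_f = f θ`, a smooth form of degree one
on the whole of `M`. -/
def degConn (hf : IsCutoff I G f) (hθ : IsConnection J I θ)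
    (l : Dual ℝ (GroupLieAlgebra J G)) : DiffForm I M :=
  ⟨fun y => oneForm (f y • (l ∘ₗ θ y)), smoothFormAt_degConn J I hf hθ l⟩

theorem alternate_oneForm_comm (L : E →ₗ[ℝ] Form E) (hL : ∀ v, ∃ l, L v = oneForm l)
    (w : Form E) : Commute (alternate L) w := by
  refine Finset.sum_induction _ (fun z => Commute z w) (fun _ _ => Commute.add_left)
    (Commute.zero_left w) fun i _ => ?_
  obtain ⟨l, hl⟩ := hL (finBasis ℝ E i)
  rw [hl]
  exact oneForm_mul_oneForm_comm _ _ _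

theorem pull_surjective_chartD (x : M) (w : Form (TangentSpace I x)) :
    ∃ w' : Form E, pull (chartD I x) w' = w := by
  refine ⟨pull (LinearMap.id : E →ₗ[ℝ] E) w, ?_⟩
  have h : (LinearMap.id : E →ₗ[ℝ] E) ∘ₗ chartD I x = LinearMap.id :=
    LinearMap.ext fun v => chartD_eq I x v
  exact (pull_pull (chartD I x) (V'' := TangentSpace I x) (LinearMap.id : E →ₗ[ℝ] E) w).trans
    ((congrArg (fun A => pull A w) h).trans (pull_id w))

/-- The exterior derivative of a form of degree one commutes with every form. -/
theorem dForm_oneForm_mem_center (l : (x : M) → Dual ℝ (TangentSpace I x))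
    (hl : ∀ x, SmoothFormAt I (fun y => oneForm (l y) : RoughForm I M) x) (w : DiffForm I M) :
    Commute (dForm I ⟨fun y => oneForm (l y), hl⟩ : DiffForm I M) w := by
  refine Subtype.ext <| funext fun x => ?_
  show pull (chartD I x) _ * w.1 x = w.1 x * pull (chartD I x) _
  obtain ⟨w', hw'⟩ := pull_surjective_chartD I x (w.1 x)
  rw [← hw', ← map_mul, ← map_mul]
  congr 1
  set u : E → Form E := chartRep I (fun y => oneForm (l y) : RoughForm I M) x with hu
  have hd : DifferentiableWithinAt ℝ u (range I) (extChartAt I x x) :=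
    smoothFormAt_differentiable I (hl x)
  let P : Form E →ₗ[ℝ] Form E := oneForm ∘ₗ ExteriorAlgebra.ιInv
  have hP : ∀ m : Dual ℝ E, P (oneForm m) = oneForm m := fun m =>
    congrArg oneForm (ExteriorAlgebra.ι_leftInverse m)
  have hPu : (fun z => P (u z)) = u := by
    funext z
    have h : u z = oneForm (l _ ∘ₗ chartInvD I x z) := pull_oneForm _ _
    rw [h, hP]
  have hD := fderivWithin_linear P hd (uniqueDiff_chart I x)
  rw [hPu] at hD
  refine alternate_oneForm_comm _ (fun v => ?_) w'
  exact ⟨_, congrArg (fun T => T v) hD⟩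

variable [LieGroup J ∞ G] {κ : Type*} [Fintype κ] (b : Basis κ ℝ (GroupLieAlgebra J G))

/-- The component along `ξ_a` of `dθ_f + ½ [θ_f, θ_f]`. -/
def formCurvature (hf : IsCutoff I G f) (hθ : IsConnection J I θ) (a : κ) : DiffForm I M :=
  dForm I (degConn J I hf hθ (b.coord a))
    + (1 / 2 : ℝ) • ∑ c, ∑ e, b.coord a ⁅b c, b e⁆ •
      (degConn J I hf hθ (b.coord c) * degConn J I hf hθ (b.coord e))

/-- The component along `ξ_a` of the equivariant degenerate curvature
`Ω_f^G = dθ_f + ½ [θ_f, θ_f] - (-1 + f) ξ_a Θ^a ∈ S(𝔤*) ⊗ Ω(M) ⊗ 𝔤`. -/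
def degCurvature (hf : IsCutoff I G f) (hθ : IsConnection J I θ) (a : κ) : CartanAlg J I G M :=
  1 ⊗ₜ[ℝ] formCurvature J I b hf hθ a
    - Theta J b a ⊗ₜ[ℝ] (-1 + funForm I f hf.smooth)

theorem formCurvature_commute (hf : IsCutoff I G f) (hθ : IsConnection J I θ) (a : κ)
    (w : DiffForm I M) : Commute (formCurvature J I b hf hθ a) w := by
  refine Commute.add_left (dForm_oneForm_mem_center I _ _ w) ?_
  refine Commute.smul_left (Commute.sum_left _ _ _ fun c _ => Commute.sum_left _ _ _ fun e _ =>
    Commute.smul_left ?_ _) _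
  exact Subtype.ext <| funext fun x => oneForm_mul_oneForm_comm _ _ _

/-- The components of the curvature have even degree; hence they are central. -/
theorem degCurvature_mem_center (hf : IsCutoff I G f) (hθ : IsConnection J I θ) (a : κ) :
    degCurvature J I b hf hθ a ∈ Subalgebra.center ℝ (CartanAlg J I G M) := by
  rw [Subalgebra.mem_center_iff]
  intro α
  induction α using TensorProduct.induction_on with
  | zero => simp
  | add x y hx hy => rw [add_mul, mul_add, hx, hy]
  | tmul s u =>
    have h1 : (funForm I f hf.smooth : DiffForm I M) * u = u * funForm I f hf.smooth :=
      Subtype.ext <| funext fun x => Algebra.commutes (A := Form (TangentSpace I x)) (f x) (u.1 x)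
    have h2 : (-1 + funForm I f hf.smooth) * u = u * (-1 + funForm I f hf.smooth) := by
      rw [add_mul, mul_add, h1, neg_one_mul, mul_neg_one]
    rw [degCurvature, mul_sub, sub_mul, Algebra.TensorProduct.tmul_mul_tmul,
      Algebra.TensorProduct.tmul_mul_tmul, Algebra.TensorProduct.tmul_mul_tmul,
      Algebra.TensorProduct.tmul_mul_tmul, mul_one, one_mul, h2, mul_comm s,
      (formCurvature_commute J I b hf hθ a u).eq]

/-- The map `F ↦ F(Ω_f^G)`, `S(𝔤*) → S(𝔤*) ⊗ Ω(M)`: the homomorphism of algebras which sends a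
linear form `l` on `𝔤` to `l(Ω_f^G) = ∑ₐ l(ξ_a) Ω^a`. -/
def chernWeil (hf : IsCutoff I G f) (hθ : IsConnection J I θ) :
    Poly J G →ₐ[ℝ] CartanAlg J I G M :=
  (Subalgebra.center ℝ (CartanAlg J I G M)).val.comp <|
    SymmetricAlgebra.lift <|
      ∑ a, (Dual.eval ℝ (GroupLieAlgebra J G) (b a)).smulRight
        (⟨degCurvature J I b hf hθ a, degCurvature_mem_center J I b hf hθ a⟩ :
          Subalgebra.center ℝ (CartanAlg J I G M))

theorem chernWeil_ι (hf : IsCutoff I G f) (hθ : IsConnection J I θ)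
    (l : Dual ℝ (GroupLieAlgebra J G)) :
    chernWeil J I b hf hθ (SymmetricAlgebra.ι ℝ _ l) = ∑ a, l (b a) • degCurvature J I b hf hθ a := by
  simp [chernWeil]

/-- Polynomials on `𝔤` which are homogeneous of degree `p`. -/
def polyDeg (G : Type*) [TopologicalSpace G] [ChartedSpace HG G] [Group G] (p : ℕ) :
    Submodule ℝ (Poly J G) :=
  LinearMap.range (SymmetricAlgebra.ι ℝ (Dual ℝ (GroupLieAlgebra J G))) ^ p

/-- Smooth differential forms of degree `k`. -/
def formDeg (M : Type*) [TopologicalSpace M] [ChartedSpace H M] (k : ℕ) :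
    Submodule ℝ (DiffForm I M) where
  carrier := {u | ∀ x, u.1 x ∈ ⋀[ℝ]^k (Dual ℝ (TangentSpace I x))}
  zero_mem' _ := zero_mem _
  add_mem' hu hw x := add_mem (hu x) (hw x)
  smul_mem' c _ hu x := Submodule.smul_mem _ c (hu x)

/-- Elements of `S(𝔤*) ⊗ Ω(M)` of total degree `n`, where the generators of `S(𝔤*)` have
degree two. -/
def cartanDeg (G M : Type*) [TopologicalSpace G] [ChartedSpace HG G] [Group G]
    [TopologicalSpace M] [ChartedSpace H M] (n : ℕ) : Submodule ℝ (CartanAlg J I G M) :=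
  ⨆ (p : ℕ) (k : ℕ) (_ : 2 * p + k = n),
    Submodule.map₂ (TensorProduct.mk ℝ (Poly J G) (DiffForm I M)) (polyDeg J G p) (formDeg I M k)

end ChernWeil

end

end DegCW

/-!
The form `f θ` is invariant and satisfies `ι_ξ (f θ) = f ξ`, so Cartan's formula gives
`ι_ξ d⟨l, f θ⟩ = -⟨ad*_ξ l, f θ⟩ - l(ξ) df`. The term `(1 - f) ξ_a Θ^a` of the equivariant curvature
absorbs `df`, whence the Bianchi identity `D Ω^l = -∑ₐ ⟨ξ^a, f θ⟩ Ω^{ad*_a l}` holds even where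
`f θ` is not a connection. As the components of `Ω` are even and central, `F ↦ D F(Ω)` is a
derivation, and therefore `D F(Ω) = -∑ₐ ⟨ξ^a, f θ⟩ (ad*_a F)(Ω)`. Differentiating `F ∘ Ad g = F`
at `g = 1` shows that `ad*_a F = 0` for invariant `F`.
-/

namespace DegCW

noncomputable section

section SymmetricAlgebra

variable {R V : Type*} [CommRing R] [AddCommGroup V] [Module R V]

/-- The algebra homomorphism `v ↦ v + ε N v` from the symmetric algebra of `V` to its dual
numbers. -/
def symDualNumberHom (N : V →ₗ[R] SymmetricAlgebra R V) :
    SymmetricAlgebra R V →ₐ[R] TrivSqZeroExt (SymmetricAlgebra R V) (SymmetricAlgebra R V) :=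
  SymmetricAlgebra.lift ((TrivSqZeroExt.inlAlgHom R _ _).toLinearMap ∘ₗ SymmetricAlgebra.ι R V
    + (TrivSqZeroExt.inrHom (SymmetricAlgebra R V) _).restrictScalars R ∘ₗ N)

theorem fst_symDualNumberHom (N : V →ₗ[R] SymmetricAlgebra R V) (F : SymmetricAlgebra R V) :
    (symDualNumberHom N F).fst = F := by
  have h : (TrivSqZeroExt.fstHom R _ _).comp (symDualNumberHom N) = AlgHom.id R _ :=
    SymmetricAlgebra.algHom_ext (LinearMap.ext fun v => by simp [symDualNumberHom])
  exact DFunLike.congr_fun h F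

/-- The derivation of the symmetric algebra of `V` which restricts to `N` on `V`. -/
def symDerivation (N : V →ₗ[R] SymmetricAlgebra R V) :
    Derivation R (SymmetricAlgebra R V) (SymmetricAlgebra R V) :=
  Derivation.mk'
    ((TrivSqZeroExt.sndHom (SymmetricAlgebra R V) _).restrictScalars R ∘ₗ
      (symDualNumberHom N).toLinearMap)
    fun F K => by simp [fst_symDualNumberHom, mul_comm]

@[simp] theorem symDerivation_ι (N : V →ₗ[R] SymmetricAlgebra R V) (v : V) :
    symDerivation N (SymmetricAlgebra.ι R V v) = N v := by
  simp [symDerivation, symDualNumberHom]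

/-- Evaluation of a polynomial on `V`, that is an element of `S(V*)`, at a point of `V`. -/
def evalPoly (w : V) : SymmetricAlgebra R (Dual R V) →ₐ[R] R :=
  SymmetricAlgebra.lift (Dual.eval R V w)

@[simp] theorem evalPoly_ι (w : V) (l : Dual R V) :
    evalPoly w (SymmetricAlgebra.ι R _ l) = l w := by
  simp [evalPoly]

theorem eq_zero_of_evalPoly_eq_zero [IsDomain R] [Infinite R] [Module.Free R V] [Module.Finite R V]
    {F : SymmetricAlgebra R (Dual R V)} (h : ∀ w : V, evalPoly w F = 0) : F = 0 := by
  classical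
  let b := Module.Free.chooseBasis R V
  let e := SymmetricAlgebra.equivMvPolynomial b.dualBasis
  have aeval_eq (x) : (MvPolynomial.aeval x).comp e.toAlgHom = evalPoly (∑ i, x i • b i) := by
    refine SymmetricAlgebra.algHom_ext (b.dualBasis.ext fun i => ?_)
    have he : e (SymmetricAlgebra.ι R _ (b.dualBasis i)) = MvPolynomial.X i :=
      SymmetricAlgebra.equivMvPolynomial_ι_apply b.dualBasis i
    simp [-Basis.coe_dualBasis, he]
    simp [Finsupp.single_apply]
  refine (map_eq_zero_iff e e.injective).mp (MvPolynomial.funext fun x => ?_)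
  exact (DFunLike.congr_fun (aeval_eq x) F).trans ((h _).trans (map_zero _).symm)

end SymmetricAlgebra

theorem hasDerivAt_evalPoly {V : Type*} [AddCommGroup V] [Module ℝ V] {c : ℝ → V} {t : ℝ}
    (δ : Derivation ℝ (SymmetricAlgebra ℝ (Dual ℝ V)) (SymmetricAlgebra ℝ (Dual ℝ V)))
    (hc : ∀ l, HasDerivAt (fun s => l (c s)) (evalPoly (c t) (δ (SymmetricAlgebra.ι ℝ _ l))) t)
    (F : SymmetricAlgebra ℝ (Dual ℝ V)) :
    HasDerivAt (fun s => evalPoly (c s) F) (evalPoly (c t) (δ F)) t := by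
  induction F using SymmetricAlgebra.induction with
  | algebraMap r => simpa using hasDerivAt_const t r
  | ι l => simpa using hc l
  | mul F K hF hK =>
    simp only [map_mul, Derivation.leibniz, smul_eq_mul, map_add]
    exact (hF.mul hK).congr_deriv (by ring)
  | add F K hF hK =>
    simp only [map_add]
    exact hF.add hK

/-- Unlike in `SymmetricAlgebra.algHom_ext`, the codomain may be noncommutative. -/
theorem algHom_ext_symmetricAlgebra {R V A : Type*} [CommSemiring R] [AddCommMonoid V] [Module R V]
    [Semiring A] [Algebra R A] {φ ψ : SymmetricAlgebra R V →ₐ[R] A}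
    (h : ∀ v, φ (SymmetricAlgebra.ι R V v) = ψ (SymmetricAlgebra.ι R V v)) : φ = ψ := by
  refine AlgHom.ext fun F => ?_
  induction F using SymmetricAlgebra.induction with
  | algebraMap r => simp only [AlgHom.commutes]
  | ι v => exact h v
  | mul F K hF hK => simp only [map_mul, hF, hK]
  | add F K hF hK => simp only [map_add, hF, hK]

section SkewDerivation

variable {R A : Type*} [CommRing R] [Ring A] [Algebra R A]

/-- Graded derivations of odd degree, the sign `(-1)^deg` being encoded by the automorphism `p`. -/
def IsSkewDerivation (p : A →ₐ[R] A) (d : A →ₗ[R] A) : Prop :=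
  ∀ u w, d (u * w) = d u * w + p u * d w

theorem IsSkewDerivation.map_one {p : A →ₐ[R] A} {d : A →ₗ[R] A} (hd : IsSkewDerivation p d) :
    d 1 = 0 := by
  simpa using hd 1 1

/-- As the values of `φ` are even and central, `D ∘ φ` is an ordinary derivation. -/
theorem IsSkewDerivation.apply_algHom_symmetricAlgebra {V κ : Type*} [AddCommGroup V] [Module R V]
    [Fintype κ] {p : A →ₐ[R] A} {D : A →ₗ[R] A} (hD : IsSkewDerivation p D)
    {φ : SymmetricAlgebra R V →ₐ[R] A} (hφ : ∀ F x, Commute (φ F) x) (hp : p.comp φ = φ) {T : κ → A}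
    {δ : κ → Derivation R (SymmetricAlgebra R V) (SymmetricAlgebra R V)}
    (h : ∀ v, D (φ (SymmetricAlgebra.ι R V v))
      = -∑ a, T a * φ (δ a (SymmetricAlgebra.ι R V v))) (F : SymmetricAlgebra R V) :
    D (φ F) = -∑ a, T a * φ (δ a F) := by
  induction F using SymmetricAlgebra.induction with
  | algebraMap r => simp [Algebra.algebraMap_eq_smul_one, hD.map_one]
  | ι v => exact h v
  | add F K hF hK => simp only [map_add, hF, hK, mul_add, Finset.sum_add_distrib, neg_add]
  | mul F K hF hK =>
    have hpF : p (φ F) = φ F := DFunLike.congr_fun hp F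
    rw [map_mul, hD, hpF, hF, hK, neg_mul, mul_neg, ← neg_add, Finset.sum_mul, Finset.mul_sum,
      ← Finset.sum_add_distrib]
    congr! 2 with a
    rw [Derivation.leibniz, smul_eq_mul, smul_eq_mul, map_add, map_mul, map_mul, mul_add,
      add_comm, ← mul_assoc, ← mul_assoc, (hφ F (T a)).eq, mul_assoc (T a), (hφ K _).eq,
      mul_assoc (T a)]

end SkewDerivation

section DualBasis

variable {R L M κ : Type*} [CommRing R] [AddCommGroup L] [Module R L] [AddCommGroup M] [Module R M]
  [Fintype κ]

theorem sum_coord_comp (b : Basis κ R L) (F : L →ₗ[R] Dual R L →ₗ[R] M) (A : L →ₗ[R] L) :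
    ∑ c, F (b c) (b.coord c ∘ₗ A) = ∑ c, F (A (b c)) (b.coord c) := by
  classical
  calc ∑ c, F (b c) (b.coord c ∘ₗ A)
      = ∑ c, ∑ e, b.coord c (A (b e)) • F (b c) (b.coord e) := by
        refine Finset.sum_congr rfl fun c _ => ?_
        rw [← b.sum_dual_apply_smul_coord (b.coord c ∘ₗ A), map_sum]
        simp only [map_smul, LinearMap.comp_apply]
    _ = ∑ e, F (A (b e)) (b.coord e) := by
        rw [Finset.sum_comm]
        refine Finset.sum_congr rfl fun e _ => ?_
        conv_rhs => rw [← b.sum_repr (A (b e)), map_sum, LinearMap.sum_apply]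
        simp only [map_smul, LinearMap.smul_apply, b.coord_apply]

end DualBasis

section Coadjoint

variable {R L : Type*} [CommRing R] [LieRing L] [LieAlgebra R L]

/-- The transpose of `ad ξ`, i.e. the coadjoint action of `-ξ`, as a function of `ξ`. -/
def coad : L →ₗ[R] Dual R L →ₗ[R] Dual R L :=
  Dual.transpose ∘ₗ (LieAlgebra.ad R L : L →ₗ[R] Module.End R L)

theorem coad_apply (ξ η : L) (l : Dual R L) : coad ξ l η = l ⁅ξ, η⁆ := rfl

theorem coad_lie (ξ η : L) (l : Dual R L) :
    coad ⁅ξ, η⁆ l = coad η (coad ξ l) - coad ξ (coad η l) := by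
  ext ζ
  simp only [LinearMap.sub_apply, coad_apply, ← map_sub, lie_lie]

variable {M κ : Type*} [AddCommGroup M] [Module R M] [Fintype κ]

theorem sum_coad_swap (b : Basis κ R L) (B : Dual R L →ₗ[R] Dual R L →ₗ[R] M) (l : Dual R L) :
    ∑ c, B (coad (b c) l) (b.coord c) = -∑ c, B (b.coord c) (coad (b c) l) := by
  have expand (c) : coad (b c) l = ∑ e, l ⁅b c, b e⁆ • b.coord e :=
    (b.sum_dual_apply_smul_coord _).symm
  simp only [expand, map_sum, map_smul, LinearMap.sum_apply, LinearMap.smul_apply]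
  rw [Finset.sum_comm, ← Finset.sum_neg_distrib]
  congr! 1 with c
  rw [← Finset.sum_neg_distrib]
  congr! 1 with e
  rw [← lie_skew, map_neg, neg_smul]

end Coadjoint

/-! ### The Bianchi identity -/

section Curvature

variable {L Ω κ : Type*} [LieRing L] [LieAlgebra ℝ L] [Ring Ω] [Algebra ℝ Ω] [Fintype κ]
  (b : Basis κ ℝ L)

/-- The bracket `[θ, θ]` of the `L`-valued form `θ`, which is encoded by its components
`θ l = ⟨l, θ⟩`. -/
def formBracket (θ : Dual ℝ L →ₗ[ℝ] Ω) : Dual ℝ L →ₗ[ℝ] Ω :=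
  ∑ c, LinearMap.mulLeft ℝ (θ (b.coord c)) ∘ₗ θ ∘ₗ coad (b c)

/-- The curvature `dθ + ½ [θ, θ]`. -/
def curvature (d : Ω →ₗ[ℝ] Ω) (θ : Dual ℝ L →ₗ[ℝ] Ω) : Dual ℝ L →ₗ[ℝ] Ω :=
  d ∘ₗ θ + (1 / 2 : ℝ) • formBracket b θ

theorem formBracket_apply (θ : Dual ℝ L →ₗ[ℝ] Ω) (l : Dual ℝ L) :
    formBracket b θ l = ∑ c, θ (b.coord c) * θ (coad (b c) l) := by
  simp [formBracket]

theorem curvature_apply (d : Ω →ₗ[ℝ] Ω) (θ : Dual ℝ L →ₗ[ℝ] Ω) (l : Dual ℝ L) :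
    curvature b d θ l = d (θ l) + (1 / 2 : ℝ) • formBracket b θ l := rfl

theorem formBracket_eq_sum (θ : Dual ℝ L →ₗ[ℝ] Ω) (l : Dual ℝ L) :
    formBracket b θ l = ∑ c, ∑ e, l ⁅b c, b e⁆ • (θ (b.coord c) * θ (b.coord e)) := by
  rw [formBracket_apply]
  congr! 1 with c
  rw [← b.sum_dual_apply_smul_coord (coad (b c) l)]
  simp only [map_sum, map_smul, Finset.mul_sum, mul_smul_comm, coad_apply]

theorem map_formBracket {φ : Ω →ₐ[ℝ] Ω} {θ : Dual ℝ L →ₗ[ℝ] Ω} {A : L →ₗ⁅ℝ⁆ L}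
    (hθ : ∀ l, φ (θ l) = θ (l ∘ₗ (A : L →ₗ[ℝ] L))) (l : Dual ℝ L) :
    φ (formBracket b θ l) = formBracket b θ (l ∘ₗ (A : L →ₗ[ℝ] L)) := by
  let F : L →ₗ[ℝ] Dual ℝ L →ₗ[ℝ] Ω :=
    LinearMap.mk₂ ℝ (fun ξ m => θ m * θ (coad ξ l ∘ₗ (A : L →ₗ[ℝ] L)))
      (by simp [LinearMap.add_comp, mul_add]) (by simp [LinearMap.smul_comp])
      (by simp [add_mul]) (by simp)
  have coad_comp (ξ) : coad (A ξ) l ∘ₗ (A : L →ₗ[ℝ] L) = coad ξ (l ∘ₗ (A : L →ₗ[ℝ] L)) := by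
    ext η
    simp [coad_apply]
  calc φ (formBracket b θ l)
      = ∑ c, F (b c) (b.coord c ∘ₗ (A : L →ₗ[ℝ] L)) := by
        simp [formBracket_apply, F, hθ]
    _ = ∑ c, F (A (b c)) (b.coord c) := sum_coord_comp b F A
    _ = formBracket b θ (l ∘ₗ (A : L →ₗ[ℝ] L)) := by
        simp [formBracket_apply, F, coad_comp]

theorem map_curvature {d : Ω →ₗ[ℝ] Ω} {φ : Ω →ₐ[ℝ] Ω} (hd : ∀ u, d (φ u) = φ (d u))
    {θ : Dual ℝ L →ₗ[ℝ] Ω} {A : L →ₗ⁅ℝ⁆ L}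
    (hθ : ∀ l, φ (θ l) = θ (l ∘ₗ (A : L →ₗ[ℝ] L))) (l : Dual ℝ L) :
    φ (curvature b d θ l) = curvature b d θ (l ∘ₗ (A : L →ₗ[ℝ] L)) := by
  rw [curvature_apply, curvature_apply, map_add, map_smul, map_formBracket b hθ, ← hd, hθ]

theorem parity_curvature {d : Ω →ₗ[ℝ] Ω} {p : Ω →ₐ[ℝ] Ω} {θ : Dual ℝ L →ₗ[ℝ] Ω}
    (hp : ∀ l, p (θ l) = -θ l) (hd : ∀ u, d (p u) = -p (d u)) (l : Dual ℝ L) :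
    p (curvature b d θ l) = curvature b d θ l := by
  have parity_d : p (d (θ l)) = d (θ l) := by rw [← neg_inj, ← hd, hp, map_neg]
  simp only [curvature_apply, formBracket_apply, map_add, map_smul, map_sum, map_mul, hp,
    neg_mul_neg, parity_d]

section Bianchi

variable {θ : Dual ℝ L →ₗ[ℝ] Ω} (hθ : ∀ l m, θ l * θ m = -(θ m * θ l))
include hθ

theorem commute_formBracket (l m : Dual ℝ L) : Commute (formBracket b θ l) (θ m) := by
  rw [formBracket_apply]
  refine Commute.sum_left _ _ _ fun c _ => ?_
  rw [commute_iff_eq, mul_assoc, hθ _ m, mul_neg, ← mul_assoc, hθ _ m, neg_mul, neg_neg, mul_assoc]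

theorem two_smul_sum_mul_formBracket_coad (l : Dual ℝ L) :
    (2 : ℝ) • ∑ c, θ (b.coord c) * formBracket b θ (coad (b c) l)
      = ∑ c, formBracket b θ (b.coord c) * θ (coad (b c) l) := by
  have swap : ∑ c, ∑ e, θ (b.coord c) * (θ (b.coord e) * θ (coad (b c) (coad (b e) l)))
      = -∑ c, ∑ e, θ (b.coord c) * (θ (b.coord e) * θ (coad (b e) (coad (b c) l))) := by
    rw [Finset.sum_comm, ← Finset.sum_neg_distrib]
    congr! 1 with c
    rw [← Finset.sum_neg_distrib]
    congr! 1 with e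
    rw [← mul_assoc, hθ, neg_mul, mul_assoc]
  have invariance (c) : ∑ e, θ (b.coord e) * θ (coad ⁅b c, b e⁆ l)
      = ∑ e, θ (coad (b c) (b.coord e)) * θ (coad (b e) l) :=
    (sum_coord_comp b (LinearMap.mk₂ ℝ (fun ξ m => θ m * θ (coad ξ l)) (by simp [mul_add])
      (by simp) (by simp [add_mul]) (by simp)) (LieAlgebra.ad ℝ L (b c))).symm
  calc (2 : ℝ) • ∑ c, θ (b.coord c) * formBracket b θ (coad (b c) l)
      = ∑ c, θ (b.coord c) * ∑ e, θ (b.coord e) * θ (coad ⁅b c, b e⁆ l) := by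
        simp only [coad_lie, map_sub, mul_sub, Finset.mul_sum, Finset.sum_sub_distrib, swap,
          formBracket_apply, two_smul, sub_neg_eq_add]
    _ = ∑ c, ∑ e, θ (b.coord c) * θ (coad (b c) (b.coord e)) * θ (coad (b e) l) := by
        simp only [invariance, Finset.mul_sum, mul_assoc]
    _ = ∑ c, formBracket b θ (b.coord c) * θ (coad (b c) l) := by
        rw [Finset.sum_comm]
        simp only [formBracket_apply, Finset.sum_mul]

/-- The Jacobi identity `[θ, [θ, θ]] = 0`. -/
theorem sum_mul_formBracket_coad (l : Dual ℝ L) :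
    ∑ c, θ (b.coord c) * formBracket b θ (coad (b c) l) = 0 := by
  set T := ∑ c, θ (b.coord c) * formBracket b θ (coad (b c) l) with hT
  have h : T = -((2 : ℝ) • T) := by
    rw [two_smul_sum_mul_formBracket_coad b hθ, hT]
    simp only [← (commute_formBracket b hθ _ _).eq]
    exact sum_coad_swap b ((LinearMap.mul ℝ Ω).compl₁₂ (formBracket b θ) θ) l
  have h3 : (3 : ℝ) • T = 0 := by
    rw [← two_add_one_eq_three, add_smul, one_smul, add_comm]
    exact eq_neg_iff_add_eq_zero.mp h
  exact (smul_eq_zero.mp h3).resolve_left three_ne_zero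

theorem d_curvature {d : Ω →ₗ[ℝ] Ω} {p : Ω →ₐ[ℝ] Ω} (hd : IsSkewDerivation p d)
    (hdd : ∀ l, d (d (θ l)) = 0) (hp : ∀ l, p (θ l) = -θ l)
    (hdθ : ∀ l m, Commute (d (θ l)) (θ m)) (l : Dual ℝ L) :
    d (curvature b d θ l) = -∑ c, θ (b.coord c) * curvature b d θ (coad (b c) l) := by
  have swap : ∑ c, d (θ (b.coord c)) * θ (coad (b c) l)
      = -∑ c, θ (b.coord c) * d (θ (coad (b c) l)) := by
    simp only [(hdθ _ _).eq]
    exact sum_coad_swap b ((LinearMap.mul ℝ Ω).compl₁₂ θ (d ∘ₗ θ)) l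
  have d_bracket : d (formBracket b θ l)
      = -((2 : ℝ) • ∑ c, θ (b.coord c) * d (θ (coad (b c) l))) := by
    simp only [formBracket_apply, map_sum, hd _ _, hp, neg_mul, Finset.sum_add_distrib,
      Finset.sum_neg_distrib, swap, two_smul, neg_add]
  simp only [curvature_apply, map_add, map_smul, hdd, d_bracket, mul_add, mul_smul_comm,
    Finset.sum_add_distrib, ← Finset.smul_sum, sum_mul_formBracket_coad b hθ]
  module

end Bianchi

variable {S : Type*} [CommRing S] [Algebra ℝ S]

/-- The equivariant curvature `dθ + ½ [θ, θ] - (-1 + f) ξ_a Θ^a`. -/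
def equivCurvature (d : Ω →ₗ[ℝ] Ω) (θ : Dual ℝ L →ₗ[ℝ] Ω) (f : Ω) (Θ : Dual ℝ L →ₗ[ℝ] S) :
    Dual ℝ L →ₗ[ℝ] S ⊗[ℝ] Ω :=
  TensorProduct.mk ℝ S Ω 1 ∘ₗ curvature b d θ
    - (TensorProduct.mk ℝ S Ω).flip (-1 + f) ∘ₗ Θ

theorem equivCurvature_apply (d : Ω →ₗ[ℝ] Ω) (θ : Dual ℝ L →ₗ[ℝ] Ω) (f : Ω)
    (Θ : Dual ℝ L →ₗ[ℝ] S) (l : Dual ℝ L) :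
    equivCurvature b d θ f Θ l = 1 ⊗ₜ curvature b d θ l - Θ l ⊗ₜ (-1 + f) := rfl

theorem map_equivCurvature {d : Ω →ₗ[ℝ] Ω} {φ : Ω →ₐ[ℝ] Ω} (hd : ∀ u, d (φ u) = φ (d u))
    {θ : Dual ℝ L →ₗ[ℝ] Ω} {A : L →ₗ⁅ℝ⁆ L}
    (hθ : ∀ l, φ (θ l) = θ (l ∘ₗ (A : L →ₗ[ℝ] L))) {f : Ω} (hf : φ f = f) {ψ : S →ₐ[ℝ] S}
    {Θ : Dual ℝ L →ₗ[ℝ] S} (hΘ : ∀ l, ψ (Θ l) = Θ (l ∘ₗ (A : L →ₗ[ℝ] L))) (l : Dual ℝ L) :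
    Algebra.TensorProduct.map ψ φ (equivCurvature b d θ f Θ l)
      = equivCurvature b d θ f Θ (l ∘ₗ (A : L →ₗ[ℝ] L)) := by
  rw [equivCurvature_apply, equivCurvature_apply, map_sub, Algebra.TensorProduct.map_tmul,
    Algebra.TensorProduct.map_tmul, map_curvature b hd hθ, hΘ, map_add, map_neg, map_one, map_one,
    hf]

theorem sum_mul_equivCurvature {d : Ω →ₗ[ℝ] Ω} {θ : Dual ℝ L →ₗ[ℝ] Ω} {f : Ω}
    (hf : ∀ u, Commute f u) (Θ : Dual ℝ L →ₗ[ℝ] S) (l : Dual ℝ L) :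
    ∑ c, ((1 : S) ⊗ₜ[ℝ] θ (b.coord c)) * equivCurvature b d θ f Θ (coad (b c) l)
      = 1 ⊗ₜ (∑ c, θ (b.coord c) * curvature b d θ (coad (b c) l))
        + ∑ c, Θ (b.coord c) ⊗ₜ ((-1 + f) * θ (coad (b c) l)) := by
  have swap : ∑ c, Θ (coad (b c) l) ⊗ₜ[ℝ] ((-1 + f) * θ (b.coord c))
      = -∑ c, Θ (b.coord c) ⊗ₜ[ℝ] ((-1 + f) * θ (coad (b c) l)) :=
    sum_coad_swap b ((TensorProduct.mk ℝ S Ω).compl₁₂ Θ (LinearMap.mulLeft ℝ (-1 + f) ∘ₗ θ)) l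
  have hf' (u) : u * (-1 + f) = (-1 + f) * u := by
    rw [add_mul, mul_add, (hf _).eq, neg_one_mul, mul_neg_one]
  simp only [equivCurvature_apply, mul_sub, Algebra.TensorProduct.tmul_mul_tmul, one_mul, hf',
    Finset.sum_sub_distrib, swap, sub_neg_eq_add, TensorProduct.tmul_sum]

section EquivariantBianchi

variable {θ : Dual ℝ L →ₗ[ℝ] Ω} {p : Ω →ₐ[ℝ] Ω} (hp : ∀ l, p (θ l) = -θ l) {f : Ω}
  (hf : ∀ u, Commute f u)
include hp hf

theorem contr_formBracket {i : Ω →ₗ[ℝ] Ω} (hi : IsSkewDerivation p i) {ξ : L}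
    (hiθ : ∀ l, i (θ l) = l ξ • f) (l : Dual ℝ L) :
    i (formBracket b θ l) = (2 : ℝ) • (f * θ (coad ξ l)) := by
  have left : ∑ c, i (θ (b.coord c)) * θ (coad (b c) l) = f * θ (coad ξ l) := by
    conv_rhs => rw [← b.sum_repr ξ]
    simp only [hiθ, map_sum, map_smul, LinearMap.sum_apply, LinearMap.smul_apply, Finset.mul_sum,
      smul_mul_assoc, mul_smul_comm, b.coord_apply]
  have right : ∑ c, θ (b.coord c) * i (θ (coad (b c) l)) = -(f * θ (coad ξ l)) := by
    rw [← b.sum_dual_apply_smul_coord (coad ξ l), map_sum, Finset.mul_sum,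
      ← Finset.sum_neg_distrib]
    congr! 1 with c
    rw [hiθ, mul_smul_comm, coad_apply, ← lie_skew, map_neg, map_smul, mul_smul_comm, (hf _).eq,
      coad_apply, neg_smul]
  simp only [formBracket_apply, map_sum, hi _ _, hp, neg_mul, Finset.sum_add_distrib,
    Finset.sum_neg_distrib, left, right, neg_neg, two_smul]

theorem contr_curvature {d i : Ω →ₗ[ℝ] Ω} (hi : IsSkewDerivation p i) {ξ : L}
    (hiθ : ∀ l, i (θ l) = l ξ • f) {l : Dual ℝ L}
    (hid : i (d (θ l)) = -θ (coad ξ l) - l ξ • d f) :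
    i (curvature b d θ l) = (-1 + f) * θ (coad ξ l) - l ξ • d f := by
  rw [curvature_apply, map_add, map_smul, contr_formBracket b hp hf hi hiθ, hid, smul_smul]
  norm_num
  noncomm_ring

/-- The equivariant Bianchi identity `D Ω = -[θ, Ω]`. -/
theorem tensorD_equivCurvature {d : Ω →ₗ[ℝ] Ω} {i : κ → Ω →ₗ[ℝ] Ω}
    (hd : IsSkewDerivation p d) (hdd : ∀ l, d (d (θ l)) = 0)
    (hθ : ∀ l m, θ l * θ m = -(θ m * θ l)) (hdθ : ∀ l m, Commute (d (θ l)) (θ m))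
    (hi : ∀ a, IsSkewDerivation p (i a)) (hif : ∀ a, i a f = 0)
    (hiθ : ∀ a l, i a (θ l) = l (b a) • f)
    (hid : ∀ a l, i a (d (θ l)) = -θ (coad (b a) l) - l (b a) • d f)
    (Θ : Dual ℝ L →ₗ[ℝ] S) (l : Dual ℝ L) :
    tensorD d i (fun a => Θ (b.coord a)) (equivCurvature b d θ f Θ l)
      = -∑ c, (1 ⊗ₜ θ (b.coord c)) * equivCurvature b d θ f Θ (coad (b c) l) := by
  have sum_df : ∑ c, Θ (b.coord c) ⊗ₜ[ℝ] (l (b c) • d f) = Θ l ⊗ₜ d f := by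
    conv_rhs => rw [← b.sum_dual_apply_smul_coord l]
    simp only [map_sum, map_smul, TensorProduct.sum_tmul, TensorProduct.smul_tmul]
  rw [sum_mul_equivCurvature b hf]
  simp only [equivCurvature_apply, map_sub, tensorD_tmul,
    d_curvature b hθ hd hdd hp hdθ, contr_curvature b hp hf (hi _) (hiθ _) (hid _ _), mul_one,
    map_add, map_neg, hd.map_one, (hi _).map_one, hif, neg_zero, add_zero, zero_add,
    TensorProduct.tmul_zero, Finset.sum_const_zero, sub_zero, TensorProduct.tmul_sub,
    Finset.sum_sub_distrib, sum_df, TensorProduct.tmul_neg]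
  abel

end EquivariantBianchi

end Curvature

/-! ### The exterior derivative -/

section Alternate

variable {V : Type*} [AddCommGroup V] [Module ℝ V] [FiniteDimensional ℝ V]

/-- `alternate` as a linear map. -/
def alternateₗ : (V →ₗ[ℝ] Form V) →ₗ[ℝ] Form V where
  toFun := alternate
  map_add' := alternate_add
  map_smul' := alternate_smul

theorem alternate_alternate_of_symm {B : V →ₗ[ℝ] V →ₗ[ℝ] Form V} (hB : ∀ v w, B v w = B w v) :
    alternate (alternateₗ ∘ₗ B) = 0 := by
  let b := finBasis ℝ V
  have expand : alternate (alternateₗ ∘ₗ B)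
      = ∑ i, ∑ j, oneForm (b.coord i) * (oneForm (b.coord j) * B (b i) (b j)) := by
    simp only [alternate, alternateₗ, LinearMap.comp_apply, LinearMap.coe_mk, AddHom.coe_mk,
      Finset.mul_sum, b]
  have neg_self : alternate (alternateₗ ∘ₗ B) = -alternate (alternateₗ ∘ₗ B) := by
    nth_rewrite 1 [expand]
    rw [Finset.sum_comm, expand, ← Finset.sum_neg_distrib]
    congr! 1 with i
    rw [← Finset.sum_neg_distrib]
    congr! 1 with j
    rw [hB, ← mul_assoc, oneForm_mul_swap, neg_mul, mul_assoc]
  have two_smul_eq : (2 : ℝ) • alternate (alternateₗ ∘ₗ B) = 0 := by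
    rw [two_smul]
    exact eq_neg_iff_add_eq_zero.mp neg_self
  exact (smul_eq_zero.mp two_smul_eq).resolve_left two_ne_zero

end Alternate

section ExteriorDerivative

variable {E : Type*} [NormedAddCommGroup E] [NormedSpace ℝ E] [FiniteDimensional ℝ E]

theorem extd_extd {s : Set E} {w : E → Form E} {y : E} (hw : ContDiffWithinAt ℝ ∞ w s y)
    (hs : UniqueDiffOn ℝ s) (hy : y ∈ s) (hc : y ∈ closure (interior s)) :
    extd s (extd s w) y = 0 := by
  have hdw := hw.fderivWithin_right hs (m := ∞) (by simp) hy
  have hsymm : IsSymmSndFDerivWithinAt ℝ w s y :=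
    (hw.of_le (m := 2) (by norm_cast)).isSymmSndFDerivWithinAt (by simp) hs hc hy
  have hext : (fderivWithin ℝ (extd s w) s y).toLinearMap
      = (alternateₗ ∘ₗ ContinuousLinearMap.coeLM ℝ) ∘ₗ
        (fderivWithin ℝ (fderivWithin ℝ w s) s y).toLinearMap :=
    fderivWithin_linear (alternateₗ ∘ₗ ContinuousLinearMap.coeLM ℝ)
      (hdw.differentiableWithinAt (by simp)) (hs y hy)
  rw [extd, hext, LinearMap.comp_assoc]
  exact alternate_alternate_of_symm fun v w => hsymm.eq v w

variable {H : Type*} [TopologicalSpace H]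
  (I : ModelWithCorners ℝ E H) {M : Type*} [TopologicalSpace M] [ChartedSpace H M]
  [IsManifold I ∞ M]

theorem dForm_dForm (u : DiffForm I M) : dForm I (dForm I u) = 0 := by
  refine Subtype.ext <| funext fun x => ?_
  have hr : extChartAt I x x ∈ range I := mem_range_self _
  have hrep : chartRep I (roughD I u.1) x =ᶠ[𝓝[range I] (extChartAt I x x)]
      extd (range I) (chartRep I u.1 x) := by
    filter_upwards [extChartAt_target_mem_nhdsWithin (I := I) x] with y hy
    exact chartRep_roughD I hy (u.2 _)
  change pull (chartD I x)
    (extd (range I) (chartRep I (roughD I u.1) x) (extChartAt I x x)) = 0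
  rw [extd_congr hrep hr, extd_extd (u.2 x) I.uniqueDiffOn hr (I.range_subset_closure_interior hr),
    map_zero]

theorem dForm_pullbackForm (f : M → M) (hf : ContMDiff I I ∞ f) (u : DiffForm I M) :
    dForm I (pullbackForm I f hf u) = pullbackForm I f hf (dForm I u) := by
  refine Subtype.ext <| funext fun x => ?_
  have hrep := (chartRep_pullback_smooth I hf (mem_extChartAt_source (I := I) x) (u.2 (f x))).2
  change pull (chartD I x)
      (extd (range I) (chartRep I (roughPullback I f u.1) x) (extChartAt I x x))
    = pull (mfderiv I I f x).toLinearMap (pull (chartD I (f x)) _)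
  rw [hrep, pull_pull, pull_pull]
  congr 2
  refine LinearMap.ext fun v => ?_
  change fderivWithin ℝ (coordMap I f x (f x)) (range I) (extChartAt I x x) (chartD I x v)
    = chartD I (f x) (mfderiv I I f x v)
  rw [chartD_eq, chartD_eq, (hf.mdifferentiableAt (by simp)).mfderiv]
  rfl

end ExteriorDerivative

/-! ### Degrees -/

section ExteriorPower

variable {V V' : Type*} [AddCommGroup V] [Module ℝ V] [AddCommGroup V'] [Module ℝ V']

theorem oneForm_mem_exteriorPower (l : Dual ℝ V) : oneForm l ∈ ⋀[ℝ]^1 (Dual ℝ V) := by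
  rw [ExteriorAlgebra.exteriorPower, pow_one]
  exact LinearMap.mem_range_self _ l

theorem pull_mem_exteriorPower (A : V →ₗ[ℝ] V') {k : ℕ} {u : Form V'}
    (hu : u ∈ ⋀[ℝ]^k (Dual ℝ V')) : pull A u ∈ ⋀[ℝ]^k (Dual ℝ V) := by
  have map_le : (⋀[ℝ]^k (Dual ℝ V')).map (pull A).toLinearMap ≤ ⋀[ℝ]^k (Dual ℝ V) := by
    rw [ExteriorAlgebra.exteriorPower, ExteriorAlgebra.exteriorPower, Submodule.map_pow]
    refine pow_le_pow_left' ?_ k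
    rintro _ ⟨_, ⟨l, rfl⟩, rfl⟩
    exact ⟨l ∘ₗ A, (pull_oneForm A l).symm⟩
  exact map_le (Submodule.mem_map_of_mem hu)

theorem alternate_mem_exteriorPower [FiniteDimensional ℝ V] {k : ℕ} {L : V →ₗ[ℝ] Form V}
    (hL : ∀ v, L v ∈ ⋀[ℝ]^k (Dual ℝ V)) : alternate L ∈ ⋀[ℝ]^(1 + k) (Dual ℝ V) :=
  Submodule.sum_mem _ fun _ _ => SetLike.mul_mem_graded (oneForm_mem_exteriorPower _) (hL _)

end ExteriorPower

section TotalDegree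

variable {R A B : Type*} [CommSemiring R] [Semiring A] [Algebra R A] [Semiring B] [Algebra R B]

theorem map₂_mk_mul_map₂_mk_le (P P' : Submodule R A) (Q Q' : Submodule R B) :
    Submodule.map₂ (TensorProduct.mk R A B) P Q * Submodule.map₂ (TensorProduct.mk R A B) P' Q'
      ≤ Submodule.map₂ (TensorProduct.mk R A B) (P * P') (Q * Q') := by
  rw [Submodule.map₂_eq_span_image2, Submodule.map₂_eq_span_image2, Submodule.span_mul_span,
    Submodule.span_le]
  rintro _ ⟨_, ⟨F, hF, u, hu, rfl⟩, _, ⟨K, hK, w, hw, rfl⟩, rfl⟩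
  change F ⊗ₜ[R] u * K ⊗ₜ[R] w ∈ _
  rw [Algebra.TensorProduct.tmul_mul_tmul]
  exact Submodule.apply_mem_map₂ (TensorProduct.mk R A B) (Submodule.mul_mem_mul hF hK)
    (Submodule.mul_mem_mul hu hw)

theorem iSup_map₂_mk_mul_le {P : ℕ → Submodule R A} {Q : ℕ → Submodule R B}
    (hP : ∀ p q, P p * P q ≤ P (p + q)) (hQ : ∀ k l, Q k * Q l ≤ Q (k + l)) (m n : ℕ) :
    (⨆ (p) (k) (_ : 2 * p + k = m), Submodule.map₂ (TensorProduct.mk R A B) (P p) (Q k)) *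
        (⨆ (p) (k) (_ : 2 * p + k = n), Submodule.map₂ (TensorProduct.mk R A B) (P p) (Q k))
      ≤ ⨆ (p) (k) (_ : 2 * p + k = m + n),
          Submodule.map₂ (TensorProduct.mk R A B) (P p) (Q k) := by
  simp only [Submodule.iSup_mul, Submodule.mul_iSup, iSup_le_iff]
  intro p k hpk q l hql
  refine (map₂_mk_mul_map₂_mk_le _ _ _ _).trans <|
    (Submodule.map₂_le_map₂ (hP _ _) (hQ _ _)).trans ?_
  exact le_iSup_of_le _ <| le_iSup_of_le _ <| le_iSup_of_le (by omega) le_rfl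

end TotalDegree

section Degree

variable {E : Type*} [NormedAddCommGroup E] [NormedSpace ℝ E] [FiniteDimensional ℝ E]
  {H : Type*} [TopologicalSpace H]
  {EG : Type*} [NormedAddCommGroup EG] [NormedSpace ℝ EG] {HG : Type*} [TopologicalSpace HG]
  (J : ModelWithCorners ℝ EG HG) (I : ModelWithCorners ℝ E H)
  {G : Type*} [TopologicalSpace G] [ChartedSpace HG G] [Group G]
  {M : Type*} [TopologicalSpace M] [ChartedSpace H M]

theorem mul_mem_formDeg {k m : ℕ} {u w : DiffForm I M} (hu : u ∈ formDeg I M k)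
    (hw : w ∈ formDeg I M m) : u * w ∈ formDeg I M (k + m) :=
  fun x => SetLike.mul_mem_graded (hu x) (hw x)

theorem formDeg_mul_le (k m : ℕ) : formDeg I M k * formDeg I M m ≤ formDeg I M (k + m) :=
  Submodule.mul_le.mpr fun _ hu _ hw => mul_mem_formDeg I hu hw

theorem one_mem_formDeg : (1 : DiffForm I M) ∈ formDeg I M 0 :=
  fun x => SetLike.one_mem_graded fun k => ⋀[ℝ]^k (Dual ℝ (TangentSpace I x))

theorem funForm_mem_formDeg [IsManifold I ∞ M] (f : M → ℝ) (hf : ContMDiff I 𝓘(ℝ, ℝ) ∞ f) :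
    funForm I f hf ∈ formDeg I M 0 :=
  fun x => SetLike.algebraMap_mem_graded (fun k => ⋀[ℝ]^k (Dual ℝ (TangentSpace I x))) (f x)

/-- Since the covectors are a direct summand of the forms, they contain the derivatives of functions
with values in them. -/
theorem fderivWithin_oneForm_mem {F : Type*} [NormedAddCommGroup F] [NormedSpace ℝ F] {s : Set F}
    {y : F} {l : F → Dual ℝ E} (hl : DifferentiableWithinAt ℝ (fun z => oneForm (l z)) s y)
    (hs : UniqueDiffWithinAt ℝ s y) (v : F) :
    fderivWithin ℝ (fun z => oneForm (l z)) s y v ∈ ⋀[ℝ]^1 (Dual ℝ E) := by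
  let P : Form E →ₗ[ℝ] Form E := oneForm ∘ₗ ExteriorAlgebra.ιInv
  have hP (m : Dual ℝ E) : P (oneForm m) = oneForm m :=
    congrArg oneForm (ExteriorAlgebra.ι_leftInverse m)
  have hD := fderivWithin_linear P hl hs
  simp only [hP] at hD
  rw [← ContinuousLinearMap.coe_coe, hD]
  exact oneForm_mem_exteriorPower _

theorem dForm_oneForm_mem_formDeg [IsManifold I ∞ M] (l : (x : M) → Dual ℝ (TangentSpace I x))
    (hl : ∀ x, SmoothFormAt I (fun y => oneForm (l y) : RoughForm I M) x) :
    dForm I ⟨fun y => oneForm (l y), hl⟩ ∈ formDeg I M 2 := by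
  intro x
  have hrep : chartRep I (fun y => oneForm (l y) : RoughForm I M) x
      = fun z => oneForm (l ((extChartAt I x).symm z) ∘ₗ chartInvD I x z) :=
    funext fun z => pull_oneForm _ _
  refine pull_mem_exteriorPower _ (alternate_mem_exteriorPower (k := 1) fun v => ?_)
  have hdiff := smoothFormAt_differentiable I (hl x)
  rw [hrep] at hdiff
  change fderivWithin ℝ (chartRep I _ x) (range I) (extChartAt I x x) v ∈ _
  rw [hrep]
  exact fderivWithin_oneForm_mem hdiff (uniqueDiff_chart I x) v

theorem one_mem_polyDeg : (1 : Poly J G) ∈ polyDeg J G 0 := by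
  rw [polyDeg, pow_zero]
  exact Submodule.one_le.mp le_rfl

theorem ι_mem_polyDeg (l : Dual ℝ (GroupLieAlgebra J G)) :
    SymmetricAlgebra.ι ℝ _ l ∈ polyDeg J G 1 := by
  rw [polyDeg, pow_one]
  exact LinearMap.mem_range_self _ l

theorem tmul_mem_cartanDeg {p k n : ℕ} (h : 2 * p + k = n) {F : Poly J G} {u : DiffForm I M}
    (hF : F ∈ polyDeg J G p) (hu : u ∈ formDeg I M k) : F ⊗ₜ[ℝ] u ∈ cartanDeg J I G M n :=
  Submodule.mem_iSup_of_mem p <| Submodule.mem_iSup_of_mem k <| Submodule.mem_iSup_of_mem h <|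
    Submodule.apply_mem_map₂ (TensorProduct.mk ℝ (Poly J G) (DiffForm I M)) hF hu

theorem one_mem_cartanDeg : (1 : CartanAlg J I G M) ∈ cartanDeg J I G M 0 :=
  tmul_mem_cartanDeg J I (p := 0) (k := 0) rfl (one_mem_polyDeg J) (one_mem_formDeg I)

theorem cartanDeg_mul_le (m n : ℕ) :
    cartanDeg J I G M m * cartanDeg J I G M n ≤ cartanDeg J I G M (m + n) :=
  iSup_map₂_mk_mul_le (fun _ _ => (pow_add _ _ _).ge) (formDeg_mul_le I) m n

theorem cartanDeg_pow_le (m q : ℕ) : cartanDeg J I G M m ^ q ≤ cartanDeg J I G M (m * q) := by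
  induction q with
  | zero =>
    refine (Submodule.pow_zero _).trans_le (Submodule.one_le.mpr ?_)
    exact one_mem_cartanDeg J I
  | succ q ih =>
    refine (Submodule.pow_succ (cartanDeg J I G M m) (n := q)).trans_le ?_
    exact (mul_le_mul' ih le_rfl).trans (cartanDeg_mul_le J I _ _)

variable [MulAction G M] [IsManifold I ∞ M] {f : M → ℝ}
  {θ : (x : M) → TangentSpace I x →ₗ[ℝ] GroupLieAlgebra J G}
  {κ : Type*} [Fintype κ] (b : Basis κ ℝ (GroupLieAlgebra J G))

theorem degConn_mem_formDeg (hf : IsCutoff I G f) (hθ : IsConnection J I θ)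
    (l : Dual ℝ (GroupLieAlgebra J G)) : degConn J I hf hθ l ∈ formDeg I M 1 :=
  fun _ => oneForm_mem_exteriorPower _

theorem formCurvature_mem_formDeg (hf : IsCutoff I G f) (hθ : IsConnection J I θ) (a : κ) :
    formCurvature J I b hf hθ a ∈ formDeg I M 2 :=
  add_mem (dForm_oneForm_mem_formDeg I _ _) <| Submodule.smul_mem _ _ <|
    sum_mem fun _ _ => sum_mem fun _ _ => Submodule.smul_mem _ _ <|
      mul_mem_formDeg I (k := 1) (m := 1) (degConn_mem_formDeg J I hf hθ _)
        (degConn_mem_formDeg J I hf hθ _)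

theorem degCurvature_mem_cartanDeg (hf : IsCutoff I G f) (hθ : IsConnection J I θ) (a : κ) :
    degCurvature J I b hf hθ a ∈ cartanDeg J I G M 2 :=
  sub_mem
    (tmul_mem_cartanDeg J I (p := 0) (k := 2) rfl (one_mem_polyDeg J)
      (formCurvature_mem_formDeg J I b hf hθ a))
    (tmul_mem_cartanDeg J I (p := 1) (k := 0) rfl (ι_mem_polyDeg J _)
      (add_mem (neg_mem (one_mem_formDeg I)) (funForm_mem_formDeg I f hf.smooth)))

variable [LieGroup J ∞ G]

theorem chernWeil_mem_cartanDeg (hf : IsCutoff I G f) (hθ : IsConnection J I θ) (q : ℕ)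
    {F : Poly J G} (hF : F ∈ polyDeg J G q) :
    chernWeil J I b hf hθ F ∈ cartanDeg J I G M (2 * q) := by
  have generators : (LinearMap.range (SymmetricAlgebra.ι ℝ (Dual ℝ (GroupLieAlgebra J G)))).map
      (chernWeil J I b hf hθ).toLinearMap ≤ cartanDeg J I G M 2 := by
    rintro _ ⟨_, ⟨l, rfl⟩, rfl⟩
    change chernWeil J I b hf hθ _ ∈ _
    rw [chernWeil_ι]
    exact sum_mem fun a _ => Submodule.smul_mem _ _ (degCurvature_mem_cartanDeg J I b hf hθ a)
  have map_le : (polyDeg J G q).map (chernWeil J I b hf hθ).toLinearMap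
      ≤ cartanDeg J I G M (2 * q) := by
    rw [polyDeg, Submodule.map_pow]
    exact (pow_le_pow_left' generators q).trans (cartanDeg_pow_le J I 2 q)
  exact map_le (Submodule.mem_map_of_mem hF)

end Degree

/-! ### Mixed partial derivatives -/

section MixedPartials

variable {F E E' : Type*} [NormedAddCommGroup F] [NormedSpace ℝ F]
  [NormedAddCommGroup E] [NormedSpace ℝ E] [NormedAddCommGroup E'] [NormedSpace ℝ E']
  {Ψ : F × E → E'} {t : Set F} {s : Set E} {a₀ : F} {y₀ : E}

theorem fderivWithin_comp_prodMk_right {a : F} (ha : a ∈ t)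
    (hΨ : DifferentiableWithinAt ℝ Ψ (t ×ˢ s) (a, y₀)) (hs : UniqueDiffWithinAt ℝ s y₀) :
    fderivWithin ℝ (fun y => Ψ (a, y)) s y₀
      = fderivWithin ℝ Ψ (t ×ˢ s) (a, y₀) ∘L ContinuousLinearMap.inr ℝ F E :=
  (hΨ.hasFDerivWithinAt.comp y₀ (hasFDerivAt_prodMk_right a y₀).hasFDerivWithinAt
    fun _ hy => mk_mem_prod ha hy).fderivWithin hs

theorem fderivWithin_comp_prodMk_left {y : E} (hy : y ∈ s)
    (hΨ : DifferentiableWithinAt ℝ Ψ (t ×ˢ s) (a₀, y)) (ht : UniqueDiffWithinAt ℝ t a₀) :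
    fderivWithin ℝ (fun a => Ψ (a, y)) t a₀
      = fderivWithin ℝ Ψ (t ×ˢ s) (a₀, y) ∘L ContinuousLinearMap.inl ℝ F E :=
  (hΨ.hasFDerivWithinAt.comp a₀ (hasFDerivAt_prodMk_left a₀ y).hasFDerivWithinAt
    fun _ ha => mk_mem_prod ha hy).fderivWithin ht

theorem hasFDerivWithinAt_fderivWithin_comp_prodMk_right
    (hdiff : ∀ᶠ p in 𝓝[t ×ˢ s] (a₀, y₀), DifferentiableWithinAt ℝ Ψ (t ×ˢ s) p)
    {D : F × E →L[ℝ] F × E →L[ℝ] E'}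
    (hD : HasFDerivWithinAt (fderivWithin ℝ Ψ (t ×ˢ s)) D (t ×ˢ s) (a₀, y₀))
    (hs : UniqueDiffWithinAt ℝ s y₀) (ha : a₀ ∈ t) (hy : y₀ ∈ s) :
    HasFDerivWithinAt (fun a => fderivWithin ℝ (fun y => Ψ (a, y)) s y₀)
      ((ContinuousLinearMap.compL ℝ E (F × E) E').flip (ContinuousLinearMap.inr ℝ F E) ∘L
        D ∘L ContinuousLinearMap.inl ℝ F E) t a₀ := by
  have hslice : HasFDerivWithinAt (fun a => (a, y₀)) (ContinuousLinearMap.inl ℝ F E) t a₀ :=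
    (hasFDerivAt_prodMk_left a₀ y₀).hasFDerivWithinAt
  have hmaps : MapsTo (fun a => (a, y₀)) t (t ×ˢ s) := fun _ ha => ⟨ha, hy⟩
  have heq : (fun a => fderivWithin ℝ (fun y => Ψ (a, y)) s y₀) =ᶠ[𝓝[t] a₀] fun a =>
      (ContinuousLinearMap.compL ℝ E (F × E) E').flip (ContinuousLinearMap.inr ℝ F E)
        (fderivWithin ℝ Ψ (t ×ˢ s) (a, y₀)) := by
    filter_upwards [(hslice.continuousWithinAt.tendsto_nhdsWithin hmaps).eventually hdiff,
      eventually_mem_nhdsWithin] with a hΨ ha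
    exact fderivWithin_comp_prodMk_right ha hΨ hs
  exact ((ContinuousLinearMap.hasFDerivAt _).comp_hasFDerivWithinAt a₀
    (hD.comp a₀ hslice hmaps)).congr_of_eventuallyEq heq (heq.self_of_nhdsWithin ha)

theorem hasFDerivWithinAt_fderivWithin_comp_prodMk_left
    (hdiff : ∀ᶠ p in 𝓝[t ×ˢ s] (a₀, y₀), DifferentiableWithinAt ℝ Ψ (t ×ˢ s) p)
    {D : F × E →L[ℝ] F × E →L[ℝ] E'}
    (hD : HasFDerivWithinAt (fderivWithin ℝ Ψ (t ×ˢ s)) D (t ×ˢ s) (a₀, y₀))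
    (ht : UniqueDiffWithinAt ℝ t a₀) (ha : a₀ ∈ t) (hy : y₀ ∈ s) :
    HasFDerivWithinAt (fun y => fderivWithin ℝ (fun a => Ψ (a, y)) t a₀)
      ((ContinuousLinearMap.compL ℝ F (F × E) E').flip (ContinuousLinearMap.inl ℝ F E) ∘L
        D ∘L ContinuousLinearMap.inr ℝ F E) s y₀ := by
  have hslice : HasFDerivWithinAt (fun y => (a₀, y)) (ContinuousLinearMap.inr ℝ F E) s y₀ :=
    (hasFDerivAt_prodMk_right a₀ y₀).hasFDerivWithinAt
  have hmaps : MapsTo (fun y => (a₀, y)) s (t ×ˢ s) := fun _ hy => ⟨ha, hy⟩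
  have heq : (fun y => fderivWithin ℝ (fun a => Ψ (a, y)) t a₀) =ᶠ[𝓝[s] y₀] fun y =>
      (ContinuousLinearMap.compL ℝ F (F × E) E').flip (ContinuousLinearMap.inl ℝ F E)
        (fderivWithin ℝ Ψ (t ×ˢ s) (a₀, y)) := by
    filter_upwards [(hslice.continuousWithinAt.tendsto_nhdsWithin hmaps).eventually hdiff,
      eventually_mem_nhdsWithin] with y hΨ hy
    exact fderivWithin_comp_prodMk_left hy hΨ ht
  exact ((ContinuousLinearMap.hasFDerivAt _).comp_hasFDerivWithinAt y₀
    (hD.comp y₀ hslice hmaps)).congr_of_eventuallyEq heq (heq.self_of_nhdsWithin hy)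

theorem exists_mixed_partial (hΨ : ContDiffWithinAt ℝ ∞ Ψ (t ×ˢ s) (a₀, y₀))
    (ht : UniqueDiffOn ℝ t) (hs : UniqueDiffOn ℝ s) (ha : a₀ ∈ t) (hy : y₀ ∈ s)
    (hat : a₀ ∈ closure (interior t)) (hys : y₀ ∈ closure (interior s)) :
    ∃ B : F →L[ℝ] E →L[ℝ] E',
      HasFDerivWithinAt (fun a => fderivWithin ℝ (fun y => Ψ (a, y)) s y₀) B t a₀ ∧
      HasFDerivWithinAt (fun y => fderivWithin ℝ (fun a => Ψ (a, y)) t a₀) B.flip s y₀ := by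
  have hp : (a₀, y₀) ∈ t ×ˢ s := ⟨ha, hy⟩
  have hclosure : (a₀, y₀) ∈ closure (interior (t ×ˢ s)) := by
    rw [interior_prod_eq, closure_prod_eq]
    exact ⟨hat, hys⟩
  have hdiff : ∀ᶠ p in 𝓝[t ×ˢ s] (a₀, y₀), DifferentiableWithinAt ℝ Ψ (t ×ˢ s) p := by
    have hev := (hΨ.of_le (m := 1) (by norm_cast)).eventually (by simp)
    rw [insert_eq_of_mem hp] at hev
    exact hev.mono fun p h => h.differentiableWithinAt one_ne_zero
  have hD := ((hΨ.fderivWithin_right (ht.prod hs) (m := ∞) (by simp) hp).differentiableWithinAt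
    (by simp)).hasFDerivWithinAt
  have hsymm : IsSymmSndFDerivWithinAt ℝ Ψ (t ×ˢ s) (a₀, y₀) :=
    (hΨ.of_le (m := 2) (by norm_cast)).isSymmSndFDerivWithinAt (by simp) (ht.prod hs) hclosure hp
  refine ⟨_, hasFDerivWithinAt_fderivWithin_comp_prodMk_right hdiff hD (hs y₀ hy) ha hy, ?_⟩
  convert! hasFDerivWithinAt_fderivWithin_comp_prodMk_left hdiff hD (ht a₀ ha) ha hy using 1
  ext v ξ
  exact hsymm.eq _ _

/-- Cartan's formula `ι_Z dα = L_Z α - d(ι_Z α)` for the field `Z = ∂Ψ/∂a (ξ)`: here `ρ` is the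
pullback of `α` along `Ψ(a, ·)`, evaluated at `v`, and `k` is the contraction of `α` with `Z`. -/
theorem fderivWithin_oneForm_of_pullback {Ψ : F × E → E}
    (hΨ : ContDiffWithinAt ℝ ∞ Ψ (univ ×ˢ s) (a₀, y₀)) (hs : UniqueDiffOn ℝ s) (hy : y₀ ∈ s)
    (hc : y₀ ∈ closure (interior s)) (hΨ₀ : ∀ᶠ y in 𝓝[s] y₀, Ψ (a₀, y) = y)
    (hmem : ∀ᶠ a in 𝓝 a₀, Ψ (a, y₀) ∈ s)
    {α : E → E →L[ℝ] ℝ} (hα : DifferentiableWithinAt ℝ α s y₀) (ξ : F) (v : E)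
    {ρ : F → ℝ} {ρ' : F →L[ℝ] ℝ} (hρ : HasFDerivAt ρ ρ' a₀)
    (hpull : ∀ᶠ a in 𝓝 a₀, α (Ψ (a, y₀)) (fderivWithin ℝ (fun y => Ψ (a, y)) s y₀ v) = ρ a)
    {k : E → ℝ} {k' : E →L[ℝ] ℝ} (hk : HasFDerivWithinAt k k' s y₀)
    (hcontr : ∀ᶠ y in 𝓝[s] y₀, α y (fderiv ℝ (fun a => Ψ (a, y)) a₀ ξ) = k y) :
    fderivWithin ℝ α s y₀ (fderiv ℝ (fun a => Ψ (a, y₀)) a₀ ξ) v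
      - fderivWithin ℝ α s y₀ v (fderiv ℝ (fun a => Ψ (a, y₀)) a₀ ξ) = ρ' ξ - k' v := by
  obtain ⟨B, hB, hBflip⟩ := exists_mixed_partial hΨ uniqueDiffOn_univ hs (mem_univ _) hy
    (by simp) hc
  rw [hasFDerivWithinAt_univ] at hB
  simp only [fderivWithin_univ] at hBflip
  have hbase : Ψ (a₀, y₀) = y₀ := hΨ₀.self_of_nhdsWithin hy
  have hid : fderivWithin ℝ (fun y => Ψ (a₀, y)) s y₀ = ContinuousLinearMap.id ℝ E :=
    (EventuallyEq.fderivWithin_eq_of_mem hΨ₀ hy).trans (fderivWithin_id (hs y₀ hy))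
  have hΨa : DifferentiableAt ℝ (fun a => Ψ (a, y₀)) a₀ :=
    differentiableWithinAt_univ.mp <| (hΨ.differentiableWithinAt (by simp)).comp a₀
      (hasFDerivAt_prodMk_left a₀ y₀).differentiableAt.differentiableWithinAt
      fun a _ => mk_mem_prod (mem_univ a) hy
  have hαΨ : HasFDerivAt (fun a => α (Ψ (a, y₀)))
      (fderivWithin ℝ α s y₀ ∘L fderiv ℝ (fun a => Ψ (a, y₀)) a₀) a₀ := by
    have hα' : HasFDerivWithinAt α (fderivWithin ℝ α s y₀) s (Ψ (a₀, y₀)) := by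
      rw [hbase]
      exact hα.hasFDerivWithinAt
    exact hα'.comp_hasFDerivAt a₀ hΨa.hasFDerivAt hmem
  have along_orbit : fderivWithin ℝ α s y₀ (fderiv ℝ (fun a => Ψ (a, y₀)) a₀ ξ) v
      + α y₀ (B ξ v) = ρ' ξ := by
    have h := (hαΨ.clm_apply (hB.clm_apply (hasFDerivAt_const v a₀))).unique
      (hρ.congr_of_eventuallyEq hpull)
    simpa [hbase, hid, add_comm] using DFunLike.congr_fun h ξ
  have along_v : fderivWithin ℝ α s y₀ v (fderiv ℝ (fun a => Ψ (a, y₀)) a₀ ξ)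
      + α y₀ (B ξ v) = k' v := by
    have h := (hs y₀ hy).eq (hα.hasFDerivWithinAt.clm_apply
      (hBflip.clm_apply (hasFDerivWithinAt_const ξ y₀ s)))
      (hk.congr_of_eventuallyEq hcontr (hcontr.self_of_nhdsWithin hy))
    simpa [add_comm] using DFunLike.congr_fun h v
  rw [← along_orbit, ← along_v, add_sub_add_right_eq_sub]

end MixedPartials

/-! ### Maps in charts -/

section Charts

variable {E : Type*} [NormedAddCommGroup E] [NormedSpace ℝ E]
  {H : Type*} [TopologicalSpace H] {I : ModelWithCorners ℝ E H}
  {M : Type*} [TopologicalSpace M] [ChartedSpace H M] [IsManifold I ∞ M]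
  {E' : Type*} [NormedAddCommGroup E'] [NormedSpace ℝ E']
  {H' : Type*} [TopologicalSpace H'] {I' : ModelWithCorners ℝ E' H'}
  {M' : Type*} [TopologicalSpace M'] [ChartedSpace H' M'] [IsManifold I' ∞ M']

theorem contDiffWithinAt_chart {f : M → M'} (hf : ContMDiff I I' ∞ f) {c x : M} {c' : M'}
    (hx : x ∈ (extChartAt I c).source) (hx' : f x ∈ (extChartAt I' c').source) :
    ContDiffWithinAt ℝ ∞ (extChartAt I' c' ∘ f ∘ (extChartAt I c).symm) (range I)
      (extChartAt I c x) :=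
  ((contMDiffAt_iff_of_mem_source (extChartAt_source I c ▸ hx)
    (extChartAt_source I' c' ▸ hx')).mp (hf x)).2

theorem mfderiv_mfderivWithin_extChartAt_symm {f : M → M'} {c : M} {c' : M'} {y : E}
    (hy : y ∈ (extChartAt I c).target)
    (hf : MDifferentiableAt I I' f ((extChartAt I c).symm y))
    (hy' : f ((extChartAt I c).symm y) ∈ (extChartAt I' c').source) (v : E) :
    (mfderiv I I' f ((extChartAt I c).symm y)
        (mfderivWithin 𝓘(ℝ, E) I (extChartAt I c).symm (range I) y v) : E')
      = mfderivWithin 𝓘(ℝ, E') I' (extChartAt I' c').symm (range I')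
          (extChartAt I' c' (f ((extChartAt I c).symm y)))
          (fderivWithin ℝ (extChartAt I' c' ∘ f ∘ (extChartAt I c).symm) (range I) y v) := by
  have hyr : y ∈ range I := extChartAt_target_subset_range c hy
  have hφ : MDifferentiableWithinAt 𝓘(ℝ, E) I (extChartAt I c).symm (range I) y :=
    mdifferentiableWithinAt_extChartAt_symm hy
  have hfφ := hf.hasMFDerivAt.comp_hasMFDerivWithinAt y hφ.hasMFDerivWithinAt
  have hψ := mdifferentiableWithinAt_extChartAt_symm ((extChartAt I' c').map_source hy')
  have hcoord : MDifferentiableWithinAt 𝓘(ℝ, E) 𝓘(ℝ, E')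
      (extChartAt I' c' ∘ f ∘ (extChartAt I c).symm) (range I) y :=
    (mdifferentiableAt_extChartAt (extChartAt_source I' c' ▸ hy')).comp_mdifferentiableWithinAt
      y (hf.comp_mdifferentiableWithinAt y hφ)
  have hψcoord := hψ.hasMFDerivWithinAt.comp y hcoord.hasMFDerivWithinAt
    fun _ _ => mem_range_self _
  have heq : f ∘ (extChartAt I c).symm =ᶠ[𝓝[range I] y]
      (extChartAt I' c').symm ∘ (extChartAt I' c' ∘ f ∘ (extChartAt I c).symm) := by
    filter_upwards [hfφ.continuousWithinAt ((isOpen_extChartAt_source c').mem_nhds hy')] with z hz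
    exact ((extChartAt I' c').left_inv hz).symm
  have hU : UniqueMDiffWithinAt 𝓘(ℝ, E) (range I) y :=
    (I.uniqueDiffOn y hyr).uniqueMDiffWithinAt
  rw [← mfderivWithin_eq_fderivWithin]
  exact DFunLike.congr_fun (F := E →L[ℝ] E') (hU.eq hfφ
    (hψcoord.congr_of_eventuallyEq heq (heq.self_of_nhdsWithin hyr))) v

theorem contDiffWithinAt_chart_prod {EG : Type*} [NormedAddCommGroup EG] [NormedSpace ℝ EG]
    {HG : Type*} [TopologicalSpace HG] {J : ModelWithCorners ℝ EG HG} [J.Boundaryless]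
    {G : Type*} [TopologicalSpace G] [ChartedSpace HG G] [IsManifold J ∞ G]
    {f : G × M → M'} (hf : ContMDiff (J.prod I) I' ∞ f) {g : G} {x : M} {c' : M'}
    (hx' : f (g, x) ∈ (extChartAt I' c').source) :
    ContDiffWithinAt ℝ ∞ (fun p : EG × E =>
        extChartAt I' c' (f ((extChartAt J g).symm p.1, (extChartAt I x).symm p.2)))
      (univ ×ˢ range I) (extChartAt J g g, extChartAt I x x) := by
  have hrange : range (J.prod I) = univ ×ˢ range I := by
    rw [modelWithCorners_prod_coe, range_prodMap, J.range_eq_univ]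
  have hcoord := contDiffWithinAt_chart hf (mem_extChartAt_source (I := J.prod I) (g, x)) hx'
  rw [hrange] at hcoord
  simp only [extChartAt_prod] at hcoord
  exact hcoord

end Charts

/-! ### The adjoint representation -/

section Adjoint

variable {EG : Type*} [NormedAddCommGroup EG] [NormedSpace ℝ EG]
  {HG : Type*} [TopologicalSpace HG] (J : ModelWithCorners ℝ EG HG)
  {G : Type*} [TopologicalSpace G] [ChartedSpace HG G] [Group G]

/-- The adjoint action `Ad g` as a continuous linear map of the model space, to which the calculus
of the normed space `EG` applies. -/
def AdL (g : G) : EG →L[ℝ] EG := mfderiv J J (fun h : G => g * h * g⁻¹) 1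

/-- Conjugation by `g` in the chart at `1`. -/
def conjInChart (g : G) : EG → EG :=
  extChartAt J (1 : G) ∘ (fun h => g * h * g⁻¹) ∘ (extChartAt J (1 : G)).symm

variable (G) in
/-- The multiplication of `G` in the chart at `1`. -/
def mulInChart (p : EG × EG) : EG :=
  extChartAt J (1 : G) ((extChartAt J (1 : G)).symm p.1 * (extChartAt J (1 : G)).symm p.2)

variable (G) in
/-- The left-invariant vector field with value `ξ` at `1`, in the chart at `1`. -/
def leftInvariantInChart (ξ : EG) : EG → EG := fun a =>
  fderiv ℝ (fun b => mulInChart J G (a, b)) (extChartAt J (1 : G) 1) ξ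

theorem conjInChart_self (g : G) :
    conjInChart J g (extChartAt J (1 : G) 1) = extChartAt J (1 : G) 1 := by
  simp [conjInChart]

theorem AdL_one : AdL J (1 : G) = ContinuousLinearMap.id ℝ EG := by
  have hconj : (fun h : G => 1 * h * 1⁻¹) = id := funext fun h => by simp
  rw [AdL, hconj]
  exact mfderiv_id

theorem fderiv_mulInChart_one_left [J.Boundaryless] :
    fderiv ℝ (fun c => mulInChart J G (c, extChartAt J (1 : G) 1)) (extChartAt J (1 : G) 1)
      = ContinuousLinearMap.id ℝ EG := by
  have heq : (fun c => mulInChart J G (c, extChartAt J (1 : G) 1)) =ᶠ[𝓝 (extChartAt J (1 : G) 1)]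
      id := by
    filter_upwards [extChartAt_target_mem_nhds (I := J) (1 : G)] with a ha
    rw [mulInChart, extChartAt_to_inv, mul_one, (extChartAt J (1 : G)).right_inv ha, id_eq]
  rw [heq.fderiv_eq, fderiv_id]

theorem evalPoly_actPoly (g : G) (F : Poly J G) (η : GroupLieAlgebra J G) :
    evalPoly η (actPoly J g F) = evalPoly (Ad J g⁻¹ η) F := by
  have hcomp : (evalPoly η).comp (actPoly J g) = evalPoly (Ad J g⁻¹ η) :=
    SymmetricAlgebra.algHom_ext (LinearMap.ext fun l => by simp [actPoly])
  exact DFunLike.congr_fun hcomp F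

variable [LieGroup J ∞ G]

theorem contMDiff_conj (g : G) : ContMDiff J J ∞ (fun h : G => g * h * g⁻¹) :=
  (contMDiff_mul_right (I := J) (n := ∞) (a := g⁻¹)).comp contMDiff_mul_left

theorem eventually_symm_conjInChart (g : G) : ∀ᶠ b in 𝓝 (extChartAt J (1 : G) 1),
    (extChartAt J (1 : G)).symm (conjInChart J g b) = g * (extChartAt J (1 : G)).symm b * g⁻¹ := by
  have hcont : ContinuousAt (fun b => g * (extChartAt J (1 : G)).symm b * g⁻¹)
      (extChartAt J (1 : G) 1) :=
    (contMDiff_conj J g).continuous.continuousAt.comp (continuousAt_extChartAt_symm (1 : G))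
  have hsource : (extChartAt J (1 : G)).source
      ∈ 𝓝 (g * (extChartAt J (1 : G)).symm (extChartAt J (1 : G) 1) * g⁻¹) :=
    (isOpen_extChartAt_source (1 : G)).mem_nhds (by simp)
  filter_upwards [hcont hsource] with b hb
  exact (extChartAt J (1 : G)).left_inv hb

variable [J.Boundaryless]

theorem hasFDerivAt_conjInChart (g : G) :
    HasFDerivAt (conjInChart J g) (AdL J g) (extChartAt J (1 : G) 1) := by
  have hdiff : DifferentiableAt ℝ (conjInChart J g) (extChartAt J (1 : G) 1) := by
    rw [← differentiableWithinAt_univ, ← J.range_eq_univ]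
    exact (contDiffWithinAt_chart (contMDiff_conj J g) (mem_extChartAt_source (1 : G))
      (by simp)).differentiableWithinAt (by simp)
  have hAd : AdL J g = fderivWithin ℝ (writtenInExtChartAt J J (1 : G) fun h : G => g * h * g⁻¹)
      (range J) (extChartAt J (1 : G) 1) :=
    ((contMDiff_conj J g).mdifferentiableAt (by simp)).mfderiv
  have hwritten : writtenInExtChartAt J J (1 : G) (fun h : G => g * h * g⁻¹) = conjInChart J g := by
    rw [writtenInExtChartAt, mul_one, mul_inv_cancel]
    rfl
  rw [hAd, hwritten, J.range_eq_univ, fderivWithin_univ]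
  exact hdiff.hasFDerivAt

theorem AdL_mul (g h : G) : AdL J (g * h) = AdL J g ∘L AdL J h := by
  have hg := hasFDerivAt_conjInChart J g
  rw [← conjInChart_self J h] at hg
  refine (hasFDerivAt_conjInChart J (g * h)).unique
    ((hg.comp _ (hasFDerivAt_conjInChart J h)).congr_of_eventuallyEq ?_)
  filter_upwards [eventually_symm_conjInChart J h] with b hb
  rw [Function.comp_apply, conjInChart, Function.comp_apply, Function.comp_apply, conjInChart,
    Function.comp_apply, Function.comp_apply, hb]
  group

theorem differentiableAt_AdL : DifferentiableAt ℝ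
    (fun a => AdL J ((extChartAt J (1 : G)).symm a)) (extChartAt J (1 : G) 1) := by
  have hconj : ContMDiff (J.prod J) J ∞ (fun p : G × G => p.1 * p.2 * p.1⁻¹) :=
    (contMDiff_fst.mul contMDiff_snd).mul contMDiff_fst.inv
  have hchart := contDiffWithinAt_chart_prod hconj (g := 1) (x := 1) (c' := 1) (by simp)
  rw [J.range_eq_univ] at hchart
  obtain ⟨K, hK, -⟩ := exists_mixed_partial hchart uniqueDiffOn_univ uniqueDiffOn_univ
    (mem_univ _) (mem_univ _) (by simp) (by simp)
  simp only [fderivWithin_univ, hasFDerivWithinAt_univ] at hK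
  have hAd : (fun a => AdL J ((extChartAt J (1 : G)).symm a)) = fun a =>
      fderiv ℝ (conjInChart J ((extChartAt J (1 : G)).symm a)) (extChartAt J (1 : G) 1) :=
    funext fun a => (hasFDerivAt_conjInChart J _).fderiv.symm
  rw [hAd]
  exact hK.differentiableAt

theorem differentiableAt_mulInChart_left {a : EG} (ha : a ∈ (extChartAt J (1 : G)).target) :
    DifferentiableAt ℝ (fun c => mulInChart J G (c, a)) (extChartAt J (1 : G) 1) := by
  rw [← differentiableWithinAt_univ, ← J.range_eq_univ]
  refine (contDiffWithinAt_chart (f := fun h => h * (extChartAt J (1 : G)).symm a)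
    contMDiff_mul_right (mem_extChartAt_source (1 : G)) ?_).differentiableWithinAt (by simp)
  rw [one_mul]
  exact (extChartAt J (1 : G)).map_target ha

/-- The identity `g h = (g h g⁻¹) g`, differentiated in `h` at `1`. -/
theorem fderiv_mulInChart_right {a : EG} (ha : a ∈ (extChartAt J (1 : G)).target) :
    fderiv ℝ (fun b => mulInChart J G (a, b)) (extChartAt J (1 : G) 1)
      = fderiv ℝ (fun c => mulInChart J G (c, a)) (extChartAt J (1 : G) 1)
          ∘L AdL J ((extChartAt J (1 : G)).symm a) := by
  have hleft := (differentiableAt_mulInChart_left J ha).hasFDerivAt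
  nth_rewrite 2 [← conjInChart_self J ((extChartAt J (1 : G)).symm a)] at hleft
  refine ((hleft.comp _ (hasFDerivAt_conjInChart J _)).congr_of_eventuallyEq ?_).fderiv
  filter_upwards [eventually_symm_conjInChart J ((extChartAt J (1 : G)).symm a)] with b hb
  rw [Function.comp_apply, mulInChart, mulInChart, hb, inv_mul_cancel_right]

theorem leftInvariantInChart_one (ξ : EG) :
    leftInvariantInChart J G ξ (extChartAt J (1 : G) 1) = ξ := by
  rw [leftInvariantInChart, fderiv_mulInChart_right J (mem_extChartAt_target (1 : G)),
    fderiv_mulInChart_one_left, extChartAt_to_inv, AdL_one]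
  rfl

theorem contDiffAt_mulInChart :
    ContDiffAt ℝ ∞ (mulInChart J G) (extChartAt J (1 : G) 1, extChartAt J (1 : G) 1) := by
  have hmul := contDiffWithinAt_chart_prod (contMDiff_mul J ∞ (G := G)) (g := 1) (x := 1)
    (c' := 1) (by simp)
  rwa [J.range_eq_univ, univ_prod_univ, contDiffWithinAt_univ] at hmul

theorem fderiv_AdL_apply_eq_lieBracket_inChart (ξ η : EG) :
    fderiv ℝ (fun a => AdL J ((extChartAt J (1 : G)).symm a)) (extChartAt J (1 : G) 1) ξ η
      = VectorField.lieBracket ℝ (leftInvariantInChart J G ξ) (leftInvariantInChart J G η)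
          (extChartAt J (1 : G) 1) := by
  have hmul := (contDiffAt_mulInChart J (G := G)).contDiffWithinAt (s := univ ×ˢ univ)
  obtain ⟨B, hright, hleft⟩ := exists_mixed_partial hmul uniqueDiffOn_univ uniqueDiffOn_univ
    (mem_univ _) (mem_univ _) (by simp) (by simp)
  simp only [fderivWithin_univ, hasFDerivWithinAt_univ] at hright hleft
  have hinvariant (ζ : EG) : HasFDerivAt (leftInvariantInChart J G ζ) (B.flip ζ)
      (extChartAt J (1 : G) 1) :=
    (hright.clm_apply (hasFDerivAt_const ζ _)).congr_fderiv (by simp)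
  have hconj : HasFDerivAt
      (fun a => fderiv ℝ (fun b => mulInChart J G (a, b)) (extChartAt J (1 : G) 1)) _
      (extChartAt J (1 : G) 1) :=
    (hleft.clm_comp (differentiableAt_AdL J (G := G)).hasFDerivAt).congr_of_eventuallyEq <| by
      filter_upwards [extChartAt_target_mem_nhds (I := J) (1 : G)] with a ha
      exact fderiv_mulInChart_right J ha
  have hbracket := DFunLike.congr_fun (DFunLike.congr_fun (hright.unique hconj) ξ) η
  simp only [add_apply, ContinuousLinearMap.comp_apply,
    ContinuousLinearMap.compL_apply, ContinuousLinearMap.flip_apply, fderiv_mulInChart_one_left,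
    extChartAt_to_inv, AdL_one, ContinuousLinearMap.id_apply] at hbracket
  rw [VectorField.lieBracket, (hinvariant _).fderiv, (hinvariant _).fderiv,
    leftInvariantInChart_one, leftInvariantInChart_one]
  exact eq_sub_of_add_eq hbracket.symm

theorem mpullbackWithin_mulInvariantVectorField_eventuallyEq (ξ : GroupLieAlgebra J G) :
    VectorField.mpullbackWithin 𝓘(ℝ, EG) J (extChartAt J (1 : G)).symm
      (mulInvariantVectorField ξ) (range J)
      =ᶠ[𝓝 (extChartAt J (1 : G) 1)] leftInvariantInChart J G ξ := by
  filter_upwards [extChartAt_target_mem_nhds (I := J) (1 : G)] with a ha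
  set φ := extChartAt J (1 : G)
  have hvalue : φ (φ.symm a * φ.symm (φ 1)) = a := by
    rw [extChartAt_to_inv, mul_one, φ.right_inv ha]
  have hchart := mfderiv_mfderivWithin_extChartAt_symm (c := (1 : G)) (c' := (1 : G))
    (mem_extChartAt_target (1 : G)) ((contMDiff_mul_left (I := J) (n := ∞)
      (a := φ.symm a)).mdifferentiableAt (by simp))
    (by rw [extChartAt_to_inv, mul_one]; exact φ.map_target ha) ξ
  rw [hvalue] at hchart
  have hinv := isInvertible_mfderivWithin_extChartAt_symm (I := J) ha
  have hsymm : (mfderivWithin 𝓘(ℝ, EG) J φ.symm (range J) (φ 1) ξ : EG) = ξ :=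
    congrArg (fun T : EG →L[ℝ] EG => T ξ) mfderivWithin_range_extChartAt_symm
  rw [extChartAt_to_inv] at hchart
  rw [J.range_eq_univ] at hchart hinv hsymm ⊢
  rw [fderivWithin_univ] at hchart
  exact hinv.inverse_apply_eq.mpr <| (congrArg (mfderiv J J (fun h => φ.symm a * h) 1 :
    EG →L[ℝ] EG) hsymm).symm.trans hchart

theorem lie_eq_lieBracket_leftInvariantInChart (ξ η : GroupLieAlgebra J G) :
    ⁅ξ, η⁆ = VectorField.lieBracket ℝ (leftInvariantInChart J G ξ) (leftInvariantInChart J G η)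
      (extChartAt J (1 : G) 1) := by
  have hinverse : (mfderiv J 𝓘(ℝ, EG) (extChartAt J (1 : G)) 1 : EG →L[ℝ] EG).inverse
      = ContinuousLinearMap.id ℝ EG :=
    (congrArg (ContinuousLinearMap.inverse (R := ℝ) (M := EG) (M₂ := EG))
      (mfderiv_extChartAt_self (I := J) (x := (1 : G)))).trans
      ContinuousLinearMap.inverse_id
  rw [← Filter.EventuallyEq.lieBracket_vectorField_eq (𝕜 := ℝ)
    (mpullbackWithin_mulInvariantVectorField_eventuallyEq J ξ)
    (mpullbackWithin_mulInvariantVectorField_eventuallyEq J η), GroupLieAlgebra.bracket_def,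
    VectorField.mlieBracket, VectorField.mlieBracketWithin, preimage_univ, univ_inter,
    J.range_eq_univ]
  exact (congrArg (fun T : EG →L[ℝ] EG => T _) hinverse).trans
    (congrFun (VectorField.lieBracketWithin_univ (𝕜 := ℝ) (E := EG)) _)

theorem fderiv_AdL_apply (ξ η : GroupLieAlgebra J G) :
    fderiv ℝ (fun a => AdL J ((extChartAt J (1 : G)).symm a)) (extChartAt J (1 : G) 1) ξ η
      = ⁅ξ, η⁆ :=
  (fderiv_AdL_apply_eq_lieBracket_inChart J ξ η).trans
    (lie_eq_lieBracket_leftInvariantInChart J ξ η).symm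

theorem Ad_lie (g : G) (ξ η : GroupLieAlgebra J G) :
    Ad J g ⁅ξ, η⁆ = ⁅Ad J g ξ, Ad J g η⁆ := by
  set e := extChartAt J (1 : G) 1
  set K := fderiv ℝ (fun a => AdL J ((extChartAt J (1 : G)).symm a)) e
  have hAd : HasFDerivAt (fun a => AdL J ((extChartAt J (1 : G)).symm a)) K e :=
    (differentiableAt_AdL J).hasFDerivAt
  have hAd' : HasFDerivAt (fun a => AdL J ((extChartAt J (1 : G)).symm a)) K
      (conjInChart J g e) := by
    rwa [conjInChart_self]
  have hK (ξ η : EG) : AdL J g (K ξ η) = K (AdL J g ξ) (AdL J g η) := by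
    have hleft := (AdL J g).hasFDerivAt.comp e (hAd.clm_apply (hasFDerivAt_const η e))
    have hright := (hAd'.comp e (hasFDerivAt_conjInChart J g)).clm_apply
      (hasFDerivAt_const (AdL J g η) e)
    have hevent : (fun a => AdL J g (AdL J ((extChartAt J (1 : G)).symm a) η)) =ᶠ[𝓝 e]
        fun a => AdL J ((extChartAt J (1 : G)).symm (conjInChart J g a)) (AdL J g η) := by
      filter_upwards [eventually_symm_conjInChart J g] with b hb
      rw [hb, ← ContinuousLinearMap.comp_apply, ← ContinuousLinearMap.comp_apply, ← AdL_mul,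
        ← AdL_mul, inv_mul_cancel_right]
    simpa using DFunLike.congr_fun (hleft.unique (hright.congr_of_eventuallyEq hevent)) ξ
  rw [← fderiv_AdL_apply, ← fderiv_AdL_apply]
  exact hK ξ η

theorem exists_hasFDerivAt_apply_Ad [FiniteDimensional ℝ EG] (l : Dual ℝ (GroupLieAlgebra J G))
    (η : GroupLieAlgebra J G) : ∃ T : EG →L[ℝ] ℝ,
      HasFDerivAt (fun a => l (Ad J ((extChartAt J (1 : G)).symm a) η)) T (extChartAt J (1 : G) 1) ∧
      ∀ ξ : GroupLieAlgebra J G, T ξ = l ⁅ξ, η⁆ := by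
  let l' : EG →ₗ[ℝ] ℝ := l
  have hη := ((differentiableAt_AdL J (G := G)).hasFDerivAt.clm_apply
    (hasFDerivAt_const (F := EG) η (extChartAt J (1 : G) 1))).congr_fderiv
      (by rw [ContinuousLinearMap.comp_zero, zero_add])
  exact ⟨_, (LinearMap.toContinuousLinearMap l').hasFDerivAt.comp _ hη,
    fun ξ => congrArg l (fderiv_AdL_apply J ξ η)⟩

theorem exists_curve_Ad [FiniteDimensional ℝ EG] (ξ : GroupLieAlgebra J G) :
    ∃ γ : ℝ → G, γ 0 = 1 ∧ ∀ (l : Dual ℝ (GroupLieAlgebra J G)) (η : GroupLieAlgebra J G),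
      HasDerivAt (fun t => l (Ad J (γ t) η)) (l ⁅ξ, η⁆) 0 := by
  let ξ' : EG := ξ
  have hline : HasDerivAt (fun t : ℝ => extChartAt J (1 : G) 1 + t • ξ') ξ' 0 := by
    simpa using ((hasDerivAt_id (0 : ℝ)).smul_const ξ').const_add (extChartAt J (1 : G) 1)
  refine ⟨fun t => (extChartAt J (1 : G)).symm (extChartAt J (1 : G) 1 + t • ξ'), by simp,
    fun l η => ?_⟩
  obtain ⟨T, hT, hTξ⟩ := exists_hasFDerivAt_apply_Ad J l η
  exact (hT.comp_hasDerivAt_of_eq 0 hline (by simp)).congr_deriv (hTξ ξ)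

omit [J.Boundaryless] in
instance lieGroup_minSmoothness : LieGroup J (minSmoothness ℝ 3) G :=
  LieGroup.of_le (n := ∞) (by simp; norm_cast)

/-- Differentiate the constant function `t ↦ F(Ad(γ t) η)` along a curve with velocity `ξ`. -/
theorem symDerivation_coad_eq_zero_of_mem_invPoly [FiniteDimensional ℝ EG] {F : Poly J G}
    (hF : F ∈ invPoly J G) (ξ : GroupLieAlgebra J G) :
    symDerivation (SymmetricAlgebra.ι ℝ _ ∘ₗ coad ξ) F = 0 := by
  have : Module.Finite ℝ (GroupLieAlgebra J G) := inferInstanceAs (Module.Finite ℝ EG)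
  refine eq_zero_of_evalPoly_eq_zero fun η => ?_
  obtain ⟨γ, hγ, hAd⟩ := exists_curve_Ad J ξ
  have hone : Ad J (γ 0) η = η := by rw [hγ]; exact DFunLike.congr_fun (AdL_one J) (η : EG)
  have hconst (t : ℝ) : evalPoly (Ad J (γ t) η) F = evalPoly η F := by
    rw [← inv_inv (γ t), ← evalPoly_actPoly, hF]
  have hderiv := hasDerivAt_evalPoly (symDerivation (SymmetricAlgebra.ι ℝ _ ∘ₗ coad ξ))
    (c := fun t => Ad J (γ t) η) (t := 0) (fun l => by simpa [hone, coad_apply] using hAd l η) F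
  simp only [hconst, hone] at hderiv
  exact hderiv.unique (hasDerivAt_const _ _)

end Adjoint

/-! ### The degenerate connection -/

section CoordinateForms

variable {E : Type*} [NormedAddCommGroup E] [NormedSpace ℝ E] [FiniteDimensional ℝ E]
  {s : Set E} {y : E}

theorem alternate_linearMap_comp (l : Dual ℝ E) :
    alternate (Algebra.linearMap ℝ (Form E) ∘ₗ l) = oneForm l := by
  have hterm (i) : oneForm ((finBasis ℝ E).coord i)
      * (Algebra.linearMap ℝ (Form E) ∘ₗ l) (finBasis ℝ E i)
      = oneForm (l (finBasis ℝ E i) • (finBasis ℝ E).coord i) := by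
    rw [LinearMap.comp_apply, Algebra.linearMap_apply, ← Algebra.commutes, ← Algebra.smul_def,
      map_smul]
  simp_rw [alternate, hterm, ← map_sum, Basis.sum_dual_apply_smul_coord]

theorem contr_alternate_oneForm_comp (A : E →ₗ[ℝ] Dual ℝ E) (X : E) :
    contr X (alternate (oneForm ∘ₗ A)) = oneForm (A X - A.flip X) := by
  have hterm (i) : contr X (oneForm ((finBasis ℝ E).coord i) * (oneForm ∘ₗ A) (finBasis ℝ E i))
      = oneForm ((finBasis ℝ E).repr X i • A (finBasis ℝ E i)
        - A.flip X (finBasis ℝ E i) • (finBasis ℝ E).coord i) := by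
    rw [contr_oneForm_mul, LinearMap.comp_apply, contr_oneForm, ← Algebra.commutes,
      ← Algebra.smul_def, map_sub, map_smul, map_smul, Basis.coord_apply, LinearMap.flip_apply]
  simp_rw [alternate, map_sum, hterm, ← map_sum, Finset.sum_sub_distrib,
    Basis.sum_dual_apply_smul_coord, ← map_smul, ← map_sum, Basis.sum_repr]

theorem differentiableWithinAt_of_oneForm {α : E → E →L[ℝ] ℝ}
    (hα : DifferentiableWithinAt ℝ (fun z => oneForm (α z : E →ₗ[ℝ] ℝ)) s y) :
    DifferentiableWithinAt ℝ α s y := by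
  let degreeOne : Form E →ₗ[ℝ] E →L[ℝ] ℝ :=
    (LinearMap.toContinuousLinearMap (𝕜 := ℝ) (E := E) (F' := ℝ)).toLinearMap ∘ₗ
      ExteriorAlgebra.ιInv
  have hdegreeOne (z) : degreeOne (oneForm (α z : E →ₗ[ℝ] ℝ)) = α z :=
    ContinuousLinearMap.ext <| LinearMap.congr_fun
      (ExteriorAlgebra.ι_leftInverse (α z : Dual ℝ E) : _ = _)
  have hcomp := (LinearMap.toContinuousLinearMap degreeOne).differentiableAt (x := oneForm (α y))
    |>.comp_differentiableWithinAt y hα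
  exact hcomp.congr (fun z _ => (hdegreeOne z).symm) (hdegreeOne y).symm

theorem contr_extd_oneForm {α : E → E →L[ℝ] ℝ} (hα : DifferentiableWithinAt ℝ α s y)
    (hs : UniqueDiffWithinAt ℝ s y) (X : E) :
    contr X (extd s (fun z => oneForm (α z : E →ₗ[ℝ] ℝ)) y)
      = oneForm ↑(fderivWithin ℝ α s y X - (fderivWithin ℝ α s y).flip X) := by
  have hfderiv : (fderivWithin ℝ (fun z => oneForm (α z : E →ₗ[ℝ] ℝ)) s y).toLinearMap
      = oneForm ∘ₗ ContinuousLinearMap.coeLM ℝ ∘ₗ (fderivWithin ℝ α s y).toLinearMap :=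
    fderivWithin_linear (oneForm ∘ₗ ContinuousLinearMap.coeLM ℝ) hα hs
  rw [extd, hfderiv, contr_alternate_oneForm_comp]
  rfl

theorem extd_algebraMap {h : E → ℝ} (hh : DifferentiableWithinAt ℝ h s y)
    (hs : UniqueDiffWithinAt ℝ s y) :
    extd s (fun z => algebraMap ℝ (Form E) (h z)) y = oneForm ↑(fderivWithin ℝ h s y) :=
  (congrArg alternate (fderivWithin_linear (Algebra.linearMap ℝ (Form E)) hh hs)).trans
    (alternate_linearMap_comp _)

end CoordinateForms

section ActionInCharts

variable {E : Type*} [NormedAddCommGroup E] [NormedSpace ℝ E]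
  {H : Type*} [TopologicalSpace H]
  {EG : Type*} [NormedAddCommGroup EG] [NormedSpace ℝ EG]
  {HG : Type*} [TopologicalSpace HG]
  (J : ModelWithCorners ℝ EG HG) (I : ModelWithCorners ℝ E H)
  {G : Type*} [TopologicalSpace G] [ChartedSpace HG G] [Group G]
  {M : Type*} [TopologicalSpace M] [ChartedSpace H M] [MulAction G M]

variable (G) in
/-- The action map in the chart of `G` at `1` and the chart of `M` at `c`. -/
def smulInChart (c : M) (p : EG × E) : E :=
  extChartAt I c ((extChartAt J (1 : G)).symm p.1 • (extChartAt I c).symm p.2)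

theorem smulInChart_one {c : M} {y : E} (hy : y ∈ (extChartAt I c).target) :
    smulInChart J I G c (extChartAt J (1 : G) 1, y) = y := by
  rw [smulInChart, extChartAt_to_inv, one_smul, (extChartAt I c).right_inv hy]

variable [ContMDiffSMul J I ∞ G M]

theorem smul_contMDiff_left (x : M) : ContMDiff J I ∞ (fun g : G => g • x) :=
  (ContMDiffSMul.contMDiff_smul (I := J) (I' := I) (n := ∞) (G := G) (M := M)).comp
    (contMDiff_id.prodMk contMDiff_const)

theorem eventually_smul_mem_source (x : M) : ∀ᶠ a in 𝓝 (extChartAt J (1 : G) 1),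
    (extChartAt J (1 : G)).symm a • (extChartAt I x).symm (extChartAt I x x)
      ∈ (extChartAt I x).source := by
  have hcont : ContinuousAt (fun a => (extChartAt J (1 : G)).symm a • x)
      (extChartAt J (1 : G) 1) :=
    (smul_contMDiff_left J I x).continuous.continuousAt.comp (continuousAt_extChartAt_symm (1 : G))
  rw [extChartAt_to_inv (I := I)]
  refine hcont.eventually_mem ((isOpen_extChartAt_source (I := I) x).mem_nhds ?_)
  simp

variable [J.Boundaryless] [LieGroup J ∞ G] [IsManifold I ∞ M]

theorem contDiffWithinAt_smulInChart (x : M) :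
    ContDiffWithinAt ℝ ∞ (smulInChart J I G x) (univ ×ˢ range I)
      (extChartAt J (1 : G) 1, extChartAt I x x) :=
  have : IsManifold J ∞ G := LieGroup.toContMDiffMul.toIsManifold
  contDiffWithinAt_chart_prod (ContMDiffSMul.contMDiff_smul (I := J) (I' := I) (n := ∞)
    (G := G) (M := M)) (g := 1) (by simp)

/-- The velocity at `t = 0` of the curve `exp (t ξ) • x` in the chart at `c`, where `y` is the
coordinate of `x`. -/
def orbitVelocity (ξ : GroupLieAlgebra J G) (c : M) (y : E) : E :=
  fderiv ℝ (fun a => smulInChart J I G c (a, y)) (extChartAt J (1 : G) 1) ξ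

theorem chartInvD_orbitVelocity (ξ : GroupLieAlgebra J G) (c : M) {y : E}
    (hy : y ∈ (extChartAt I c).target) :
    chartInvD I c y (orbitVelocity J I ξ c y) = -fundVF J I ξ ((extChartAt I c).symm y) := by
  set φ := extChartAt J (1 : G)
  set z := (extChartAt I c).symm y
  have hsource : (1 : G) • z ∈ (extChartAt I c).source := by
    rw [one_smul]
    exact (extChartAt I c).map_target hy
  have hchart := mfderiv_mfderivWithin_extChartAt_symm (c := (1 : G)) (c' := c)
    (mem_extChartAt_target (I := J) (1 : G))
    ((smul_contMDiff_left J I z).mdifferentiableAt (by simp)) (by rwa [extChartAt_to_inv]) ξ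
  have hsymm : (mfderivWithin 𝓘(ℝ, EG) J φ.symm (range J) (φ 1) ξ : EG) = ξ :=
    congrArg (fun T : EG →L[ℝ] EG => T ξ) mfderivWithin_range_extChartAt_symm
  rw [extChartAt_to_inv, one_smul, (extChartAt I c).right_inv hy] at hchart
  rw [J.range_eq_univ] at hchart hsymm
  rw [fderivWithin_univ] at hchart
  exact hchart.symm.trans <| (congrArg (mfderiv J I (fun g : G => g • z) 1 : EG →L[ℝ] E)
    hsymm).trans (neg_neg _).symm

theorem chartD_fundVF [FiniteDimensional ℝ E] (ξ : GroupLieAlgebra J G) (x : M) :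
    chartD I x (fundVF J I ξ x) = -orbitVelocity J I ξ x (extChartAt I x x) := by
  have hvelocity := chartInvD_orbitVelocity J I ξ x (mem_extChartAt_target (I := I) x)
  have hid (Z : E) : (chartInvD I x (extChartAt I x x) Z : E) = Z :=
    congrArg (fun T : E →L[ℝ] E => T Z) mfderivWithin_range_extChartAt_symm
  have hbase : (fundVF J I ξ ((extChartAt I x).symm (extChartAt I x x)) : E) = fundVF J I ξ x :=
    congrArg (fun p => (fundVF J I ξ p : E)) (extChartAt_to_inv x)
  exact (chartD_eq I x _).trans <| neg_eq_iff_eq_neg.mp <| Eq.symm <|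
    ((hid _).symm.trans hvelocity).trans (congrArg (fun v : E => -v) hbase)

end ActionInCharts

section DegenerateConnection

variable {E : Type*} [NormedAddCommGroup E] [NormedSpace ℝ E]
  {H : Type*} [TopologicalSpace H]
  {EG : Type*} [NormedAddCommGroup EG] [NormedSpace ℝ EG]
  {HG : Type*} [TopologicalSpace HG]
  (J : ModelWithCorners ℝ EG HG) (I : ModelWithCorners ℝ E H)
  {G : Type*} [TopologicalSpace G] [ChartedSpace HG G] [Group G]
  {M : Type*} [TopologicalSpace M] [ChartedSpace H M]
  {f : M → ℝ} {θ : (x : M) → TangentSpace I x →ₗ[ℝ] GroupLieAlgebra J G}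

theorem differentiableWithinAt_comp_extChartAt_symm [IsManifold I ∞ M]
    (hf : ContMDiff I 𝓘(ℝ, ℝ) ∞ f) (x : M) :
    DifferentiableWithinAt ℝ (fun y => f ((extChartAt I x).symm y)) (range I)
      (extChartAt I x x) := by
  have hchart := contDiffWithinAt_chart hf (mem_extChartAt_source (I := I) x)
    (mem_extChartAt_source (I := 𝓘(ℝ, ℝ)) (f x))
  rw [extChartAt_model_space_eq_id] at hchart
  exact hchart.differentiableWithinAt (by simp)

theorem eq_zero_of_mem_singularSet [MulAction G M] (hf : IsCutoff I G f) {x : M}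
    (hx : x ∈ singularSet G M) : f x = 0 := by
  obtain ⟨U, V, -, -, hU, -, hzero, -⟩ := hf.nhds
  exact hzero x (hU hx)

variable [FiniteDimensional ℝ E]

variable (f θ) in
/-- The coordinate expression, in the chart at `c`, of the one-form `⟨l, f θ⟩`. -/
def degConnInChart (l : Dual ℝ (GroupLieAlgebra J G)) (c : M) (y : E) : E →L[ℝ] ℝ :=
  LinearMap.toContinuousLinearMap
    (f ((extChartAt I c).symm y) • (l ∘ₗ θ ((extChartAt I c).symm y) ∘ₗ chartInvD I c y))

theorem degConnInChart_apply (l : Dual ℝ (GroupLieAlgebra J G)) (c : M) (y v : E) :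
    degConnInChart J I f θ l c y v
      = f ((extChartAt I c).symm y) * l (θ ((extChartAt I c).symm y) (chartInvD I c y v)) := rfl

variable [MulAction G M]

theorem mul_connection_fundVF (hf : IsCutoff I G f) (hθ : IsConnection J I θ)
    (ξ : GroupLieAlgebra J G) (l : Dual ℝ (GroupLieAlgebra J G)) (x : M) :
    f x * l (θ x (fundVF J I ξ x)) = f x * l ξ := by
  by_cases hx : x ∈ singularSet G M
  · rw [eq_zero_of_mem_singularSet I hf hx, zero_mul, zero_mul]
  · rw [hθ.reproduces ξ x hx]

variable [IsManifold I ∞ M]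

theorem chartRep_degConn (hf : IsCutoff I G f) (hθ : IsConnection J I θ)
    (l : Dual ℝ (GroupLieAlgebra J G)) (c : M) :
    chartRep I (degConn J I hf hθ l).1 c
      = fun y => oneForm (degConnInChart J I f θ l c y : E →ₗ[ℝ] ℝ) :=
  funext fun _ => pull_oneForm _ _

theorem differentiableWithinAt_degConnInChart (hf : IsCutoff I G f) (hθ : IsConnection J I θ)
    (l : Dual ℝ (GroupLieAlgebra J G)) (x : M) :
    DifferentiableWithinAt ℝ (degConnInChart J I f θ l x) (range I) (extChartAt I x x) :=
  differentiableWithinAt_of_oneForm <| chartRep_degConn J I hf hθ l x ▸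
    smoothFormAt_differentiable I ((degConn J I hf hθ l).2 x)

theorem roughPullback_degConn (hf : IsCutoff I G f) (hθ : IsConnection J I θ) (g : G)
    (l : Dual ℝ (GroupLieAlgebra J G)) :
    roughPullback I (fun x : M => g • x) (degConn J I hf hθ l).1
      = (degConn J I hf hθ (l ∘ₗ Ad J g)).1 := by
  funext x
  refine (pull_oneForm _ _).trans <| congrArg oneForm <| LinearMap.ext fun v => ?_
  change f (g • x) * l (θ (g • x) (mfderiv I I (fun y : M => g • y) x v)) = f x * l (Ad J g (θ x v))
  by_cases hx : x ∈ singularSet G M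
  · rw [hf.invariant, eq_zero_of_mem_singularSet I hf hx, zero_mul, zero_mul]
  · rw [hf.invariant, hθ.equivariant g x hx]

variable [ContMDiffSMul J I ∞ G M]

theorem actForm_degConn (hf : IsCutoff I G f) (hθ : IsConnection J I θ) (g : G)
    (l : Dual ℝ (GroupLieAlgebra J G)) :
    actForm J I g (degConn J I hf hθ l) = degConn J I hf hθ (l ∘ₗ Ad J g⁻¹) :=
  Subtype.ext (roughPullback_degConn J I hf hθ g⁻¹ l)

theorem eventually_degConnInChart_smulInChart (hf : IsCutoff I G f) (hθ : IsConnection J I θ)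
    (l : Dual ℝ (GroupLieAlgebra J G)) (x : M) (v : E) : ∀ᶠ a in 𝓝 (extChartAt J (1 : G) 1),
    degConnInChart J I f θ l x (smulInChart J I G x (a, extChartAt I x x))
        (fderivWithin ℝ (fun y => smulInChart J I G x (a, y)) (range I) (extChartAt I x x) v)
      = degConnInChart J I f θ (l ∘ₗ Ad J ((extChartAt J (1 : G)).symm a)) x (extChartAt I x x)
          v := by
  filter_upwards [eventually_smul_mem_source J I (G := G) x] with a ha
  have hpull := chartRep_pullback_apply I (smul_contMDiff J I ((extChartAt J (1 : G)).symm a))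
    (degConn J I hf hθ l).1 x x (mem_extChartAt_target x) ha
  rw [roughPullback_degConn, chartRep_degConn, chartRep_degConn, pull_oneForm] at hpull
  exact (LinearMap.congr_fun (ExteriorAlgebra.ι_leftInverse.injective hpull) v).symm

variable [LieGroup J ∞ G] [J.Boundaryless]

theorem degConnInChart_orbitVelocity (hf : IsCutoff I G f) (hθ : IsConnection J I θ)
    (ξ : GroupLieAlgebra J G) (l : Dual ℝ (GroupLieAlgebra J G)) (x : M) {y : E}
    (hy : y ∈ (extChartAt I x).target) :
    degConnInChart J I f θ l x y (orbitVelocity J I ξ x y)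
      = -l ξ * f ((extChartAt I x).symm y) := by
  rw [degConnInChart_apply, chartInvD_orbitVelocity J I ξ x hy, map_neg, map_neg, mul_neg,
    mul_connection_fundVF J I hf hθ, neg_mul, mul_comm]

theorem fderivWithin_degConnInChart [FiniteDimensional ℝ EG] (hf : IsCutoff I G f)
    (hθ : IsConnection J I θ) (ξ : GroupLieAlgebra J G) (l : Dual ℝ (GroupLieAlgebra J G)) (x : M)
    (v : E) :
    fderivWithin ℝ (degConnInChart J I f θ l x) (range I) (extChartAt I x x)
        (orbitVelocity J I ξ x (extChartAt I x x)) v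
      - fderivWithin ℝ (degConnInChart J I f θ l x) (range I) (extChartAt I x x) v
        (orbitVelocity J I ξ x (extChartAt I x x))
      = degConnInChart J I f θ (coad ξ l) x (extChartAt I x x) v
        + l ξ * fderivWithin ℝ (fun y => f ((extChartAt I x).symm y)) (range I)
          (extChartAt I x x) v := by
  have hrange : extChartAt I x x ∈ range I := mem_range_self _
  have htarget : ∀ᶠ y in 𝓝[range I] extChartAt I x x, y ∈ (extChartAt I x).target :=
    extChartAt_target_mem_nhdsWithin x
  obtain ⟨T, hT, hTξ⟩ := exists_hasFDerivAt_apply_Ad J l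
    (θ ((extChartAt I x).symm (extChartAt I x x)) (chartInvD I x (extChartAt I x x) v))
  have hcartan := fderivWithin_oneForm_of_pullback (contDiffWithinAt_smulInChart J I (G := G) x)
    I.uniqueDiffOn hrange (I.range_subset_closure_interior hrange)
    (htarget.mono fun y hy => smulInChart_one J I hy) (.of_forall fun a => mem_range_self _)
    (differentiableWithinAt_degConnInChart J I hf hθ l x) ξ v
    (hT.const_mul (f ((extChartAt I x).symm (extChartAt I x x))))
    (eventually_degConnInChart_smulInChart J I hf hθ l x v)
    ((differentiableWithinAt_comp_extChartAt_symm I hf.smooth x).hasFDerivWithinAt.const_mul (-l ξ))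
    (htarget.mono fun y hy => degConnInChart_orbitVelocity J I hf hθ ξ l x hy)
  refine hcartan.trans ?_
  change f _ * T ξ - -l ξ * _ = f _ * l ⁅ξ, _⁆ + _
  rw [hTξ, neg_mul, sub_neg_eq_add]
  rfl

theorem contrForm_dForm_degConn [FiniteDimensional ℝ EG] (hf : IsCutoff I G f)
    (hθ : IsConnection J I θ) (ξ : GroupLieAlgebra J G) (l : Dual ℝ (GroupLieAlgebra J G)) :
    contrForm J I ξ (dForm I (degConn J I hf hθ l))
      = -degConn J I hf hθ (coad ξ l) - l ξ • dForm I (funForm I f hf.smooth) := by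
  refine Subtype.ext <| funext fun x => ?_
  have hfun : chartRep I (funForm I f hf.smooth).1 x
      = fun y => algebraMap ℝ (Form E) (f ((extChartAt I x).symm y)) :=
    funext fun _ => AlgHom.commutes _ _
  have hchart : contr (chartD I x (fundVF J I ξ x))
        (extd (range I) (chartRep I (degConn J I hf hθ l).1 x) (extChartAt I x x))
      = -chartRep I (degConn J I hf hθ (coad ξ l)).1 x (extChartAt I x x)
        - l ξ • extd (range I) (chartRep I (funForm I f hf.smooth).1 x) (extChartAt I x x) := by
    rw [hfun, extd_algebraMap (differentiableWithinAt_comp_extChartAt_symm I hf.smooth x)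
      (uniqueDiff_chart I x), chartRep_degConn, contr_extd_oneForm
      (differentiableWithinAt_degConnInChart J I hf hθ l x) (uniqueDiff_chart I x),
      chartRep_degConn, ← map_neg, ← map_smul, ← map_sub]
    refine congrArg oneForm <| LinearMap.ext fun v => ?_
    have hcartan := fderivWithin_degConnInChart J I hf hθ ξ l x v
    rw [chartD_fundVF]
    simp only [map_neg, ContinuousLinearMap.toLinearMap_sub, ContinuousLinearMap.toLinearMap_neg,
      LinearMap.sub_apply, LinearMap.neg_apply, LinearMap.smul_apply, ContinuousLinearMap.coe_coe,
      ContinuousLinearMap.flip_apply, smul_eq_mul]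
    linear_combination -hcartan
  change contr (fundVF J I ξ x) (pull (chartD I x)
      (extd (range I) (chartRep I (degConn J I hf hθ l).1 x) (extChartAt I x x))) = _
  rw [← pull_contr, hchart, map_sub, map_neg, pull_chartRep_self, map_smul]
  rfl

end DegenerateConnection

/-! ### The degenerate Chern–Weil homomorphism -/

section ChernWeilHomomorphism

variable {E : Type*} [NormedAddCommGroup E] [NormedSpace ℝ E] [FiniteDimensional ℝ E]
  {H : Type*} [TopologicalSpace H]
  {EG : Type*} [NormedAddCommGroup EG] [NormedSpace ℝ EG]
  {HG : Type*} [TopologicalSpace HG]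
  (J : ModelWithCorners ℝ EG HG) (I : ModelWithCorners ℝ E H)
  {G : Type*} [TopologicalSpace G] [ChartedSpace HG G] [Group G]
  {M : Type*} [TopologicalSpace M] [ChartedSpace H M] [IsManifold I ∞ M]
  {f : M → ℝ} {θ : (x : M) → TangentSpace I x →ₗ[ℝ] GroupLieAlgebra J G}

theorem commute_funForm (hf : ContMDiff I 𝓘(ℝ, ℝ) ∞ f) (u : DiffForm I M) :
    Commute (funForm I f hf) u :=
  Subtype.ext <| funext fun x => Algebra.commutes (A := Form (TangentSpace I x)) (f x) (u.1 x)

theorem parityForm_funForm (hf : ContMDiff I 𝓘(ℝ, ℝ) ∞ f) :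
    parityForm I (funForm I f hf) = funForm I f hf :=
  Subtype.ext <| funext fun _ => AlgHom.commutes _ _

variable [MulAction G M]

/-- The degenerate connection `f θ`, as the linear map `l ↦ ⟨l, f θ⟩`. -/
def degConnₗ (hf : IsCutoff I G f) (hθ : IsConnection J I θ) :
    Dual ℝ (GroupLieAlgebra J G) →ₗ[ℝ] DiffForm I M where
  toFun := degConn J I hf hθ
  map_add' l l' := Subtype.ext <| funext fun x => by
    change oneForm (f x • ((l + l') ∘ₗ θ x)) = oneForm (f x • (l ∘ₗ θ x))
      + oneForm (f x • (l' ∘ₗ θ x))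
    rw [LinearMap.add_comp, smul_add, map_add]
  map_smul' r l := Subtype.ext <| funext fun x => by
    change oneForm (f x • ((r • l) ∘ₗ θ x)) = r • oneForm (f x • (l ∘ₗ θ x))
    rw [LinearMap.smul_comp, smul_comm, map_smul]

theorem parityForm_degConn (hf : IsCutoff I G f) (hθ : IsConnection J I θ)
    (l : Dual ℝ (GroupLieAlgebra J G)) :
    parityForm I (degConn J I hf hθ l) = -degConn J I hf hθ l :=
  Subtype.ext <| funext fun _ => parity_oneForm _

theorem degConn_mul_swap (hf : IsCutoff I G f) (hθ : IsConnection J I θ)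
    (l m : Dual ℝ (GroupLieAlgebra J G)) :
    degConn J I hf hθ l * degConn J I hf hθ m = -(degConn J I hf hθ m * degConn J I hf hθ l) :=
  Subtype.ext <| funext fun _ => oneForm_mul_swap _ _

theorem commute_dForm_degConn (hf : IsCutoff I G f) (hθ : IsConnection J I θ)
    (l : Dual ℝ (GroupLieAlgebra J G)) (u : DiffForm I M) :
    Commute (dForm I (degConn J I hf hθ l)) u :=
  dForm_oneForm_mem_center I (fun x => f x • (l ∘ₗ θ x)) (smoothFormAt_degConn J I hf hθ l) u

theorem actForm_funForm [ContMDiffSMul J I ∞ G M] (hf : IsCutoff I G f) (g : G) :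
    actForm J I g (funForm I f hf.smooth) = funForm I f hf.smooth := by
  refine Subtype.ext <| funext fun x => ?_
  change pull _ (algebraMap ℝ (Form (TangentSpace I (g⁻¹ • x))) (f (g⁻¹ • x)))
    = algebraMap ℝ (Form (TangentSpace I x)) (f x)
  rw [AlgHom.commutes, hf.invariant]

variable [LieGroup J ∞ G]

theorem contrForm_funForm [ContMDiffSMul J I ∞ G M] (hf : ContMDiff I 𝓘(ℝ, ℝ) ∞ f)
    (ξ : GroupLieAlgebra J G) :
    contrForm J I ξ (funForm I f hf) = 0 :=
  Subtype.ext <| funext fun _ => contr_algebraMap _ _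

theorem contrForm_degConn [ContMDiffSMul J I ∞ G M] (hf : IsCutoff I G f) (hθ : IsConnection J I θ)
    (ξ : GroupLieAlgebra J G) (l : Dual ℝ (GroupLieAlgebra J G)) :
    contrForm J I ξ (degConn J I hf hθ l) = l ξ • funForm I f hf.smooth := by
  refine Subtype.ext <| funext fun x => ?_
  change contr (fundVF J I ξ x) (oneForm (f x • (l ∘ₗ θ x)))
    = l ξ • algebraMap ℝ (Form (TangentSpace I x)) (f x)
  rw [contr_oneForm, Algebra.smul_def, ← map_mul, mul_comm (l ξ)]
  exact congrArg _ (mul_connection_fundVF J I hf hθ ξ l x)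

variable {κ : Type*} [Fintype κ] (b : Basis κ ℝ (GroupLieAlgebra J G))

theorem chernWeil_commute (hf : IsCutoff I G f) (hθ : IsConnection J I θ) (F : Poly J G)
    (α : CartanAlg J I G M) : Commute (chernWeil J I b hf hθ F) α :=
  (Subalgebra.mem_center_iff.mp (Subtype.property _) α).symm

variable [FiniteDimensional ℝ EG]

theorem degCurvature_eq_equivCurvature (hf : IsCutoff I G f) (hθ : IsConnection J I θ) (a : κ) :
    degCurvature J I b hf hθ a
      = equivCurvature b (dForm I) (degConnₗ J I hf hθ) (funForm I f hf.smooth)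
          (SymmetricAlgebra.ι ℝ _) (b.coord a) := by
  rw [equivCurvature_apply, curvature_apply, formBracket_eq_sum]
  rfl

theorem chernWeil_ι_eq_equivCurvature (hf : IsCutoff I G f) (hθ : IsConnection J I θ)
    (l : Dual ℝ (GroupLieAlgebra J G)) :
    chernWeil J I b hf hθ (SymmetricAlgebra.ι ℝ _ l)
      = equivCurvature b (dForm I) (degConnₗ J I hf hθ) (funForm I f hf.smooth)
          (SymmetricAlgebra.ι ℝ _) l := by
  conv_rhs => rw [← b.sum_dual_apply_smul_coord l]
  simp only [chernWeil_ι, degCurvature_eq_equivCurvature, map_sum, map_smul]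

theorem cartanParity_comp_chernWeil (hf : IsCutoff I G f) (hθ : IsConnection J I θ) :
    (cartanParity J I).comp (chernWeil J I b hf hθ) = chernWeil J I b hf hθ := by
  refine algHom_ext_symmetricAlgebra fun l => ?_
  rw [AlgHom.comp_apply, chernWeil_ι_eq_equivCurvature, equivCurvature_apply, cartanParity, map_sub,
    Algebra.TensorProduct.map_tmul, Algebra.TensorProduct.map_tmul,
    parity_curvature b (parityForm_degConn J I hf hθ) (dForm_parityForm I), map_add, map_neg,
    map_one, map_one, parityForm_funForm]
  rfl

variable [J.Boundaryless]

/-- The adjoint representation at `g`, as an endomorphism of the Lie algebra. -/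
def adHom (g : G) : GroupLieAlgebra J G →ₗ⁅ℝ⁆ GroupLieAlgebra J G where
  __ := Ad J g
  map_lie' := Ad_lie J g _ _

variable [ContMDiffSMul J I ∞ G M]

theorem actCartan_chernWeil (hf : IsCutoff I G f) (hθ : IsConnection J I θ) (g : G)
    (F : Poly J G) :
    actCartan J I g (chernWeil J I b hf hθ F) = chernWeil J I b hf hθ (actPoly J g F) := by
  suffices h : (actCartan J I g).comp (chernWeil J I b hf hθ)
      = (chernWeil J I b hf hθ).comp (actPoly J g) from DFunLike.congr_fun h F
  have actPoly_ι (l : Dual ℝ (GroupLieAlgebra J G)) : actPoly J g (SymmetricAlgebra.ι ℝ _ l)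
      = SymmetricAlgebra.ι ℝ _ (l ∘ₗ (adHom J g⁻¹ : GroupLieAlgebra J G →ₗ[ℝ] _)) :=
    SymmetricAlgebra.lift_ι_apply ..
  refine algHom_ext_symmetricAlgebra fun l => ?_
  rw [AlgHom.comp_apply, AlgHom.comp_apply, actPoly_ι, chernWeil_ι_eq_equivCurvature,
    chernWeil_ι_eq_equivCurvature]
  exact map_equivCurvature b (dForm_pullbackForm I _ (smul_contMDiff J I g⁻¹))
    (A := adHom J g⁻¹) (actForm_degConn J I hf hθ g) (actForm_funForm J I hf g)
    actPoly_ι l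

theorem cartanD_chernWeil_ι (hf : IsCutoff I G f) (hθ : IsConnection J I θ)
    (l : Dual ℝ (GroupLieAlgebra J G)) :
    cartanD J I b (chernWeil J I b hf hθ (SymmetricAlgebra.ι ℝ _ l))
      = -∑ c, (1 ⊗ₜ degConn J I hf hθ (b.coord c))
          * chernWeil J I b hf hθ (SymmetricAlgebra.ι ℝ _ (coad (b c) l)) := by
  simp only [chernWeil_ι_eq_equivCurvature]
  exact tensorD_equivCurvature b (θ := degConnₗ J I hf hθ) (d := dForm I)
    (i := fun a => contrForm J I (b a)) (parityForm_degConn J I hf hθ)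
    (commute_funForm I hf.smooth) (dForm_mul I) (fun l => dForm_dForm I (degConn J I hf hθ l))
    (degConn_mul_swap J I hf hθ) (fun l m => commute_dForm_degConn J I hf hθ l _)
    (fun a => contrForm_mul J I (b a)) (fun a => contrForm_funForm J I hf.smooth (b a))
    (fun a => contrForm_degConn J I hf hθ (b a))
    (fun a => contrForm_dForm_degConn J I hf hθ (b a)) (SymmetricAlgebra.ι ℝ _) l

/-- By the Bianchi identity `D` acts on polynomials in the curvature through the coadjoint
representation, under which invariant polynomials are annihilated. -/
theorem cartanD_chernWeil (hf : IsCutoff I G f) (hθ : IsConnection J I θ) {F : Poly J G}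
    (hF : F ∈ invPoly J G) : cartanD J I b (chernWeil J I b hf hθ F) = 0 := by
  have hskew : IsSkewDerivation (cartanParity J I) (cartanD J I b (M := M)) := cartanD_mul J I b
  rw [hskew.apply_algHom_symmetricAlgebra (chernWeil_commute J I b hf hθ)
    (cartanParity_comp_chernWeil J I b hf hθ)
    (δ := fun c => symDerivation (SymmetricAlgebra.ι ℝ _ ∘ₗ coad (b c)))
    (T := fun c => 1 ⊗ₜ degConn J I hf hθ (b.coord c)) fun l => ?_]
  · simp only [symDerivation_coad_eq_zero_of_mem_invPoly J hF, map_zero, mul_zero,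
      Finset.sum_const_zero, neg_zero]
  · simpa only [symDerivation_ι, LinearMap.comp_apply] using cartanD_chernWeil_ι J I b hf hθ l

theorem chernWeil_mem_closedForms (hf : IsCutoff I G f) (hθ : IsConnection J I θ) {F : Poly J G}
    (hF : F ∈ invPoly J G) : chernWeil J I b hf hθ F ∈ closedForms J I b (M := M) :=
  ⟨fun g => by rw [actCartan_chernWeil, hF g], cartanD_chernWeil J I b hf hθ hF⟩

/-- The Chern–Weil map from invariant polynomials to cocycles of the Cartan model; its composition
with `cohomClass` is the degenerate Chern–Weil homomorphism. -/
def chernWeilCocycle (hf : IsCutoff I G f) (hθ : IsConnection J I θ) :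
    invPoly J G →ₐ[ℝ] Cocycle J I M b :=
  ((chernWeil J I b hf hθ).comp (invPoly J G).val).codRestrict (closedForms J I b)
    fun F => chernWeil_mem_closedForms J I b hf hθ F.2

end ChernWeilHomomorphism

end

end DegCW

open DegCW in
theorem theorem2p1_general
    {EG : Type*} [NormedAddCommGroup EG] [NormedSpace ℝ EG] [FiniteDimensional ℝ EG]
    {HG : Type*} [TopologicalSpace HG] (J : ModelWithCorners ℝ EG HG) [J.Boundaryless]
    {G : Type*} [TopologicalSpace G] [ChartedSpace HG G] [Group G] [LieGroup J ∞ G]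
    {κ : Type*} [Fintype κ] (b : Basis κ ℝ (GroupLieAlgebra J G))
    {E : Type*} [NormedAddCommGroup E] [NormedSpace ℝ E] [FiniteDimensional ℝ E]
    {H : Type*} [TopologicalSpace H] (I : ModelWithCorners ℝ E H)
    {W : Type*} [TopologicalSpace W] [ChartedSpace H W] [IsManifold I ∞ W]
    [MulAction G W] [ContMDiffSMul J I ∞ G W]
    {f : W → ℝ} (hf : IsCutoff I G f)
    {θ : (x : W) → TangentSpace I x →ₗ[ℝ] GroupLieAlgebra J G} (hθ : IsConnection J I θ) :
    (∀ F ∈ invPoly J G, chernWeil J I b hf hθ F ∈ EquivForm J I G W ∧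
      cartanD J I b (chernWeil J I b hf hθ F) = 0) ∧
    (∀ (q : ℕ), ∀ F ∈ polyDeg J G q,
      chernWeil J I b hf hθ F ∈ cartanDeg J I G W (2 * q)) ∧
    ∃ cw : invPoly J G →ₐ[ℝ] EquivCohomology J I W b,
      ∀ F : invPoly J G, ∃ h : chernWeil J I b hf hθ F ∈ closedForms J I b,
        cw F = cohomClass J I W b ⟨chernWeil J I b hf hθ F, h⟩ :=
  ⟨fun _ hF => chernWeil_mem_closedForms J I b hf hθ hF,
    fun q _ hF => chernWeil_mem_cartanDeg J I b hf hθ q hF,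
    (cohomClass J I W b).comp (chernWeilCocycle J I b hf hθ),
    fun F => ⟨chernWeil_mem_closedForms J I b hf hθ F.2, rfl⟩⟩

theorem theorem2p1
    -- a compact connected Lie group `G`, with a basis `b = (ξ_a)` of its Lie algebra
    {EG : Type*} [NormedAddCommGroup EG] [NormedSpace ℝ EG] [FiniteDimensional ℝ EG]
    {HG : Type*} [TopologicalSpace HG] (J : ModelWithCorners ℝ EG HG) [J.Boundaryless]
    {G : Type*} [TopologicalSpace G] [ChartedSpace HG G] [Group G] [LieGroup J ∞ G]
    [T2Space G] [CompactSpace G] [ConnectedSpace G]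
    {κ : Type*} [Fintype κ] (b : Module.Basis κ ℝ (GroupLieAlgebra J G))
    -- a compact smooth manifold `W`, possibly with boundary, with a smooth action of `G`
    {E : Type*} [NormedAddCommGroup E] [NormedSpace ℝ E] [FiniteDimensional ℝ E]
    {H : Type*} [TopologicalSpace H] (I : ModelWithCorners ℝ E H)
    {W : Type*} [TopologicalSpace W] [ChartedSpace H W] [IsManifold I ∞ W]
    [T2Space W] [CompactSpace W]
    [MulAction G W] [ContMDiffSMul J I ∞ G W]
    -- which is a degenerate principal bundle, with a degenerate connection `f θ`
    (_hW : DegCW.IsDegeneratePrincipalBundle I (M := W) G)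
    {f : W → ℝ} (hf : DegCW.IsCutoff I G f)
    {θ : (x : W) → TangentSpace I x →ₗ[ℝ] GroupLieAlgebra J G} (hθ : DegCW.IsConnection J I θ) :
    -- invariant polynomials are sent to `D`-closed equivariant forms
    (∀ F ∈ DegCW.invPoly J G, DegCW.chernWeil J I b hf hθ F ∈ DegCW.EquivForm J I G W ∧
      DegCW.cartanD J I b (DegCW.chernWeil J I b hf hθ F) = 0) ∧
    -- polynomials of degree `q` are sent to elements of degree `2 q`
    (∀ (q : ℕ), ∀ F ∈ DegCW.polyDeg J G q,
      DegCW.chernWeil J I b hf hθ F ∈ DegCW.cartanDeg J I G W (2 * q)) ∧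
    -- the induced homomorphism of algebras from invariant polynomials to equivariant cohomology
    ∃ cw : DegCW.invPoly J G →ₐ[ℝ] DegCW.EquivCohomology J I W b,
      ∀ F : DegCW.invPoly J G, ∃ h : DegCW.chernWeil J I b hf hθ F ∈ DegCW.closedForms J I b,
        cw F = DegCW.cohomClass J I W b ⟨DegCW.chernWeil J I b hf hθ F, h⟩ :=
  theorem2p1_general J b I hf hθ
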